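/- **Conventions.** Let $(Z,d,\nu)$ be a metric space with a Borel measure, and let $1\le p<\infty$. Functions are identified when they agree almost everywhere; $⨍$ denotes the integral mean and $B(x,r)$ an open ball. * $M^{1,p}(Z)$ is the space of $u\in L^p(Z)$ with $\|u\|_{M^{1,p}}^p=\|u\|_{L^p}^p+\inf_g\|g\|_{L^p}^p<\infty$, where $g$ runs over the Hajłasz gradients of $u$, i.e. the measurable $g:Z\to[0,\infty]$ such that $|u(x)-u(y)|\le d(x,y)(g(x)+g(y))$ for all $x,y$ outside a null set. * $N^{1,p}(Z)$ is the space of $u\in L^p(Z)$ with $\|u\|_{N^{1,p}}^p=\|u\|_{L^p}^p+\inf_g\|g\|_{L^p}^p<\infty$, where $g$ runs over the upper gradients of representatives $v$ of $u$, i.e. the Borel $g:Z\to[0,\infty]$ with $|v(\gamma(b))-v(\gamma(a))|\le\int_\gamma g\,ds$ for all rectifiable curves $\gamma:[a,b]\to Z$. * $Z$ admits a $p$-Poincaré inequality if there are $C>0$, $\lambda\ge1$ such that $⨍_{B(x,r)}|u-u_{B(x,r)}|\,d\nu\le r\,\bigl(⨍_{B(x,\lambda r)}(Cg)^p\,d\nu\bigr)^{1/p}$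 for all $x\in Z$, $r>0$, all $u$ integrable on balls and all upper gradients $g$ of $u$. * For $R\in(0,\infty]$ and $\alpha>0$, $B^\alpha_{p,\infty}(Z)$ is the space of $f\in L^p(Z)$ for which $$\|f\|_{B^\alpha_{p,\infty}}=\|f\|_{L^p}+\sup_{0<t<R}\Bigl(\int_Z ⨍_{B(y,t)}\frac{|f(y)-f(z)|^p}{t^{\alpha p}}\,d\nu(z)\,d\nu(y)\Bigr)^{1/p}$$ is finite. The statements below hold for every choice of $R\in(0,\infty]$. Let $(X,d,\mu)$ be a metric space with a Borel measure, and let $\Omega\subset X$ be a domain (non-empty, open, connected), considered with the metric and the measure inherited from $X$, such that $\mu\lfloor_\Omega$ is doubling: for some $c$, $0<\mu(B(x,2r)\cap\Omega)\le c\,\mu(B(x,r)\cap\Omega)<\infty$ for all $x\in\overline\Omega$, $r>0$. Let $F\subset\overline\Omega$ be a bounded set with a Borel measure $\nu$ that satisfies an upper codimension-$\theta$ bound for some $\theta>0$: there is $c$ such that $\nu(B(z,r)\cap F)\le c\,\mu(B(z,r)\cap\Omega)/r^\theta$ for all $z\in F$ and $0<r\le 2\operatorname{diam}F$ (if $F$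 is a single point, for all $0<r\le\rho$ with some $\rho>0$). A function $f$ on $F$ is called the trace of a function $u$ on $\Omega$ if $$\lim_{r\to0^+}⨍_{B(z,r)\cap\Omega}|u(x)-f(z)|\,d\mu(x)=0\quad\text{for $\nu$-a.e. }z\in F.$$ **Theorem.** Let $p>\theta$ and $p\ge1$. 1. There is a bounded linear operator $T:M^{1,p}(\Omega)\to B^{1-\theta/p}_{p,\infty}(F)$ such that $Tu$ is the trace of $u$ for every $u\in M^{1,p}(\Omega)$. 2. If $\Omega$ admits a $p$-Poincaré inequality, then there is a bounded linear operator $T:N^{1,p}(\Omega)\to B^{1-\theta/p}_{p,\infty}(F)$ such that $Tu$ is the trace of $u$ for every $u\in N^{1,p}(\Omega)$. 3. In general, the operator in 1. is not surjective, and its values need not have any higher smoothness. Namely, let $X=\mathbb R^2$ with the Euclidean metric and Lebesgue measure, $\Omega=\{(x_1,x_2):0<x_2<x_1^2<x_1\}$, $F=\partial\Omega$, and let $\nu$ be the one-dimensional Hausdorff measure on $\partial\Omega$. These satisfy all the hypotheses with $\theta=2$, and for every $p\in(2,3)$ the operator $T:M^{1,p}(\Omega)\to B^{1-2/p}_{p,\infty}(\partial\Omega)$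 is not surjective, and there is $u\in M^{1,p}(\Omega)$ with $Tu\in B^{1-2/p}_{p,\infty}(\partial\Omega)\setminus\bigcup_{\alpha>1-2/p}B^\alpha_{p,\infty}(\partial\Omega)$. -/

import Mathlib

open MeasureTheory Set Filter Topology
open scoped ENNReal NNReal

noncomputable section

/-- The Besov norm of smoothness `α`, integrability `p` and third index `∞` of a function `f` on a
metric measure space `(Z, ν)`, with the parameter `R ∈ (0, ∞]`:
`‖f‖_{L^p} + sup_{0 < t < R} (∫_Z ⨍_{B(y,t)} |f(y) - f(z)|^p / t^(α p) dν(z) dν(y))^(1/p)`.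
A measurable function belongs to `B^α_{p,∞}(Z)` iff this is finite. -/
def besovNorm {Z : Type*} [MetricSpace Z] [MeasurableSpace Z]
    (R : ℝ≥0∞) (α p : ℝ) (ν : Measure Z) (f : Z → ℝ) : ℝ≥0∞ :=
  (∫⁻ y, ‖f y‖ₑ ^ p ∂ν) ^ (1 / p) +
    ⨆ (t : ℝ) (_ : 0 < t) (_ : ENNReal.ofReal t < R),
      (∫⁻ y, ⨍⁻ z in Metric.ball y t,
        ‖f y - f z‖ₑ ^ p / ENNReal.ofReal (t ^ (α * p)) ∂ν ∂ν) ^ (1 / p)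

/-- `g : Z → [0, ∞]` is a (measurable) Hajłasz gradient of `u`. -/
def IsHajlaszGradient {Z : Type*} [MetricSpace Z] [MeasurableSpace Z]
    (μ : Measure Z) (u : Z → ℝ) (g : Z → ℝ≥0∞) : Prop :=
  AEMeasurable g μ ∧ ∃ E : Set Z, μ E = 0 ∧
    ∀ x ∉ E, ∀ y ∉ E, ‖u x - u y‖ₑ ≤ edist x y * (g x + g y)

/-- The norm of the Hajłasz space `M^{1,p}(Z)`. -/
def hajlaszNorm {Z : Type*} [MetricSpace Z] [MeasurableSpace Z]
    (p : ℝ) (μ : Measure Z) (u : Z →ₘ[μ] ℝ) : ℝ≥0∞ :=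
  ((∫⁻ x, ‖u x‖ₑ ^ p ∂μ) +
    ⨅ (g : Z → ℝ≥0∞) (_ : IsHajlaszGradient μ u g), ∫⁻ x, g x ^ p ∂μ) ^ (1 / p)

/-- The integral `∫_γ g ds` of `g` along the rectifiable curve `γ : [a, b] → Z`, that is, the
integral over `[0, length γ]` of `g` composed with the arc length parametrization of `γ`. -/
def arcLengthIntegral {Z : Type*} [MetricSpace Z] (g : Z → ℝ≥0∞) (γ : ℝ → Z) (a b : ℝ) : ℝ≥0∞ :=
  ∫⁻ s in Icc 0 (eVariationOn γ (Icc a b)).toReal, g (naturalParameterization γ (Icc a b) a s)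

/-- `g : Z → [0, ∞]` is an upper gradient of `u`: it is Borel and `|u(γ(b)) - u(γ(a))| ≤ ∫_γ g ds`
for all rectifiable curves `γ : [a, b] → Z`. Real-valued `u` are enough: if `u` takes the values
`±∞` and `∫_γ g ds = ∞` for all curves with an end point where it does, then `g` is also an
upper gradient of the function obtained by replacing these values by `0`. -/
def IsUpperGradient {Z : Type*} [MetricSpace Z] [MeasurableSpace Z]
    (u : Z → ℝ) (g : Z → ℝ≥0∞) : Prop :=
  Measurable g ∧ ∀ (a b : ℝ) (γ : ℝ → Z), a ≤ b → ContinuousOn γ (Icc a b) →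
    BoundedVariationOn γ (Icc a b) → ‖u (γ b) - u (γ a)‖ₑ ≤ arcLengthIntegral g γ a b

/-- The norm of the Newtonian space `N^{1,p}(Z)`. As `u` is a class of functions modulo equality
almost everywhere, the infimum runs over the upper gradients of all its representatives. -/
def newtonNorm {Z : Type*} [MetricSpace Z] [MeasurableSpace Z]
    (p : ℝ) (μ : Measure Z) (u : Z →ₘ[μ] ℝ) : ℝ≥0∞ :=
  ((∫⁻ x, ‖u x‖ₑ ^ p ∂μ) +
    ⨅ (v : Z → ℝ) (_ : v =ᵐ[μ] u) (g : Z → ℝ≥0∞) (_ : IsUpperGradient v g),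
      ∫⁻ x, g x ^ p ∂μ) ^ (1 / p)

section Subspaces

variable {Z : Type*} [MeasurableSpace Z]

theorem lintegral_rpow_add_lt_top {p : ℝ} (hp : 1 ≤ p) {μ : Measure Z} {f g : Z → ℝ≥0∞}
    (hf : AEMeasurable f μ) (h1 : ∫⁻ x, f x ^ p ∂μ < ∞) (h2 : ∫⁻ x, g x ^ p ∂μ < ∞) :
    ∫⁻ x, (f x + g x) ^ p ∂μ < ∞ := by
  calc ∫⁻ x, (f x + g x) ^ p ∂μ
      ≤ ∫⁻ x, 2 ^ (p - 1) * (f x ^ p + g x ^ p) ∂μ :=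
        lintegral_mono fun x => ENNReal.rpow_add_le_mul_rpow_add_rpow _ _ hp
    _ = 2 ^ (p - 1) * (∫⁻ x, f x ^ p ∂μ + ∫⁻ x, g x ^ p ∂μ) := by
        rw [lintegral_const_mul' _ _ (by finiteness), lintegral_add_left' (hf.pow_const p)]
    _ < ∞ := by finiteness

theorem lintegral_rpow_const_mul_lt_top {p : ℝ} (hp : 1 ≤ p) {μ : Measure Z} {f : Z → ℝ≥0∞}
    (c : ℝ≥0∞) (hc : c ≠ ∞) (h1 : ∫⁻ x, f x ^ p ∂μ < ∞) :
    ∫⁻ x, (c * f x) ^ p ∂μ < ∞ := by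
  have hp0 : 0 ≤ p := by linarith
  simp_rw [ENNReal.mul_rpow_of_nonneg _ _ hp0]
  rw [lintegral_const_mul' _ _ (by finiteness)]
  finiteness

theorem lintegral_enorm_rpow_add_lt_top {p : ℝ} (hp : 1 ≤ p) {μ : Measure Z} {u v : Z →ₘ[μ] ℝ}
    (h1 : ∫⁻ x, ‖u x‖ₑ ^ p ∂μ < ∞) (h2 : ∫⁻ x, ‖v x‖ₑ ^ p ∂μ < ∞) :
    ∫⁻ x, ‖(u + v) x‖ₑ ^ p ∂μ < ∞ := by
  refine lt_of_le_of_lt (lintegral_mono_ae ?_)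
    (lintegral_rpow_add_lt_top hp u.aestronglyMeasurable.enorm h1 h2)
  filter_upwards [AEEqFun.coeFn_add u v] with x hx
  rw [hx]
  exact ENNReal.rpow_le_rpow (enorm_add_le _ _) (by linarith)

theorem lintegral_enorm_rpow_smul_lt_top {p : ℝ} (hp : 1 ≤ p) {μ : Measure Z} {u : Z →ₘ[μ] ℝ}
    (c : ℝ) (h1 : ∫⁻ x, ‖u x‖ₑ ^ p ∂μ < ∞) : ∫⁻ x, ‖(c • u) x‖ₑ ^ p ∂μ < ∞ := by
  refine lt_of_le_of_lt (lintegral_mono_ae ?_)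
    (lintegral_rpow_const_mul_lt_top hp ‖c‖ₑ (by finiteness) h1)
  filter_upwards [AEEqFun.coeFn_smul c u] with x hx
  rw [hx, Pi.smul_apply, smul_eq_mul, enorm_mul]

theorem lintegral_enorm_rpow_zero_lt_top {p : ℝ} (hp : 1 ≤ p) {μ : Measure Z} :
    ∫⁻ x, ‖(0 : Z →ₘ[μ] ℝ) x‖ₑ ^ p ∂μ < ∞ := by
  have hp0 : 0 < p := by linarith
  have : ∫⁻ x, ‖(0 : Z →ₘ[μ] ℝ) x‖ₑ ^ p ∂μ = ∫⁻ _, 0 ∂μ := by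
    refine lintegral_congr_ae ?_
    filter_upwards [AEEqFun.coeFn_zero (μ := μ) (α := Z) (β := ℝ)] with x hx
    simp [hx, hp0]
  simp [this]

variable [MetricSpace Z]

theorem hajlaszNorm_lt_top_iff {p : ℝ} (hp : 1 ≤ p) {μ : Measure Z} {u : Z →ₘ[μ] ℝ} :
    hajlaszNorm p μ u < ∞ ↔ ∫⁻ x, ‖u x‖ₑ ^ p ∂μ < ∞ ∧
      ∃ g, IsHajlaszGradient μ u g ∧ ∫⁻ x, g x ^ p ∂μ < ∞ := by
  have hp0 : 0 < 1 / p := by positivity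
  rw [hajlaszNorm, ENNReal.rpow_lt_top_iff_of_pos hp0, ENNReal.add_lt_top]
  simp only [iInf_lt_iff, exists_prop]

theorem newtonNorm_lt_top_iff {p : ℝ} (hp : 1 ≤ p) {μ : Measure Z} {u : Z →ₘ[μ] ℝ} :
    newtonNorm p μ u < ∞ ↔ ∫⁻ x, ‖u x‖ₑ ^ p ∂μ < ∞ ∧
      ∃ v : Z → ℝ, v =ᵐ[μ] u ∧ ∃ g, IsUpperGradient v g ∧ ∫⁻ x, g x ^ p ∂μ < ∞ := by
  have hp0 : 0 < 1 / p := by positivity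
  rw [newtonNorm, ENNReal.rpow_lt_top_iff_of_pos hp0, ENNReal.add_lt_top]
  simp only [iInf_lt_iff, exists_prop]

/-- The Hajłasz space `M^{1,p}(Z)`, as a space of functions modulo equality almost everywhere. -/
def HajlaszSpace (p : ℝ) (hp : 1 ≤ p) (μ : Measure Z) : Submodule ℝ (Z →ₘ[μ] ℝ) where
  carrier := {u | hajlaszNorm p μ u < ∞}
  zero_mem' := by
    refine (hajlaszNorm_lt_top_iff hp).2 ⟨lintegral_enorm_rpow_zero_lt_top hp, fun _ => 0, ?_, ?_⟩
    · have h0 := AEEqFun.coeFn_zero (μ := μ) (α := Z) (β := ℝ)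
      refine ⟨aemeasurable_const, _, ae_iff.1 h0, fun x hx y hy => ?_⟩
      simp only [mem_ofPred_eq, not_not] at hx hy
      simp [hx, hy]
    · have : 0 < p := by linarith
      simp [ENNReal.zero_rpow_of_pos this]
  add_mem' := by
    intro u v hu hv
    obtain ⟨hu1, g, ⟨hgm, E, hE, hg⟩, hg1⟩ := (hajlaszNorm_lt_top_iff hp).1 hu
    obtain ⟨hv1, k, ⟨hkm, D, hD, hk⟩, hk1⟩ := (hajlaszNorm_lt_top_iff hp).1 hv
    refine (hajlaszNorm_lt_top_iff hp).2 ⟨lintegral_enorm_rpow_add_lt_top hp hu1 hv1,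
      fun x => g x + k x, ⟨hgm.add hkm, E ∪ D ∪ {x | ¬ (u + v) x = u x + v x}, ?_, ?_⟩,
      lintegral_rpow_add_lt_top hp hgm hg1 hk1⟩
    · exact measure_union_null (measure_union_null hE hD) (ae_iff.1 (AEEqFun.coeFn_add u v))
    · intro x hx y hy
      simp only [mem_union, mem_ofPred_eq, not_or, not_not] at hx hy
      rw [hx.2, hy.2, show u x + v x - (u y + v y) = (u x - u y) + (v x - v y) by ring]
      calc ‖(u x - u y) + (v x - v y)‖ₑ ≤ ‖u x - u y‖ₑ + ‖v x - v y‖ₑ := enorm_add_le _ _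
        _ ≤ edist x y * (g x + g y) + edist x y * (k x + k y) :=
          add_le_add (hg x hx.1.1 y hy.1.1) (hk x hx.1.2 y hy.1.2)
        _ = edist x y * (g x + k x + (g y + k y)) := by ring
  smul_mem' := by
    intro c u hu
    obtain ⟨hu1, g, ⟨hgm, E, hE, hg⟩, hg1⟩ := (hajlaszNorm_lt_top_iff hp).1 hu
    refine (hajlaszNorm_lt_top_iff hp).2 ⟨lintegral_enorm_rpow_smul_lt_top hp c hu1,
      fun x => ‖c‖ₑ * g x, ⟨hgm.const_mul _, E ∪ {x | ¬ (c • u) x = c * u x}, ?_, ?_⟩,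
      lintegral_rpow_const_mul_lt_top hp _ (by finiteness) hg1⟩
    · exact measure_union_null hE (ae_iff.1 (AEEqFun.coeFn_smul c u))
    · intro x hx y hy
      simp only [mem_union, mem_ofPred_eq, not_or, not_not] at hx hy
      rw [hx.2, hy.2, ← mul_sub, enorm_mul]
      calc ‖c‖ₑ * ‖u x - u y‖ₑ ≤ ‖c‖ₑ * (edist x y * (g x + g y)) := by
            gcongr; exact hg x hx.1 y hy.1
        _ = edist x y * (‖c‖ₑ * g x + ‖c‖ₑ * g y) := by ring

/-- The Newtonian space `N^{1,p}(Z)`, as a space of functions modulo equality almost everywhere. -/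
def NewtonSpace (p : ℝ) (hp : 1 ≤ p) (μ : Measure Z) : Submodule ℝ (Z →ₘ[μ] ℝ) where
  carrier := {u | newtonNorm p μ u < ∞}
  zero_mem' := by
    refine (newtonNorm_lt_top_iff hp).2 ⟨lintegral_enorm_rpow_zero_lt_top hp, fun _ => 0,
      (AEEqFun.coeFn_zero (μ := μ) (α := Z) (β := ℝ)).symm, fun _ => 0,
      ⟨measurable_const, ?_⟩, ?_⟩
    · intros; simp
    · have : 0 < p := by linarith
      simp [ENNReal.zero_rpow_of_pos this]
  add_mem' := by
    intro u v hu hv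
    obtain ⟨hu1, u', hu', g, ⟨hgm, hg⟩, hg1⟩ := (newtonNorm_lt_top_iff hp).1 hu
    obtain ⟨hv1, v', hv', k, ⟨hkm, hk⟩, hk1⟩ := (newtonNorm_lt_top_iff hp).1 hv
    refine (newtonNorm_lt_top_iff hp).2 ⟨lintegral_enorm_rpow_add_lt_top hp hu1 hv1,
      u' + v', (hu'.add hv').trans (AEEqFun.coeFn_add u v).symm, fun x => g x + k x,
      ⟨hgm.add hkm, ?_⟩, lintegral_rpow_add_lt_top hp hgm.aemeasurable hg1 hk1⟩
    intro a b γ hab hc hbv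
    simp only [Pi.add_apply]
    rw [show u' (γ b) + v' (γ b) - (u' (γ a) + v' (γ a))
      = (u' (γ b) - u' (γ a)) + (v' (γ b) - v' (γ a)) by ring]
    exact (enorm_add_le _ _).trans ((add_le_add (hg a b γ hab hc hbv) (hk a b γ hab hc hbv)).trans
      (le_lintegral_add _ _))
  smul_mem' := by
    intro c u hu
    obtain ⟨hu1, u', hu', g, ⟨hgm, hg⟩, hg1⟩ := (newtonNorm_lt_top_iff hp).1 hu
    refine (newtonNorm_lt_top_iff hp).2 ⟨lintegral_enorm_rpow_smul_lt_top hp c hu1,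
      c • u', (hu'.const_smul c).trans (AEEqFun.coeFn_smul c u).symm, fun x => ‖c‖ₑ * g x,
      ⟨hgm.const_mul _, ?_⟩, lintegral_rpow_const_mul_lt_top hp _ (by finiteness) hg1⟩
    intro a b γ hab hc hbv
    simp only [Pi.smul_apply, smul_eq_mul]
    rw [← mul_sub, enorm_mul]
    exact (mul_le_mul_right (hg a b γ hab hc hbv) _).trans (lintegral_const_mul_le _ _)

end Subspaces

/-- `(Z, μ)` admits a `q`-Poincaré inequality: for some `C > 0` and `L ≥ 1`,
`⨍_B |u - u_B| dμ ≤ rad(B) (⨍_{L B} (C g)^q dμ)^(1/q)` for all balls `B` of `Z`, all functions `u`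
that are integrable on balls, and all upper gradients `g` of `u`. -/
def HasPoincareInequality {Z : Type*} [MetricSpace Z] [MeasurableSpace Z]
    (q : ℝ) (μ : Measure Z) : Prop :=
  ∃ C L : ℝ, 0 < C ∧ 1 ≤ L ∧ ∀ (u : Z → ℝ) (g : Z → ℝ≥0∞),
    (∀ (x : Z) (r : ℝ), IntegrableOn u (Metric.ball x r) μ) → IsUpperGradient u g →
    ∀ (x : Z) (r : ℝ), 0 < r →
      ⨍⁻ y in Metric.ball x r, ‖u y - ⨍ z in Metric.ball x r, u z ∂μ‖ₑ ∂μ ≤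
        ENNReal.ofReal r *
          (⨍⁻ y in Metric.ball x (L * r), (ENNReal.ofReal C * g y) ^ q ∂μ) ^ (1 / q)

/-- The measure `μ` restricted to the set `Ω`, as a measure on the metric space `Ω`. -/
abbrev measureOn {X : Type*} [MeasurableSpace X] (μ : Measure X) (Ω : Set X) : Measure Ω :=
  Measure.comap (Subtype.val : Ω → X) μ

/-- The restriction of `μ` to `Ω` is doubling and non-trivial. -/
def IsDoublingOn {X : Type*} [MetricSpace X] [MeasurableSpace X]
    (μ : Measure X) (Ω : Set X) : Prop :=
  ∃ c : ℝ≥0, ∀ x ∈ closure Ω, ∀ r : ℝ, 0 < r →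
    0 < μ (Metric.ball x (2 * r) ∩ Ω) ∧
    μ (Metric.ball x (2 * r) ∩ Ω) ≤ c * μ (Metric.ball x r ∩ Ω) ∧
    μ (Metric.ball x r ∩ Ω) < ∞

/-- The measure `ν` on the set `F` satisfies an upper codimension-`θ` bound with respect to the
restriction of `μ` to `Ω`: `ν(B(z,r) ∩ F) ≤ c μ(B(z,r) ∩ Ω) / r^θ` for `z ∈ F` and `0 < r ≤ ρ`.
If `F` has at least two points, then one may take `ρ = 2 diam F`; a positive `ρ` is used so that
the condition is not void for a one-point set. -/
def HasUpperCodimBound {X : Type*} [MetricSpace X] [MeasurableSpace X]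
    (μ : Measure X) (Ω F : Set X) (ν : Measure F) (θ : ℝ) : Prop :=
  ∃ (c : ℝ≥0) (ρ : ℝ), 0 < ρ ∧ 2 * Metric.diam F ≤ ρ ∧ ∀ (z : F) (r : ℝ), 0 < r → r ≤ ρ →
    ν (Metric.ball z r) ≤
      c * μ (Metric.ball (z : X) r ∩ Ω) / ENNReal.ofReal (r ^ θ)

/-- `f : F → ℝ` is the trace of `u : Ω → ℝ`: for `ν`-a.e. `z ∈ F`,
`⨍_{B(z,r) ∩ Ω} |u(x) - f(z)| dμ(x) → 0` as `r → 0⁺`. -/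
def HasTrace {X : Type*} [MetricSpace X] [MeasurableSpace X]
    (μ : Measure X) (Ω F : Set X) (ν : Measure F) (u : Ω → ℝ) (f : F → ℝ) : Prop :=
  ∀ᵐ z : F ∂ν, Tendsto
    (fun r : ℝ => ⨍⁻ x in (Subtype.val : Ω → X) ⁻¹' Metric.ball (z : X) r,
      ‖u x - f z‖ₑ ∂(measureOn μ Ω)) (𝓝[>] 0) (𝓝 0)

/-- The linear operator `T`, defined on a space `V` of functions on `Ω` with the norm `N`, maps each
function to its trace on `F` and is bounded from `V` to `B^α_{p,∞}(F)`. -/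
def IsBoundedTraceOperator {X : Type*} [MetricSpace X] [MeasurableSpace X]
    (μ : Measure X) (Ω F : Set X) (ν : Measure F)
    (V : Submodule ℝ (Ω →ₘ[measureOn μ Ω] ℝ)) (N : (Ω →ₘ[measureOn μ Ω] ℝ) → ℝ≥0∞)
    (α p : ℝ) (T : V →ₗ[ℝ] (F →ₘ[ν] ℝ)) : Prop :=
  (∀ u : V, HasTrace μ Ω F ν (u : Ω →ₘ[measureOn μ Ω] ℝ) (T u)) ∧
  ∀ R : ℝ≥0∞, 0 < R → ∃ C : ℝ≥0, ∀ u : V, besovNorm R α p ν (T u) ≤ C * N u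

/-- The cusp `{(x₁, x₂) : 0 < x₂ < x₁² < x₁}` in the Euclidean plane. -/
def cuspDomain : Set (EuclideanSpace ℝ (Fin 2)) :=
  {x | 0 < x 1 ∧ x 1 < x 0 ^ 2 ∧ x 0 ^ 2 < x 0}

/-- The one-dimensional Hausdorff measure on the boundary of the cusp. -/
def cuspBoundaryMeasure : Measure (frontier cuspDomain) :=
  Measure.hausdorffMeasure 1

end

/-!
The existence of the traces rests on one estimate. Let `u` and `g` satisfy a Poincaré inequality
on the balls centred in `F`; for a Hajłasz gradient `g` this is a direct consequence of the
definition (`SatisfiesPoincare.of_hajlasz`), and for an upper gradient it is the assumed inequality,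
moved from balls centred in `Ω` to balls centred in its closure
(`HasPoincareInequality.exists_satisfiesPoincare`). Then the averages of `u` over the balls
`B(z, r / 2 ^ j) ∩ Ω` have differences that are bounded by the terms of the series `potential`, so
that they converge at each `z` where this series is finite; the limit `f z` is the trace, and the
mean deviation of `u` from `f z` on `B(z, r) ∩ Ω` is at most a constant times the potential
(`IsDoublingWith.exists_tendsto_meanDev`, `IsDoublingWith.meanDev_le_potential`). By the codimension
bound, integrating averages over balls of radius `r` against `ν` costs a factor `r ^ (-θ)`
(`KernelBound.lintegral_setLAverage_le`). As `θ < p`, Minkowski's inequality and a geometric series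
bound the `L^p(ν)`-norm of the potential by `r ^ (1 - θ / p)` times the `L^p`-norm of `g`
(`KernelBound.lintegral_potential_le`). In particular, the potential is finite almost everywhere.

For the Besov norm, two points `y`, `z` of `F` with distance less than `t` satisfy
`|f y - f z| ≲ potential y + potential z` with radius `2 t`, so that the power of `t` is just the
required one (`KernelBound.exists_besovNorm_le`). The measure `ν` need not be doubling; that the
average over balls is nevertheless bounded on `L¹(ν)` holds because `F` is a subset of a doubling
metric space (`IsDoublingWith.exists_lintegral_setLAverage_ball_le`). The trace is unique, hence
linear in `u`.

In the cusp, a ball with centre `z` and radius `r ≤ 1` has a measure comparable to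
`r * min r ((z₁ + r) ^ 2)`. At the tip this is `r ^ 3`, which gives `θ = 2`. At distance `s` from the
tip, however, the codimension is `1` for all radii up to about `s ^ 2`, which is also the distance
of the two edges. The potential with such radii and exponent `1 - 1 / p` shows that the traces on
the two edges are closer to each other than the Besov condition requires, and the Hölder continuous
function `z ↦ z₂ ^ (1 - 2 / p)`, which vanishes on the lower edge only, is not a trace
(`not_hasTrace_cusp`). The lack of additional smoothness comes from the tip: the part of the cusp
with `x₁ < 2 ^ (-k)` has a measure of at most `8 ^ (-k)`, so that spikes of width `2 ^ (-k)` may have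
the height `2 ^ (k (3 / p - 1))`, up to a summable factor, in a function of `M^{1,p}`. The mean
differences at the scale `2 ^ (-k)` of the sum of these spikes on the one-dimensional boundary have
exactly the order that belongs to the smoothness `1 - 2 / p`, up to this factor
(`le_besovNorm_spike`).
-/

noncomputable section

/-! ### Averages, Minkowski's inequality and Tonelli's theorem -/

section Averages

variable {Y : Type*} [MeasurableSpace Y] {m : Measure Y}

theorem setLAverage_le_mul_of_subset {A B : Set Y} {c : ℝ≥0∞} (hAB : A ⊆ B) (h : m B ≤ c * m A)
    (h0 : m B ≠ 0) (htop : m B ≠ ∞) (f : Y → ℝ≥0∞) :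
    ⨍⁻ x in A, f x ∂m ≤ c * ⨍⁻ x in B, f x ∂m := by
  rw [setLAverage_eq, setLAverage_eq, ENNReal.div_eq_inv_mul, ENNReal.div_eq_inv_mul, ← mul_assoc]
  refine mul_le_mul' ?_ (lintegral_mono_set hAB)
  rw [← div_eq_mul_inv, ENNReal.le_div_iff_mul_le (Or.inl h0) (Or.inl htop), mul_comm,
    ← div_eq_mul_inv]
  exact ENNReal.div_le_of_le_mul h

theorem setLAverage_mono {A : Set Y} {f g : Y → ℝ≥0∞} (h : ∀ x, f x ≤ g x) :
    ⨍⁻ x in A, f x ∂m ≤ ⨍⁻ x in A, g x ∂m :=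
  laverage_mono_ae (Eventually.of_forall h)

theorem setLAverage_const_le (A : Set Y) (c : ℝ≥0∞) : ⨍⁻ _x in A, c ∂m ≤ c := by
  rw [setLAverage_eq, setLIntegral_const, ENNReal.mul_div_right_comm, mul_comm]
  by_cases h : m A = 0
  · simp [h]
  by_cases h' : m A = ∞
  · simp [h']
  rw [ENNReal.mul_div_cancel h h']

theorem setLAverage_add_left {A : Set Y} {f : Y → ℝ≥0∞} (hf : Measurable f) (g : Y → ℝ≥0∞) :
    ⨍⁻ x in A, (f x + g x) ∂m = ⨍⁻ x in A, f x ∂m + ⨍⁻ x in A, g x ∂m := by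
  rw [laverage, lintegral_add_left hf]; rfl

theorem setLAverage_const_mul {A : Set Y} (c : ℝ≥0∞) (f : Y → ℝ≥0∞) (hc : c ≠ ∞) :
    ⨍⁻ x in A, c * f x ∂m = c * ⨍⁻ x in A, f x ∂m := by
  rw [laverage, lintegral_const_mul' _ _ hc]; rfl

/-- Jensen's inequality for averages. -/
theorem setLAverage_le_rpow {A : Set Y} {p : ℝ} (hp : 1 ≤ p) {f : Y → ℝ≥0∞} (hf : AEMeasurable f m) :
    ⨍⁻ x in A, f x ∂m ≤ (⨍⁻ x in A, f x ^ p ∂m) ^ (1 / p) := by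
  by_cases h : m A = 0
  · rw [Measure.restrict_eq_zero.2 h]; simp
  by_cases h' : m A = ∞
  · simp [setLAverage_eq, h']
  have : IsProbabilityMeasure ((m.restrict A univ)⁻¹ • m.restrict A) := by
    constructor
    rw [Measure.smul_apply, Measure.restrict_apply_univ, smul_eq_mul, ENNReal.inv_mul_cancel h h']
  have h2 := eLpNorm'_le_eLpNorm'_of_exponent_le (p := 1) (q := p) one_pos hp
    ((m.restrict A univ)⁻¹ • m.restrict A) (f := f)
    ((hf.restrict.smul_measure _).aestronglyMeasurable)
  simpa [eLpNorm', laverage] using h2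

theorem rpow_setLAverage_le {A : Set Y} {p : ℝ} (hp : 1 ≤ p) {f : Y → ℝ≥0∞}
    (hf : AEMeasurable f m) :
    (⨍⁻ x in A, f x ∂m) ^ p ≤ ⨍⁻ x in A, f x ^ p ∂m := by
  have hp0 : 0 < p := by linarith
  calc (⨍⁻ x in A, f x ∂m) ^ p ≤ ((⨍⁻ x in A, f x ^ p ∂m) ^ (1 / p)) ^ p :=
        ENNReal.rpow_le_rpow (setLAverage_le_rpow hp hf) hp0.le
    _ = _ := by rw [← ENNReal.rpow_mul, one_div_mul_cancel hp0.ne', ENNReal.rpow_one]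

/-- Minkowski's inequality for infinite sums. -/
theorem lintegral_Lp_tsum_le {p : ℝ} (hp : 1 ≤ p) {f : ℕ → Y → ℝ≥0∞} (hf : ∀ j, Measurable (f j)) :
    (∫⁻ x, (∑' j, f j x) ^ p ∂m) ^ (1 / p) ≤ ∑' j, (∫⁻ x, f j x ^ p ∂m) ^ (1 / p) := by
  have hp0 : 0 < p := by linarith
  have hfin : ∀ n : ℕ, (∫⁻ x, (∑ j ∈ Finset.range n, f j x) ^ p ∂m) ^ (1 / p) ≤
      ∑ j ∈ Finset.range n, (∫⁻ x, f j x ^ p ∂m) ^ (1 / p) := by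
    intro n
    induction n with
    | zero => simp [hp0]
    | succ n ih =>
      simp_rw [Finset.sum_range_succ]
      refine le_trans ?_ (add_le_add ih le_rfl)
      exact ENNReal.lintegral_Lp_add_le (Finset.measurable_fun_sum _ fun j _ => hf j).aemeasurable
        (hf n).aemeasurable hp
  rw [one_div, ENNReal.rpow_inv_le_iff hp0]
  have hmono : ∀ x, Monotone fun n : ℕ => ∑ j ∈ Finset.range n, f j x := fun x =>
    monotone_nat_of_le_succ fun n => by rw [Finset.sum_range_succ]; exact le_self_add
  have hsup : ∀ x, (∑' j, f j x) ^ p = ⨆ n : ℕ, (∑ j ∈ Finset.range n, f j x) ^ p := by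
    intro x
    rw [ENNReal.tsum_eq_iSup_nat]
    exact (ENNReal.orderIsoRpow p hp0).map_iSup _
  simp_rw [hsup]
  rw [lintegral_iSup (fun n => (Finset.measurable_fun_sum _ fun j _ => hf j).pow_const p)
    (fun a b hab x => ENNReal.rpow_le_rpow (hmono x hab) hp0.le)]
  refine iSup_le fun n => ?_
  rw [← ENNReal.rpow_inv_le_iff hp0, ← one_div]
  exact (hfin n).trans (ENNReal.sum_le_tsum _)

/-- Tonelli's theorem for integrals over the sections of a measurable relation. -/
theorem lintegral_mul_setLIntegral_swap {Z : Type*} [MeasurableSpace Z] {ν : Measure Z}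
    [SFinite m] [SFinite ν] {s : Set (Z × Y)} (hs : MeasurableSet s) {w : Z → ℝ≥0∞}
    (hw : Measurable w) {φ : Y → ℝ≥0∞} (hφ : Measurable φ) :
    ∫⁻ z, w z * ∫⁻ y in {y | (z, y) ∈ s}, φ y ∂m ∂ν =
      ∫⁻ y, φ y * ∫⁻ z in {z | (z, y) ∈ s}, w z ∂ν ∂m := by
  have h1 : ∀ z, w z * ∫⁻ y in {y | (z, y) ∈ s}, φ y ∂m =
      ∫⁻ y, s.indicator (fun q : Z × Y => w q.1 * φ q.2) (z, y) ∂m := by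
    intro z
    have hsz : MeasurableSet {y | (z, y) ∈ s} := measurable_prodMk_left hs
    rw [← lintegral_const_mul _ hφ, ← lintegral_indicator hsz]
    rfl
  have h2 : ∀ y, φ y * ∫⁻ z in {z | (z, y) ∈ s}, w z ∂ν =
      ∫⁻ z, s.indicator (fun q : Z × Y => w q.1 * φ q.2) (z, y) ∂ν := by
    intro y
    have hsy : MeasurableSet {z | (z, y) ∈ s} := measurable_prodMk_right hs
    simp_rw [mul_comm (w _)]
    rw [← lintegral_const_mul _ hw, ← lintegral_indicator hsy]
    refine lintegral_congr fun z => ?_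
    by_cases hz : (z, y) ∈ s
    · rw [indicator_of_mem hz, indicator_of_mem (show z ∈ {z | (z, y) ∈ s} from hz)]
    · rw [indicator_of_notMem hz, indicator_of_notMem (show z ∉ {z | (z, y) ∈ s} from hz)]
  simp_rw [h1, h2]
  refine lintegral_lintegral_swap (Measurable.aemeasurable ?_)
  exact ((hw.comp measurable_fst).mul (hφ.comp measurable_snd)).indicator hs

theorem measurable_setLIntegral_section {Z : Type*} [MeasurableSpace Z] [SFinite m]
    {s : Set (Z × Y)} (hs : MeasurableSet s) {φ : Y → ℝ≥0∞} (hφ : Measurable φ) :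
    Measurable fun z => ∫⁻ y in {y | (z, y) ∈ s}, φ y ∂m := by
  have h1 : ∀ z, ∫⁻ y in {y | (z, y) ∈ s}, φ y ∂m =
      ∫⁻ y, s.indicator (fun q : Z × Y => φ q.2) (z, y) ∂m := by
    intro z
    have hsz : MeasurableSet {y | (z, y) ∈ s} := measurable_prodMk_left hs
    rw [← lintegral_indicator hsz]
    rfl
  simp_rw [h1]
  exact ((hφ.comp measurable_snd).indicator hs).lintegral_prod_right'

theorem setLIntegral_biUnion_finset_le {ι : Type*} (s : Finset ι) (t : ι → Set Y)
    (f : Y → ℝ≥0∞) : ∫⁻ x in ⋃ i ∈ s, t i, f x ∂m ≤ ∑ i ∈ s, ∫⁻ x in t i, f x ∂m := by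
  classical
  induction s using Finset.induction_on with
  | empty => simp
  | insert i s hi ih =>
    rw [Finset.set_biUnion_insert, Finset.sum_insert hi]
    exact (lintegral_union_le _ _ _).trans (add_le_add le_rfl ih)

/-- A bound that holds for each member of a family holds for its infimum. -/
theorem le_mul_add_iInf {ι : Type*} {S : ι → Prop} {φ : ι → ℝ≥0∞} {A C U : ℝ≥0∞} (hC0 : C ≠ 0)
    (hC : C ≠ ∞) (h : ∀ i, S i → A ≤ C * (U + φ i)) : A ≤ C * (U + ⨅ (i) (_ : S i), φ i) := by
  by_contra! hlt
  rw [mul_comm, ← ENNReal.lt_div_iff_mul_lt (Or.inl hC0) (Or.inl hC), ← lt_tsub_iff_left] at hlt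
  simp only [iInf_lt_iff] at hlt
  obtain ⟨i, hi, hlt⟩ := hlt
  rw [lt_tsub_iff_left, ENNReal.lt_div_iff_mul_lt (Or.inl hC0) (Or.inl hC), mul_comm] at hlt
  exact absurd (h i hi) (not_le.2 hlt)

end Averages

/-! ### Doubling measures -/

section Doubling

variable {X : Type*} [MetricSpace X]

/-- The part in `Ω` of the ball of the ambient space with centre `z`, which need not lie in `Ω`,
as a subset of the subtype `Ω`. -/
abbrev relBall (Ω : Set X) (z : X) (r : ℝ) : Set Ω := Subtype.val ⁻¹' Metric.ball z r

theorem relBall_subset {Ω : Set X} {z z' : X} {r r' : ℝ} (h : r + dist z z' ≤ r') :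
    relBall Ω z r ⊆ relBall Ω z' r' :=
  preimage_mono (Metric.ball_subset_ball' h)

theorem relBall_eq_section {Ω F : Set X} (z : F) (r : ℝ) :
    relBall Ω (z : X) r = {x : Ω | (z, x) ∈ {q : F × Ω | dist (q.1 : X) q.2 < r}} := by
  ext x
  simp only [mem_preimage, Metric.mem_ball, mem_ofPred_eq, dist_comm]

/-- `m` is a doubling measure on `Ω` with constant `c`; the balls are centred in the closure
of `Ω`. -/
structure IsDoublingWith {Ω : Set X} [MeasurableSpace X] (m : Measure Ω) (c : ℝ≥0) : Prop where
  ne_zero : ∀ z ∈ closure Ω, ∀ r : ℝ, 0 < r → m (relBall Ω z r) ≠ 0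
  ne_top : ∀ z ∈ closure Ω, ∀ r : ℝ, 0 < r → m (relBall Ω z r) ≠ ∞
  le_mul : ∀ z ∈ closure Ω, ∀ r : ℝ, 0 < r → m (relBall Ω z (2 * r)) ≤ c * m (relBall Ω z r)

variable [MeasurableSpace X] {Ω : Set X} {m : Measure Ω} {c : ℝ≥0}

theorem measureOn_relBall [BorelSpace X] {μ : Measure X} (hΩ : IsOpen Ω) (z : X) (r : ℝ) :
    measureOn μ Ω (relBall Ω z r) = μ (Metric.ball z r ∩ Ω) := by
  rw [measureOn, comap_subtype_coe_apply hΩ.measurableSet, Subtype.image_preimage_coe, inter_comm]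

theorem IsDoublingOn.exists_isDoublingWith [BorelSpace X] {μ : Measure X} (hΩ : IsOpen Ω)
    (h : IsDoublingOn μ Ω) : ∃ c : ℝ≥0, IsDoublingWith (measureOn μ Ω) c := by
  obtain ⟨c, hc⟩ := h
  refine ⟨c, fun z hz r hr => ?_, fun z hz r hr => ?_, fun z hz r hr => ?_⟩
  · have := (hc z hz (r / 2) (by positivity)).1
    rw [mul_div_cancel₀ r two_ne_zero] at this
    rw [measureOn_relBall hΩ]; exact this.ne'
  · rw [measureOn_relBall hΩ]; exact (hc z hz r hr).2.2.ne
  · rw [measureOn_relBall hΩ, measureOn_relBall hΩ]; exact (hc z hz r hr).2.1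

namespace IsDoublingWith

theorem le_pow_mul (h : IsDoublingWith m c) (k : ℕ) {z : X} (hz : z ∈ closure Ω) {r : ℝ}
    (hr : 0 < r) : m (relBall Ω z (2 ^ k * r)) ≤ (c : ℝ≥0∞) ^ k * m (relBall Ω z r) := by
  induction k with
  | zero => simp
  | succ k ih =>
    rw [pow_succ', mul_assoc]
    refine (h.le_mul z hz _ (by positivity)).trans ?_
    rw [pow_succ', mul_assoc]
    gcongr

/-- Comparison of the measures of a ball and of a larger ball with another centre. -/
theorem le_pow_mul_of_subset (h : IsDoublingWith m c) (k : ℕ) {z z' : X} (hz : z ∈ closure Ω)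
    {r r' : ℝ} (hr : 0 < r) (hrr : r' + dist z' z ≤ 2 ^ k * r) :
    m (relBall Ω z' r') ≤ (c : ℝ≥0∞) ^ k * m (relBall Ω z r) :=
  (measure_mono (relBall_subset hrr)).trans (h.le_pow_mul k hz hr)

/-- Points of a ball of radius `t` that are `t / 2 ^ k` apart are at most `c ^ (k + 3)` in
number. -/
theorem card_le_of_separated [OpensMeasurableSpace X] (h : IsDoublingWith m c) (k : ℕ) {z : X}
    (hz : z ∈ closure Ω) {t : ℝ} (ht : 0 < t) {s : Finset X}
    (hs : (s : Set X) ⊆ closure Ω ∩ Metric.ball z t)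
    (hsep : (s : Set X).Pairwise fun x y => t / 2 ^ k ≤ dist x y) :
    (s.card : ℝ≥0∞) ≤ (c : ℝ≥0∞) ^ (k + 3) := by
  have hε : 0 < t / 2 ^ k := by positivity
  set M := m (relBall Ω z (2 * t)) with hM
  have hM0 : M ≠ 0 := h.ne_zero z hz _ (by positivity)
  have hMt : M ≠ ∞ := h.ne_top z hz _ (by positivity)
  have hlow : ∀ y ∈ s, M ≤ (c : ℝ≥0∞) ^ (k + 3) * m (relBall Ω y (t / 2 ^ k / 2)) := by
    intro y hy
    refine h.le_pow_mul_of_subset _ (hs hy).1 (by positivity) ?_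
    have h1 : dist y z < t := (hs hy).2
    have h2 : (2 : ℝ) ^ (k + 3) * (t / 2 ^ k / 2) = 4 * t := by
      field_simp; ring
    rw [h2, dist_comm]; linarith
  have hdisj : ∑ y ∈ s, m (relBall Ω y (t / 2 ^ k / 2)) ≤ M := by
    rw [← measure_biUnion_finset]
    · refine measure_mono (iUnion₂_subset fun y hy => relBall_subset ?_)
      have h1 : dist y z < t := (hs hy).2
      have h2 : t / 2 ^ k ≤ t := div_le_self ht.le (one_le_pow₀ (by norm_num))
      linarith
    · intro x hx y hy hxy
      refine Disjoint.preimage _ (Metric.ball_disjoint_ball ?_)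
      have := hsep hx hy hxy
      linarith
    · intro y _
      exact Metric.isOpen_ball.measurableSet.preimage measurable_subtype_coe
  have : (s.card : ℝ≥0∞) * M ≤ (c : ℝ≥0∞) ^ (k + 3) * M := by
    calc (s.card : ℝ≥0∞) * M = ∑ y ∈ s, M := by simp
      _ ≤ ∑ y ∈ s, (c : ℝ≥0∞) ^ (k + 3) * m (relBall Ω y (t / 2 ^ k / 2)) :=
        Finset.sum_le_sum hlow
      _ = (c : ℝ≥0∞) ^ (k + 3) * ∑ y ∈ s, m (relBall Ω y (t / 2 ^ k / 2)) := by
        rw [Finset.mul_sum]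
      _ ≤ _ := by gcongr
  exact (ENNReal.mul_le_mul_iff_left hM0 hMt).1 this

/-- A subset of a ball of radius `t` is covered by a bounded number of balls of radius `t / 2 ^ k`
centred in this subset. -/
theorem exists_finset_cover [OpensMeasurableSpace X] (h : IsDoublingWith m c) (k : ℕ) :
    ∃ N : ℕ, ∀ z ∈ closure Ω, ∀ t : ℝ, 0 < t → ∀ A ⊆ closure Ω ∩ Metric.ball z t,
      ∃ s : Finset X, (s : Set X) ⊆ A ∧ s.card ≤ N ∧ A ⊆ ⋃ y ∈ s, Metric.ball y (t / 2 ^ k) := by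
  obtain ⟨N, hN⟩ := exists_nat_ge (c ^ (k + 3))
  refine ⟨N, fun z hz t ht A hA => ?_⟩
  let P : ℕ → Prop := fun n => ∃ s : Finset X, (s : Set X) ⊆ A ∧
    ((s : Set X).Pairwise fun x y => t / 2 ^ k ≤ dist x y) ∧ s.card = n
  have hb : ∀ n, P n → n ≤ N := by
    rintro n ⟨s, hsA, hsep, rfl⟩
    have := h.card_le_of_separated k hz ht (hsA.trans hA) hsep
    have h2 : ((s.card : ℝ≥0) : ℝ≥0∞) ≤ ((c ^ (k + 3) : ℝ≥0) : ℝ≥0∞) := by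
      push_cast; exact this
    exact_mod_cast (ENNReal.coe_le_coe.1 h2).trans hN
  classical
  have hP : P (Nat.findGreatest P N) :=
    Nat.findGreatest_spec (P := P) (Nat.zero_le N) ⟨∅, by simp, by simp, rfl⟩
  obtain ⟨s, hsA, hsep, hcard⟩ := hP
  refine ⟨s, hsA, hcard.le.trans (Nat.findGreatest_le _), fun x hx => ?_⟩
  by_contra hcov
  simp only [mem_iUnion, Metric.mem_ball, not_exists, not_lt] at hcov
  have hxs : x ∉ s := fun hxs => by
    have := hcov x hxs
    rw [dist_self] at this
    exact absurd this (not_le.2 (by positivity))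
  have hP' : P (Nat.findGreatest P N + 1) := by
    refine ⟨insert x s, ?_, ?_, by rw [Finset.card_insert_of_notMem hxs, hcard]⟩
    · rw [Finset.coe_insert]; exact insert_subset hx hsA
    · rw [Finset.coe_insert]
      refine hsep.insert_of_notMem (by simpa using hxs) fun y hy => ⟨hcov y hy, ?_⟩
      rw [dist_comm]; exact hcov y hy
  have := Nat.le_findGreatest (hb _ hP') hP'
  omega

theorem isSeparable_closure [OpensMeasurableSpace X] (h : IsDoublingWith m c) :
    TopologicalSpace.IsSeparable (closure Ω) := by
  rcases (closure Ω).eq_empty_or_nonempty with h0 | ⟨z, hz⟩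
  · rw [h0]; exact countable_empty.isSeparable
  have hU : closure Ω ⊆ ⋃ n : ℕ, closure Ω ∩ Metric.ball z (n + 1) := by
    intro x hx
    obtain ⟨n, hn⟩ := exists_nat_gt (dist x z)
    exact mem_iUnion.2 ⟨n, hx, by rw [Metric.mem_ball]; linarith⟩
  refine TopologicalSpace.IsSeparable.mono
    (TopologicalSpace.isSeparable_iUnion.2 fun n => TotallyBounded.isSeparable ?_) hU
  rw [Metric.totallyBounded_iff]
  intro ε hε
  obtain ⟨k, hk⟩ := pow_unbounded_of_one_lt ((n + 1 : ℝ) / ε) (one_lt_two)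
  obtain ⟨N, hN⟩ := h.exists_finset_cover k
  obtain ⟨s, -, -, hs⟩ := hN z hz (n + 1) (by positivity) _ subset_rfl
  refine ⟨s, s.finite_toSet, hs.trans (iUnion₂_mono fun y _ => Metric.ball_subset_ball ?_)⟩
  rw [div_le_iff₀ (by positivity)]
  rw [div_lt_iff₀ hε] at hk
  linarith

theorem secondCountableTopology_of_subset [OpensMeasurableSpace X] (h : IsDoublingWith m c)
    {F : Set X} (hF : F ⊆ closure Ω) : SecondCountableTopology F :=
  (h.isSeparable_closure.mono hF).secondCountableTopology

theorem sigmaFinite (h : IsDoublingWith m c) : SigmaFinite m := by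
  rcases Ω.eq_empty_or_nonempty with h0 | ⟨z, hz⟩
  · have : IsEmpty Ω := isEmpty_coe_sort.2 h0
    rw [m.eq_zero_of_isEmpty]; infer_instance
  refine ⟨⟨⟨fun n : ℕ => relBall Ω z (n + 1), fun _ => trivial, fun n =>
    (h.ne_top z (subset_closure hz) _ (by positivity)).lt_top, ?_⟩⟩⟩
  refine eq_univ_of_forall fun x => ?_
  obtain ⟨n, hn⟩ := exists_nat_gt (dist (x : X) z)
  exact mem_iUnion.2 ⟨n, by rw [mem_preimage, Metric.mem_ball]; linarith⟩

theorem setLAverage_le (h : IsDoublingWith m c) (k : ℕ) {z z' : X} (hz : z ∈ closure Ω)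
    (hz' : z' ∈ closure Ω) {r r' : ℝ} (hr : 0 < r) (hr' : 0 < r') (h1 : r + dist z z' ≤ r')
    (h2 : r' + dist z' z ≤ 2 ^ k * r) (f : Ω → ℝ≥0∞) :
    ⨍⁻ x in relBall Ω z r, f x ∂m ≤ (c : ℝ≥0∞) ^ k * ⨍⁻ x in relBall Ω z' r', f x ∂m :=
  setLAverage_le_mul_of_subset (relBall_subset h1) (h.le_pow_mul_of_subset k hz hr h2)
    (h.ne_zero z' hz' _ hr') (h.ne_top z' hz' _ hr') f

end IsDoublingWith

end Doubling

/-! ### Mean oscillation and potentials -/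

section Oscillation

variable {X : Type*} [MetricSpace X] [MeasurableSpace X] {Ω : Set X} {m : Measure Ω} {c : ℝ≥0}

/-- The mean oscillation of `u` on the part in `Ω` of a ball. -/
def meanOsc (m : Measure Ω) (u : Ω → ℝ) (z : X) (r : ℝ) : ℝ≥0∞ :=
  ⨍⁻ y in relBall Ω z r, ⨍⁻ x in relBall Ω z r, ‖u x - u y‖ₑ ∂m ∂m

/-- The mean deviation of `u` from the number `a` on the part in `Ω` of a ball. -/
def meanDev (m : Measure Ω) (u : Ω → ℝ) (a : ℝ) (z : X) (r : ℝ) : ℝ≥0∞ :=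
  ⨍⁻ x in relBall Ω z r, ‖u x - a‖ₑ ∂m

/-- The sum over the radii `r / 2 ^ j` of the right-hand sides of the Poincaré inequality. -/
def potential (m : Measure Ω) (L p : ℝ) (h : Ω → ℝ≥0∞) (z : X) (r : ℝ) : ℝ≥0∞ :=
  ∑' j : ℕ, ENNReal.ofReal (r / 2 ^ j) *
    (⨍⁻ x in relBall Ω z (L * (r / 2 ^ j)), h x ^ p ∂m) ^ (1 / p)

/-- A Poincaré inequality for the pair `(u, h)` on all balls centred in `F`. It holds for a
Hajłasz gradient `h` of `u`, and for an upper gradient if `Ω` admits a Poincaré inequality. -/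
def SatisfiesPoincare (m : Measure Ω) (F : Set X) (K : ℝ≥0) (L p : ℝ) (u : Ω → ℝ)
    (h : Ω → ℝ≥0∞) : Prop :=
  ∀ z ∈ F, ∀ r : ℝ, 0 < r → meanOsc m u z r ≤
    K * (ENNReal.ofReal r * (⨍⁻ x in relBall Ω z (L * r), h x ^ p ∂m) ^ (1 / p))

theorem IsDoublingWith.meanDev_le_add (hD : IsDoublingWith m c) {u : Ω → ℝ} (hu : Measurable u)
    (a : ℝ) {z : X} (hz : z ∈ closure Ω) {r : ℝ} (hr : 0 < r) :
    meanDev m u a z r ≤ c * meanOsc m u z r + meanDev m u a z (r / 2) := by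
  have hr2 : 0 < r / 2 := by positivity
  have hm : ∀ b : ℝ, Measurable fun x => ‖u x - b‖ₑ := fun b => (hu.sub_const b).enorm
  have h1 : ∀ y, meanDev m u a z r ≤ ⨍⁻ x in relBall Ω z r, ‖u x - u y‖ₑ ∂m + ‖u y - a‖ₑ := by
    intro y
    calc meanDev m u a z r ≤ ⨍⁻ x in relBall Ω z r, (‖u x - u y‖ₑ + ‖u y - a‖ₑ) ∂m := by
          refine setLAverage_mono fun x => ?_
          rw [show u x - a = (u x - u y) + (u y - a) by ring]
          exact enorm_add_le _ _
      _ ≤ _ := by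
          rw [setLAverage_add_left (hm _)]
          exact add_le_add le_rfl (setLAverage_const_le _ _)
  calc meanDev m u a z r = ⨍⁻ _y in relBall Ω z (r / 2), meanDev m u a z r ∂m :=
        (setLAverage_const (hD.ne_zero z hz _ hr2) (hD.ne_top z hz _ hr2) _).symm
    _ ≤ ⨍⁻ y in relBall Ω z (r / 2),
          (‖u y - a‖ₑ + ⨍⁻ x in relBall Ω z r, ‖u x - u y‖ₑ ∂m) ∂m :=
        setLAverage_mono fun y => (h1 y).trans (add_comm _ _).le
    _ = meanDev m u a z (r / 2) +
          ⨍⁻ y in relBall Ω z (r / 2), ⨍⁻ x in relBall Ω z r, ‖u x - u y‖ₑ ∂m ∂m :=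
        setLAverage_add_left (hm a) _
    _ ≤ meanDev m u a z (r / 2) + c * meanOsc m u z r := by
        refine add_le_add le_rfl ?_
        have := hD.setLAverage_le 1 hz hz hr2 hr (by simp; linarith) (by simp; linarith)
          (fun y => ⨍⁻ x in relBall Ω z r, ‖u x - u y‖ₑ ∂m)
        rwa [pow_one] at this
    _ = _ := add_comm _ _

theorem IsDoublingWith.meanDev_le_sum (hD : IsDoublingWith m c) {u : Ω → ℝ} (hu : Measurable u)
    (a : ℝ) {z : X} (hz : z ∈ closure Ω) {r : ℝ} (hr : 0 < r) (n : ℕ) :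
    meanDev m u a z r ≤
      c * ∑ j ∈ Finset.range n, meanOsc m u z (r / 2 ^ j) + meanDev m u a z (r / 2 ^ n) := by
  induction n with
  | zero => simp
  | succ n ih =>
    refine ih.trans ?_
    rw [Finset.sum_range_succ, mul_add, add_assoc]
    refine add_le_add le_rfl ?_
    have := hD.meanDev_le_add hu a hz (r := r / 2 ^ n) (by positivity)
    rwa [div_div, ← pow_succ] at this

/-- If `a` is the limit of the averages of `u` at `z`, then the mean deviation from `a` is
controlled by the potential: the deviations at the radii `r / 2 ^ j` telescope. -/
theorem IsDoublingWith.meanDev_le_potential (hD : IsDoublingWith m c) {u : Ω → ℝ}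
    (hu : Measurable u) {F : Set X} (hF : F ⊆ closure Ω) {K : ℝ≥0} {L p : ℝ} {h : Ω → ℝ≥0∞}
    (hP : SatisfiesPoincare m F K L p u h) {a : ℝ} {z : X} (hz : z ∈ F)
    (ha : Tendsto (meanDev m u a z) (𝓝[>] 0) (𝓝 0)) {r : ℝ} (hr : 0 < r) :
    meanDev m u a z r ≤ c * K * potential m L p h z r := by
  have h1 : ∀ n : ℕ, meanDev m u a z r ≤
      c * K * potential m L p h z r + meanDev m u a z (r / 2 ^ n) := by
    intro n
    refine (hD.meanDev_le_sum hu a (hF hz) hr n).trans (add_le_add ?_ le_rfl)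
    rw [mul_assoc]
    refine mul_le_mul' le_rfl ?_
    calc ∑ j ∈ Finset.range n, meanOsc m u z (r / 2 ^ j)
        ≤ ∑ j ∈ Finset.range n, K * (ENNReal.ofReal (r / 2 ^ j) *
          (⨍⁻ x in relBall Ω z (L * (r / 2 ^ j)), h x ^ p ∂m) ^ (1 / p)) :=
          Finset.sum_le_sum fun j _ => hP z hz _ (by positivity)
      _ ≤ _ := by
          rw [← Finset.mul_sum]
          exact mul_le_mul' le_rfl (ENNReal.sum_le_tsum _)
  have h2 : Tendsto (fun n : ℕ => r / 2 ^ n) atTop (𝓝[>] 0) := by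
    refine tendsto_nhdsWithin_iff.2 ⟨?_, Eventually.of_forall fun n => by
      simp only [mem_Ioi]; positivity⟩
    have := (tendsto_pow_atTop_nhds_zero_of_lt_one (r := (1 / 2 : ℝ)) (by norm_num)
      (by norm_num)).const_mul r
    simpa [div_eq_mul_inv] using this
  have h3 := (ha.comp h2).const_add (c * K * potential m L p h z r)
  rw [add_zero] at h3
  exact ge_of_tendsto' h3 h1

/-- Comparison of the values at two points whose mean deviations are known. -/
theorem IsDoublingWith.enorm_sub_le_meanDev (hD : IsDoublingWith m c) {u : Ω → ℝ}
    (hu : Measurable u) {a b : ℝ} {y z : X} (hy : y ∈ closure Ω) (hz : z ∈ closure Ω) {t : ℝ}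
    (ht : 0 < t) (hyz : dist y z ≤ t) :
    ‖a - b‖ₑ ≤ (c : ℝ≥0∞) ^ 2 * (meanDev m u a y (2 * t) + meanDev m u b z (2 * t)) := by
  have hm : ∀ b : ℝ, Measurable fun x => ‖u x - b‖ₑ := fun b => (hu.sub_const b).enorm
  have h2t : 0 < 2 * t := by positivity
  calc ‖a - b‖ₑ = ⨍⁻ _x in relBall Ω y t, ‖a - b‖ₑ ∂m :=
        (setLAverage_const (hD.ne_zero y hy _ ht) (hD.ne_top y hy _ ht) _).symm
    _ ≤ ⨍⁻ x in relBall Ω y t, (‖u x - a‖ₑ + ‖u x - b‖ₑ) ∂m := by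
        refine setLAverage_mono fun x => ?_
        rw [show a - b = -(u x - a) + (u x - b) by ring, ← enorm_neg (u x - a)]
        exact enorm_add_le _ _
    _ = ⨍⁻ x in relBall Ω y t, ‖u x - a‖ₑ ∂m + ⨍⁻ x in relBall Ω y t, ‖u x - b‖ₑ ∂m :=
        setLAverage_add_left (hm a) _
    _ ≤ (c : ℝ≥0∞) ^ 2 * meanDev m u a y (2 * t) + (c : ℝ≥0∞) ^ 2 * meanDev m u b z (2 * t) := by
        refine add_le_add (hD.setLAverage_le 2 hy hy ht h2t ?_ ?_ _)
          (hD.setLAverage_le 2 hy hz ht h2t ?_ ?_ _)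
        · rw [dist_self]; linarith
        · rw [dist_self]; linarith
        · linarith
        · rw [dist_comm]; linarith
    _ = _ := (mul_add _ _ _).symm

end Oscillation

/-! ### Integral estimates on the set `F` -/

section Potential

variable {X : Type*} [MetricSpace X] [MeasurableSpace X] [BorelSpace X] {Ω F : Set X}
  {m : Measure Ω} {c : ℝ≥0} {ν : Measure F}

/-- The form in which the upper codimension-`θ` bound is used: it is the bound for the kernel which
arises when averages over balls centred in `F` are integrated over `F`. -/
def KernelBound (m : Measure Ω) (ν : Measure F) (M : ℝ≥0) (θ ρ : ℝ) : Prop :=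
  ∀ r : ℝ, 0 < r → r ≤ ρ → ∀ x : Ω,
    ∫⁻ z in {z : F | dist (z : X) x < r}, (m (relBall Ω z r))⁻¹ ∂ν ≤ M * ENNReal.ofReal r ^ (-θ)

theorem measurableSet_dist_lt [SecondCountableTopology Ω] (r : ℝ) :
    MeasurableSet {q : F × Ω | dist (q.1 : X) q.2 < r} :=
  (isOpen_lt (by fun_prop) continuous_const).measurableSet

theorem measurable_setLIntegral_relBall [SecondCountableTopology Ω] [SFinite m] (r : ℝ)
    {φ : Ω → ℝ≥0∞} (hφ : Measurable φ) :
    Measurable fun z : F => ∫⁻ x in relBall Ω (z : X) r, φ x ∂m := by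
  simp_rw [relBall_eq_section]
  exact measurable_setLIntegral_section (measurableSet_dist_lt r) hφ

theorem measurable_measure_relBall [SecondCountableTopology Ω] [SFinite m] (r : ℝ) :
    Measurable fun z : F => m (relBall Ω (z : X) r) := by
  have := measurable_setLIntegral_relBall (F := F) (m := m) r (φ := fun _ => 1) measurable_const
  simpa using this

theorem measurable_setLAverage_relBall [SecondCountableTopology Ω] [SFinite m] (r : ℝ)
    {φ : Ω → ℝ≥0∞} (hφ : Measurable φ) :
    Measurable fun z : F => ⨍⁻ x in relBall Ω (z : X) r, φ x ∂m := by
  simp_rw [setLAverage_eq]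
  exact (measurable_setLIntegral_relBall r hφ).div (measurable_measure_relBall r)

theorem measurable_potential [SecondCountableTopology Ω] [SFinite m] (L p r : ℝ)
    {h : Ω → ℝ≥0∞} (hh : Measurable h) : Measurable fun z : F => potential m L p h (z : X) r :=
  Measurable.tsum fun _ => ((measurable_setLAverage_relBall _ (hh.pow_const p)).pow_const
    _).const_mul _

theorem KernelBound.lintegral_setLAverage_le [SecondCountableTopology Ω] [SFinite m] [SFinite ν]
    {M : ℝ≥0} {θ ρ : ℝ} (hk : KernelBound m ν M θ ρ) {r : ℝ} (hr : 0 < r) (hrρ : r ≤ ρ)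
    {φ : Ω → ℝ≥0∞} (hφ : Measurable φ) :
    ∫⁻ z : F, ⨍⁻ x in relBall Ω (z : X) r, φ x ∂m ∂ν ≤
      M * ENNReal.ofReal r ^ (-θ) * ∫⁻ x, φ x ∂m := by
  simp_rw [setLAverage_eq, ENNReal.div_eq_inv_mul]
  have := lintegral_mul_setLIntegral_swap (m := m) (ν := ν)
    (measurableSet_dist_lt (Ω := Ω) (F := F) r) (measurable_measure_relBall (m := m) r).inv hφ
  simp_rw [relBall_eq_section] at this ⊢
  simp only [Pi.inv_apply] at this
  rw [this, ← lintegral_const_mul _ hφ]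
  refine lintegral_mono fun x => ?_
  rw [mul_comm]
  refine mul_le_mul' ?_ le_rfl
  have h2 := hk r hr hrρ x
  simp_rw [relBall_eq_section] at h2
  exact h2

/-- The `L^p(ν)`-norm of the potential is at most a constant times `r^(1 - θ/p)`: the terms of the
sum are bounded by a geometric sequence with ratio `2^-(1 - θ/p) < 1`. -/
theorem KernelBound.lintegral_potential_le [SecondCountableTopology Ω] [SFinite m] [SFinite ν]
    {M : ℝ≥0} {θ ρ : ℝ} (hk : KernelBound m ν M θ ρ) {p : ℝ} (hp : 1 ≤ p) {L r : ℝ} (hL : 0 < L)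
    (hr : 0 < r) (hrρ : L * r ≤ ρ) {h : Ω → ℝ≥0∞} (hh : Measurable h) :
    ∫⁻ z : F, potential m L p h (z : X) r ^ p ∂ν ≤
      M * ENNReal.ofReal L ^ (-θ) * ((1 - 2⁻¹ ^ (1 - θ / p))⁻¹ : ℝ≥0∞) ^ p *
        ENNReal.ofReal r ^ (p - θ) * ∫⁻ x, h x ^ p ∂m := by
  have hp0 : 0 < p := by linarith
  set H := ∫⁻ x, h x ^ p ∂m
  set q := 1 - θ / p with hq
  set A : ℝ≥0∞ := M * ENNReal.ofReal L ^ (-θ) * H with hA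
  have hr0 : ENNReal.ofReal r ≠ 0 := by simpa using hr
  have hterm : ∀ j : ℕ, (∫⁻ z : F, (ENNReal.ofReal (r / 2 ^ j) *
      (⨍⁻ x in relBall Ω (z : X) (L * (r / 2 ^ j)), h x ^ p ∂m) ^ (1 / p)) ^ p ∂ν) ^ (1 / p) ≤
      A ^ (1 / p) * ENNReal.ofReal r ^ q * (2⁻¹ ^ q) ^ j := by
    intro j
    have hrj : 0 < r / 2 ^ j := by positivity
    set R := ENNReal.ofReal (r / 2 ^ j) with hR
    have hR0 : R ≠ 0 := by simpa [hR] using hrj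
    have hRt : R ≠ ∞ := ENNReal.ofReal_ne_top
    have hRe : R = ENNReal.ofReal r * 2⁻¹ ^ j := by
      rw [hR, div_eq_mul_inv, ENNReal.ofReal_mul hr.le, ← inv_pow, ENNReal.ofReal_pow (by norm_num),
        ENNReal.ofReal_inv_of_pos (by norm_num)]
      simp
    have h1 : ∫⁻ z : F, (R * (⨍⁻ x in relBall Ω (z : X) (L * (r / 2 ^ j)), h x ^ p ∂m) ^ (1 / p)) ^ p
        ∂ν ≤ R ^ p * (A * R ^ (-θ)) := by
      simp_rw [ENNReal.mul_rpow_of_nonneg _ _ hp0.le, ← ENNReal.rpow_mul,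
        one_div_mul_cancel hp0.ne', ENNReal.rpow_one]
      rw [lintegral_const_mul' _ _ (by finiteness)]
      refine mul_le_mul' le_rfl ?_
      refine (hk.lintegral_setLAverage_le (by positivity) (le_trans ?_ hrρ)
        (hh.pow_const p)).trans (le_of_eq ?_)
      · gcongr; exact div_le_self hr.le (one_le_pow₀ (by norm_num))
      · rw [ENNReal.ofReal_mul hL.le, ENNReal.mul_rpow_of_ne_top (by finiteness) (by finiteness), hA]
        ring
    calc _ ≤ (R ^ p * (A * R ^ (-θ))) ^ (1 / p) := ENNReal.rpow_le_rpow h1 (by positivity)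
      _ = (A * R ^ (q * p)) ^ (1 / p) := by
          rw [show q * p = p + -θ by rw [hq]; field_simp; ring, ENNReal.rpow_add _ _ hR0 hRt]
          ring_nf
      _ = A ^ (1 / p) * R ^ q := by
          rw [ENNReal.mul_rpow_of_nonneg _ _ (by positivity), ← ENNReal.rpow_mul, mul_assoc,
            mul_one_div_cancel hp0.ne', mul_one]
      _ = _ := by
          rw [hRe, ENNReal.mul_rpow_of_ne_top (x := ENNReal.ofReal r) (by finiteness) (by finiteness),
            ← mul_assoc,
            ← ENNReal.rpow_natCast, ← ENNReal.rpow_mul, mul_comm (j : ℝ), ENNReal.rpow_mul,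
            ENNReal.rpow_natCast]
  have hsum : (∫⁻ z : F, potential m L p h (z : X) r ^ p ∂ν) ^ (1 / p) ≤
      A ^ (1 / p) * ENNReal.ofReal r ^ q * (1 - 2⁻¹ ^ q)⁻¹ := by
    refine (lintegral_Lp_tsum_le hp fun j => ((measurable_setLAverage_relBall _
      (hh.pow_const p)).pow_const _).const_mul _).trans ?_
    refine (ENNReal.tsum_le_tsum hterm).trans (le_of_eq ?_)
    rw [ENNReal.tsum_mul_left, ENNReal.tsum_geometric]
  rw [one_div, ENNReal.rpow_inv_le_iff hp0] at hsum
  refine hsum.trans (le_of_eq ?_)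
  rw [ENNReal.mul_rpow_of_nonneg _ _ hp0.le, ENNReal.mul_rpow_of_nonneg _ _ hp0.le,
    ← ENNReal.rpow_mul, ← ENNReal.rpow_mul, inv_mul_cancel₀ hp0.ne', ENNReal.rpow_one,
    show q * p = p - θ by rw [hq]; field_simp, hA]
  ring

/-- Averaging over balls of a fixed radius is bounded on `L¹(ν)`. As `ν` need not be doubling, this
uses that `F` is a doubling metric space. -/
theorem IsDoublingWith.exists_lintegral_setLAverage_ball_le (hD : IsDoublingWith m c)
    (hF : F ⊆ closure Ω) (ν : Measure F) [IsFiniteMeasure ν] :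
    ∃ N : ℕ, ∀ t : ℝ, 0 < t → ∀ φ : F → ℝ≥0∞, Measurable φ →
      ∫⁻ y, ⨍⁻ z in Metric.ball y t, φ z ∂ν ∂ν ≤ N * ∫⁻ z, φ z ∂ν := by
  have := hD.secondCountableTopology_of_subset hF
  obtain ⟨N, hN⟩ := hD.exists_finset_cover 1
  refine ⟨N, fun t ht φ hφ => ?_⟩
  have hs : MeasurableSet {q : F × F | dist q.1 q.2 < t} :=
    (isOpen_lt (by fun_prop) continuous_const).measurableSet
  have hball : ∀ y : F, Metric.ball y t = {z | (y, z) ∈ {q : F × F | dist q.1 q.2 < t}} := by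
    intro y; ext z; simp only [Metric.mem_ball, mem_ofPred_eq, dist_comm]
  have hw : Measurable fun y : F => (ν (Metric.ball y t))⁻¹ := by
    have := measurable_setLIntegral_section (m := ν) hs (φ := fun _ => 1) measurable_const
    simp_rw [← hball] at this
    simp only [lintegral_const, MeasurableSet.univ, Measure.restrict_apply, univ_inter, one_mul]
      at this
    exact this.inv
  simp_rw [setLAverage_eq, ENNReal.div_eq_inv_mul]
  have hT := lintegral_mul_setLIntegral_swap (m := ν) (ν := ν) hs hw hφ
  simp_rw [← hball] at hT
  rw [hT, ← lintegral_const_mul _ hφ]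
  refine lintegral_mono fun z => ?_
  rw [mul_comm]
  refine mul_le_mul' ?_ le_rfl
  obtain ⟨s, hsA, hcard, hcov⟩ := hN z (hF z.2) t ht (F ∩ Metric.ball (z : X) t)
    (inter_subset_inter_left _ hF)
  have hsub : {y : F | (y, z) ∈ {q : F × F | dist q.1 q.2 < t}} ⊆
      ⋃ x ∈ s, (Subtype.val ⁻¹' Metric.ball x (t / 2) : Set F) := by
    intro y hy
    have hy' : (y : X) ∈ F ∩ Metric.ball (z : X) t := ⟨y.2, hy⟩
    have := hcov hy'
    simpa using this
  calc _ ≤ ∫⁻ y in ⋃ x ∈ s, (Subtype.val ⁻¹' Metric.ball x (t / 2) : Set F),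
          (ν (Metric.ball y t))⁻¹ ∂ν := lintegral_mono_set hsub
    _ ≤ ∑ x ∈ s, ∫⁻ y in (Subtype.val ⁻¹' Metric.ball x (t / 2) : Set F),
          (ν (Metric.ball y t))⁻¹ ∂ν := setLIntegral_biUnion_finset_le _ _ _
    _ ≤ ∑ x ∈ s, 1 := by
        refine Finset.sum_le_sum fun x _ => ?_
        set B : Set F := Subtype.val ⁻¹' Metric.ball x (t / 2) with hB
        have hBm : MeasurableSet B := Metric.isOpen_ball.measurableSet.preimage
          measurable_subtype_coe
        calc ∫⁻ y in B, (ν (Metric.ball y t))⁻¹ ∂ν ≤ ∫⁻ _y in B, (ν B)⁻¹ ∂ν := by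
              refine setLIntegral_mono' hBm fun y hy => ENNReal.inv_le_inv.2 (measure_mono ?_)
              intro y' hy'
              have h1 : dist (y : X) x < t / 2 := hy
              have h2 : dist (y' : X) x < t / 2 := hy'
              have h3 := dist_triangle_right (y' : X) y x
              rw [Metric.mem_ball, Subtype.dist_eq]
              linarith
          _ = (ν B)⁻¹ * ν B := by rw [setLIntegral_const]
          _ ≤ 1 := ENNReal.inv_mul_le_one _
    _ = s.card := by simp
    _ ≤ N := by exact_mod_cast hcard

end Potential

/-! ### Existence, uniqueness and linearity of the trace -/

section Trace

variable {X : Type*} [MetricSpace X] [MeasurableSpace X] {Ω F : Set X}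
  {m : Measure Ω} {c : ℝ≥0} {ν : Measure F}

theorem IsDoublingWith.tendsto_meanDev_of_tendsto_seq (hD : IsDoublingWith m c) {u : Ω → ℝ} {a : ℝ}
    {z : X} (hz : z ∈ closure Ω) {r : ℝ} (hr : 0 < r)
    (h : Tendsto (fun k : ℕ => meanDev m u a z (r / 2 ^ k)) atTop (𝓝 0)) :
    Tendsto (meanDev m u a z) (𝓝[>] 0) (𝓝 0) := by
  have h' := ENNReal.Tendsto.const_mul (a := (c : ℝ≥0∞)) h (Or.inr ENNReal.coe_ne_top)
  rw [mul_zero] at h'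
  rw [ENNReal.tendsto_nhds_zero] at h' ⊢
  intro ε hε
  obtain ⟨n, hn⟩ := eventually_atTop.1 (h' ε hε)
  have hrn : 0 < r / 2 ^ n := by positivity
  filter_upwards [Ioo_mem_nhdsGT hrn] with s hs
  -- Compare with the radius `r / 2 ^ k` for which `s ≤ r / 2 ^ k < 2 s`.
  obtain ⟨k, hk1, hk2⟩ := exists_nat_pow_near_of_lt_one (x := s / (r / 2 ^ n)) (y := (1 / 2 : ℝ))
    (by have := hs.1; positivity) ((div_le_one hrn).2 hs.2.le) (by norm_num) (by norm_num)
  have e1 : s ≤ r / 2 ^ (n + k) := by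
    rw [div_le_iff₀ hrn] at hk2
    calc s ≤ _ := hk2
      _ = _ := by rw [pow_add, one_div, inv_pow]; field_simp
  have e2 : r / 2 ^ (n + k) ≤ 2 * s := by
    rw [lt_div_iff₀ hrn] at hk1
    have : (1 / 2 : ℝ) ^ (k + 1) * (r / 2 ^ n) = r / 2 ^ (n + k) / 2 := by
      rw [pow_succ, pow_add, one_div, inv_pow]; field_simp
    rw [this] at hk1
    linarith
  refine le_trans ?_ (hn (n + k) (by omega))
  have := hD.setLAverage_le 1 hz hz hs.1 (r' := r / 2 ^ (n + k)) (by positivity)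
    (by rw [dist_self]; linarith) (by rw [dist_self]; linarith) (fun x => ‖u x - a‖ₑ)
  rwa [pow_one] at this

theorem enorm_average_sub_le {Y : Type*} [MeasurableSpace Y] {m : Measure Y} {S : Set Y}
    (h0 : m S ≠ 0) (htop : m S ≠ ∞) {u : Y → ℝ} (hu : IntegrableOn u S m) (a : ℝ) :
    ‖⨍ x in S, u x ∂m - a‖ₑ ≤ ⨍⁻ x in S, ‖u x - a‖ₑ ∂m := by
  have : IsProbabilityMeasure ((m.restrict S univ)⁻¹ • m.restrict S) := by
    constructor
    rw [Measure.smul_apply, Measure.restrict_apply_univ, smul_eq_mul, ENNReal.inv_mul_cancel h0 htop]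
  have hu' : Integrable u ((m.restrict S univ)⁻¹ • m.restrict S) := by
    refine Integrable.smul_measure hu ?_
    rw [Measure.restrict_apply_univ]
    exact ENNReal.inv_ne_top.2 h0
  have h1 : ⨍ x in S, u x ∂m - a = ∫ x, (u x - a) ∂((m.restrict S univ)⁻¹ • m.restrict S) := by
    rw [integral_sub hu' (integrable_const a), integral_const]
    rw [probReal_univ, one_smul, average]
  rw [h1]
  exact enorm_integral_le_lintegral_enorm _

theorem meanDev_average_le_meanOsc (hD : IsDoublingWith m c) {u : Ω → ℝ} {z : X}
    (hz : z ∈ closure Ω) {r : ℝ} (hr : 0 < r) (hi : IntegrableOn u (relBall Ω z r) m) :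
    meanDev m u (⨍ x in relBall Ω z r, u x ∂m) z r ≤ meanOsc m u z r := by
  refine setLAverage_mono fun y => ?_
  rw [← enorm_neg, neg_sub]
  exact enorm_average_sub_le (hD.ne_zero z hz r hr) (hD.ne_top z hz r hr) hi _

/-- Where the potential is finite, the averages of `u` converge, because their successive
differences are bounded by the terms of the potential. -/
theorem IsDoublingWith.exists_tendsto_meanDev (hD : IsDoublingWith m c) {u : Ω → ℝ}
    (hu : Measurable u) (hF : F ⊆ closure Ω) {K : ℝ≥0} {L p : ℝ} {h : Ω → ℝ≥0∞}
    (hP : SatisfiesPoincare m F K L p u h) {z : X} (hz : z ∈ F)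
    (hi : ∀ r : ℝ, 0 < r → IntegrableOn u (relBall Ω z r) m) {r : ℝ} (hr : 0 < r)
    (hpot : potential m L p h z r ≠ ∞) :
    ∃ a : ℝ, Tendsto (fun k : ℕ => ⨍ x in relBall Ω z (r / 2 ^ k), u x ∂m) atTop (𝓝 a) ∧
      Tendsto (meanDev m u a z) (𝓝[>] 0) (𝓝 0) := by
  set b : ℕ → ℝ := fun k => ⨍ x in relBall Ω z (r / 2 ^ k), u x ∂m with hb
  have hrk : ∀ k : ℕ, 0 < r / 2 ^ k := fun k => by positivity
  have hm : ∀ b : ℝ, Measurable fun x => ‖u x - b‖ₑ := fun b => (hu.sub_const b).enorm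
  set d : ℕ → ℝ≥0∞ := fun k => meanOsc m u z (r / 2 ^ k) with hd
  have hdsum : ∑' k, d k ≠ ∞ := by
    refine ne_top_of_le_ne_top (ENNReal.mul_ne_top (ENNReal.coe_ne_top (r := K)) hpot) ?_
    rw [potential, ← ENNReal.tsum_mul_left]
    exact ENNReal.tsum_le_tsum fun k => hP z hz _ (hrk k)
  have hcdsum : ∑' k, (c : ℝ≥0∞) * d k ≠ ∞ := by
    rw [ENNReal.tsum_mul_left]; exact ENNReal.mul_ne_top ENNReal.coe_ne_top hdsum
  have hdev : ∀ k, meanDev m u (b k) z (r / 2 ^ k) ≤ d k := fun k =>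
    meanDev_average_le_meanOsc hD (hF hz) (hrk k) (hi _ (hrk k))
  have hstep : ∀ k, edist (b k) (b k.succ) ≤ c * d k := by
    intro k
    rw [edist_comm, edist_eq_enorm_sub]
    refine (enorm_average_sub_le (hD.ne_zero z (hF hz) _ (hrk _)) (hD.ne_top z (hF hz) _ (hrk _))
      (hi _ (hrk _)) (b k)).trans ?_
    have e : r / 2 ^ k = 2 * (r / 2 ^ k.succ) := by rw [pow_succ]; field_simp
    have := hD.setLAverage_le 1 (hF hz) (hF hz) (hrk k.succ) (hrk k)
      (by rw [dist_self, e]; have := hrk k.succ; linarith) (by rw [dist_self, e]; simp)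
      (fun x => ‖u x - b k‖ₑ)
    rw [pow_one] at this
    exact this.trans (mul_le_mul' le_rfl (hdev k))
  obtain ⟨a, ha⟩ := cauchySeq_tendsto_of_complete
    (cauchySeq_of_edist_le_of_tsum_ne_top _ hstep hcdsum)
  refine ⟨a, ha, hD.tendsto_meanDev_of_tendsto_seq (hF hz) hr ?_⟩
  have hbound : ∀ k, meanDev m u a z (r / 2 ^ k) ≤ d k + ∑' j, (c : ℝ≥0∞) * d (j + k) := by
    intro k
    calc meanDev m u a z (r / 2 ^ k)
        ≤ ⨍⁻ x in relBall Ω z (r / 2 ^ k), (‖u x - b k‖ₑ + ‖b k - a‖ₑ) ∂m := by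
          refine setLAverage_mono fun x => ?_
          rw [show u x - a = (u x - b k) + (b k - a) by ring]
          exact enorm_add_le _ _
      _ ≤ d k + ‖b k - a‖ₑ := by
          rw [setLAverage_add_left (hm _)]
          exact add_le_add (hdev k) (setLAverage_const_le _ _)
      _ ≤ _ := by
          refine add_le_add le_rfl ?_
          rw [← edist_eq_enorm_sub]
          refine (edist_le_tsum_of_edist_le_of_tendsto _ hstep ha k).trans (le_of_eq ?_)
          simp_rw [add_comm k]
  have h1 : Tendsto d atTop (𝓝 0) := ENNReal.tendsto_atTop_zero_of_tsum_ne_top hdsum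
  have h2 := ENNReal.tendsto_sum_nat_add (fun j => (c : ℝ≥0∞) * d j) hcdsum
  have h3 := h1.add h2
  rw [add_zero] at h3
  exact tendsto_of_tendsto_of_tendsto_of_le_of_le tendsto_const_nhds h3 (fun _ => zero_le) hbound

theorem IsDoublingWith.eq_of_tendsto_meanDev (hD : IsDoublingWith m c) {u : Ω → ℝ}
    (hu : Measurable u) {z : X} (hz : z ∈ closure Ω) {a b : ℝ}
    (ha : Tendsto (meanDev m u a z) (𝓝[>] 0) (𝓝 0))
    (hb : Tendsto (meanDev m u b z) (𝓝[>] 0) (𝓝 0)) : a = b := by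
  have h2 : Tendsto (fun t : ℝ => 2 * t) (𝓝[>] 0) (𝓝[>] 0) := by
    refine tendsto_nhdsWithin_iff.2 ⟨?_, ?_⟩
    · have : Tendsto (fun t : ℝ => 2 * t) (𝓝 0) (𝓝 (2 * 0)) := (continuous_const_mul 2).tendsto 0
      rw [mul_zero] at this
      exact this.mono_left nhdsWithin_le_nhds
    · filter_upwards [self_mem_nhdsWithin] with t ht
      have : (0 : ℝ) < t := ht
      simpa using this
  have h3 := ENNReal.Tendsto.const_mul (a := (c : ℝ≥0∞) ^ 2) ((ha.comp h2).add (hb.comp h2))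
    (Or.inr (by finiteness))
  rw [add_zero, mul_zero] at h3
  have h4 : ‖a - b‖ₑ ≤ 0 := by
    refine ge_of_tendsto h3 ?_
    filter_upwards [self_mem_nhdsWithin] with t ht
    have ht' : (0 : ℝ) < t := ht
    exact hD.enorm_sub_le_meanDev hu hz hz ht' (by rw [dist_self]; exact ht'.le)
  have h5 : ‖a - b‖ₑ = 0 := le_antisymm h4 zero_le
  rw [enorm_eq_zero, sub_eq_zero] at h5
  exact h5

theorem meanDev_congr {u v : Ω → ℝ} (h : u =ᵐ[m] v) (a : ℝ) (z : X) :
    meanDev m u a z = meanDev m v a z := by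
  funext r
  refine laverage_congr (ae_restrict_of_ae ?_)
  filter_upwards [h] with x hx
  rw [hx]

theorem tendsto_meanDev_add {u v : Ω → ℝ} (hu : Measurable u) {a b : ℝ} {z : X}
    (ha : Tendsto (meanDev m u a z) (𝓝[>] 0) (𝓝 0))
    (hb : Tendsto (meanDev m v b z) (𝓝[>] 0) (𝓝 0)) :
    Tendsto (meanDev m (fun x => u x + v x) (a + b) z) (𝓝[>] 0) (𝓝 0) := by
  have h := ha.add hb
  rw [add_zero] at h
  refine tendsto_of_tendsto_of_tendsto_of_le_of_le tendsto_const_nhds h (fun _ => zero_le) ?_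
  intro r
  simp only [meanDev]
  rw [← setLAverage_add_left (hu.sub_const a).enorm]
  refine setLAverage_mono fun x => ?_
  rw [show u x + v x - (a + b) = (u x - a) + (v x - b) by ring]
  exact enorm_add_le _ _

theorem tendsto_meanDev_const_mul {u : Ω → ℝ} (k : ℝ) {a : ℝ} {z : X}
    (ha : Tendsto (meanDev m u a z) (𝓝[>] 0) (𝓝 0)) :
    Tendsto (meanDev m (fun x => k * u x) (k * a) z) (𝓝[>] 0) (𝓝 0) := by
  have h := ENNReal.Tendsto.const_mul (a := ‖k‖ₑ) ha (Or.inr (by finiteness))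
  rw [mul_zero] at h
  refine h.congr fun r => ?_
  rw [meanDev, meanDev, ← setLAverage_const_mul _ _ (by finiteness)]
  simp_rw [← mul_sub, enorm_mul]

/-- If every function of a linear space has a trace, then by uniqueness the trace is a linear
operator. -/
theorem IsDoublingWith.exists_linearMap (hD : IsDoublingWith m c) (hF : F ⊆ closure Ω)
    (V : Submodule ℝ (Ω →ₘ[m] ℝ))
    (h : ∀ u : V, ∃ f : F →ₘ[ν] ℝ, ∀ᵐ z ∂ν,
      Tendsto (meanDev m (u : Ω →ₘ[m] ℝ) (f z) (z : X)) (𝓝[>] 0) (𝓝 0)) :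
    ∃ T : V →ₗ[ℝ] (F →ₘ[ν] ℝ), ∀ u : V, ∀ᵐ z ∂ν,
      Tendsto (meanDev m (u : Ω →ₘ[m] ℝ) (T u z) (z : X)) (𝓝[>] 0) (𝓝 0) := by
  choose T hT using h
  refine ⟨⟨⟨T, fun u v => ?_⟩, fun k u => ?_⟩, hT⟩
  · refine AEEqFun.ext ?_
    filter_upwards [hT (u + v), hT u, hT v, AEEqFun.coeFn_add (T u) (T v)] with z h1 h2 h3 h4
    rw [h4]
    refine hD.eq_of_tendsto_meanDev (AEEqFun.measurable _) (hF z.2) h1 ?_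
    rw [Submodule.coe_add, meanDev_congr (AEEqFun.coeFn_add (u : Ω →ₘ[m] ℝ) v)]
    exact tendsto_meanDev_add (AEEqFun.measurable _) h2 h3
  · refine AEEqFun.ext ?_
    filter_upwards [hT (k • u), hT u, AEEqFun.coeFn_smul k (T u)] with z h1 h2 h4
    rw [RingHom.id_apply, h4]
    refine hD.eq_of_tendsto_meanDev (AEEqFun.measurable _) (hF z.2) h1 ?_
    rw [Submodule.coe_smul, meanDev_congr (AEEqFun.coeFn_smul k (u : Ω →ₘ[m] ℝ))]
    exact tendsto_meanDev_const_mul k h2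

theorem measurable_average_relBall [BorelSpace X] [SecondCountableTopology Ω] [SFinite m] (r : ℝ)
    {u : Ω → ℝ} (hu : Measurable u) :
    Measurable fun z : F => ⨍ x in relBall Ω (z : X) r, u x ∂m := by
  simp_rw [setAverage_eq]
  refine Measurable.smul (f := fun z : F => (m.real (relBall Ω (z : X) r))⁻¹)
    (measurable_measure_relBall r).ennreal_toReal.inv ?_
  have h1 : ∀ z : F, ∫ x in relBall Ω (z : X) r, u x ∂m =
      ∫ x, ({q : F × Ω | dist (q.1 : X) q.2 < r}.indicator fun q => u q.2) (z, x) ∂m := by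
    intro z
    have hs : MeasurableSet {x : Ω | (z, x) ∈ {q : F × Ω | dist (q.1 : X) q.2 < r}} :=
      measurable_prodMk_left (measurableSet_dist_lt r)
    rw [relBall_eq_section, ← integral_indicator hs]
    rfl
  simp_rw [h1]
  have h2 : StronglyMeasurable
      ({q : F × Ω | dist (q.1 : X) q.2 < r}.indicator fun q => u q.2) :=
    ((hu.comp measurable_snd).indicator (measurableSet_dist_lt r)).stronglyMeasurable
  exact h2.integral_prod_right'.measurable

theorem one_sub_two_inv_rpow_ne_zero {q : ℝ} (hq : 0 < q) : (1 - 2⁻¹ ^ q : ℝ≥0∞) ≠ 0 := by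
  rw [ne_eq, tsub_eq_zero_iff_le, not_le]
  exact ENNReal.rpow_lt_one (ENNReal.inv_lt_one.2 (by norm_num)) hq

theorem IsDoublingWith.integrableOn_relBall (hD : IsDoublingWith m c) {u : Ω → ℝ}
    (hu : AEStronglyMeasurable u m) {p : ℝ} (hp : 1 ≤ p) (hup : ∫⁻ x, ‖u x‖ₑ ^ p ∂m < ∞) {z : X}
    (hz : z ∈ closure Ω) {r : ℝ} (hr : 0 < r) : IntegrableOn u (relBall Ω z r) m := by
  have hp0 : 0 < p := by linarith
  have hL : MemLp u (ENNReal.ofReal p) m := by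
    refine ⟨hu, ?_⟩
    rw [eLpNorm_lt_top_iff_lintegral_rpow_enorm_lt_top (by simpa using hp0) (by finiteness),
      ENNReal.toReal_ofReal hp0.le]
    exact hup
  have : IsFiniteMeasure (m.restrict (relBall Ω z r)) :=
    ⟨by rw [Measure.restrict_apply_univ]; exact (hD.ne_top _ hz r hr).lt_top⟩
  exact (hL.restrict _).integrable (by simpa using hp)

/-- The trace exists almost everywhere, because the potential is in `L^p(ν)`. That it is measurable
follows from its being a limit of averages. -/
theorem KernelBound.exists_trace [BorelSpace X] (hD : IsDoublingWith m c) (hF : F ⊆ closure Ω)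
    [SFinite ν] {M : ℝ≥0} {θ ρ : ℝ} (hk : KernelBound m ν M θ ρ) (hρ : 0 < ρ) {p : ℝ} (hp : 1 ≤ p)
    (hθp : θ < p) {K : ℝ≥0} {L : ℝ} (hL : 0 < L) {u : Ω → ℝ} (hu : Measurable u)
    (hup : ∫⁻ x, ‖u x‖ₑ ^ p ∂m < ∞) {h : Ω → ℝ≥0∞} (hh : Measurable h)
    (hhp : ∫⁻ x, h x ^ p ∂m < ∞) (hP : SatisfiesPoincare m F K L p u h) :
    ∃ f : F →ₘ[ν] ℝ, ∀ᵐ z ∂ν, Tendsto (meanDev m u (f z) (z : X)) (𝓝[>] 0) (𝓝 0) := by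
  have := hD.secondCountableTopology_of_subset subset_closure
  have := hD.sigmaFinite
  have hp0 : 0 < p := by linarith
  set r := ρ / L with hr
  have hr0 : 0 < r := by positivity
  have hq : 0 < 1 - θ / p := by rw [sub_pos, div_lt_one hp0]; exact hθp
  have hi : ∀ z : F, ∀ r : ℝ, 0 < r → IntegrableOn u (relBall Ω (z : X) r) m := fun z r hr =>
    hD.integrableOn_relBall hu.aestronglyMeasurable hp hup (hF z.2) hr
  have hfin : ∀ᵐ z : F ∂ν, potential m L p h (z : X) r ^ p < ∞ := by
    refine ae_lt_top ((measurable_potential L p r hh).pow_const p) (ne_top_of_le_ne_top ?_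
      (hk.lintegral_potential_le hp hL hr0 (le_of_eq (mul_div_cancel₀ _ hL.ne')) hh))
    have h1 : ((1 - 2⁻¹ ^ (1 - θ / p))⁻¹ : ℝ≥0∞) ≠ ∞ :=
      ENNReal.inv_ne_top.2 (one_sub_two_inv_rpow_ne_zero hq)
    have h2 : ENNReal.ofReal L ^ (-θ) ≠ ∞ :=
      ENNReal.rpow_ne_top_of_ne_zero (by simpa using hL) (by finiteness)
    have h3 : 0 ≤ p - θ := by linarith
    finiteness
  have hex : ∀ᵐ z : F ∂ν, ∃ a : ℝ,
      Tendsto (fun k : ℕ => ⨍ x in relBall Ω (z : X) (r / 2 ^ k), u x ∂m) atTop (𝓝 a) ∧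
      Tendsto (meanDev m u a (z : X)) (𝓝[>] 0) (𝓝 0) := by
    filter_upwards [hfin] with z hz
    refine hD.exists_tendsto_meanDev hu hF hP z.2 (hi z) hr0 ?_
    intro htop
    rw [htop, ENNReal.top_rpow_of_pos hp0] at hz
    exact lt_irrefl _ hz
  obtain ⟨f, hf, hlim⟩ := measurable_limit_of_tendsto_metrizable_ae
    (fun k : ℕ => (measurable_average_relBall (F := F) (m := m) (r / 2 ^ k) hu).aemeasurable (μ := ν))
    (hex.mono fun z hz => hz.imp fun a ha => ha.1)
  refine ⟨AEEqFun.mk f hf.aestronglyMeasurable, ?_⟩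
  filter_upwards [hex, hlim, AEEqFun.coeFn_mk f hf.aestronglyMeasurable] with z ⟨a, ha1, ha2⟩ h2 h3
  rw [h3, tendsto_nhds_unique h2 ha1]
  exact ha2

end Trace

/-! ### Bounds for the Besov norm of the trace -/

section Besov

variable {X : Type*} [MetricSpace X] [MeasurableSpace X] [BorelSpace X] {Ω F : Set X}
  {m : Measure Ω} {c : ℝ≥0} {ν : Measure F}

theorem lintegral_setLAverage_enorm_sub_le {N : ℝ≥0∞} {t p : ℝ} (hp : 1 ≤ p)
    (hN : ∀ φ : F → ℝ≥0∞, Measurable φ →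
      ∫⁻ y, ⨍⁻ z in Metric.ball y t, φ z ∂ν ∂ν ≤ N * ∫⁻ z, φ z ∂ν)
    {f : F → ℝ} {Φ : F → ℝ≥0∞} (hΦ : Measurable Φ)
    (h : ∀ᵐ y ∂ν, ∀ᵐ z ∂ν, dist z y < t → ‖f y - f z‖ₑ ≤ Φ y + Φ z) :
    ∫⁻ y, ⨍⁻ z in Metric.ball y t, ‖f y - f z‖ₑ ^ p ∂ν ∂ν ≤
      2 ^ (p - 1) * (1 + N) * ∫⁻ y, Φ y ^ p ∂ν := by
  have hp0 : 0 ≤ p := by linarith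
  have h2 : (2 : ℝ≥0∞) ^ (p - 1) ≠ ∞ := by
    have : 0 ≤ p - 1 := by linarith
    finiteness
  calc ∫⁻ y, ⨍⁻ z in Metric.ball y t, ‖f y - f z‖ₑ ^ p ∂ν ∂ν
      ≤ ∫⁻ y, 2 ^ (p - 1) * (Φ y ^ p + ⨍⁻ z in Metric.ball y t, Φ z ^ p ∂ν) ∂ν := by
        refine lintegral_mono_ae ?_
        filter_upwards [h] with y hy
        calc ⨍⁻ z in Metric.ball y t, ‖f y - f z‖ₑ ^ p ∂ν
            ≤ ⨍⁻ z in Metric.ball y t, 2 ^ (p - 1) * (Φ y ^ p + Φ z ^ p) ∂ν := by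
              refine laverage_mono_ae ?_
              filter_upwards [ae_restrict_of_ae hy, ae_restrict_mem measurableSet_ball] with z hz hzt
              exact (ENNReal.rpow_le_rpow (hz hzt) hp0).trans
                (ENNReal.rpow_add_le_mul_rpow_add_rpow _ _ hp)
          _ ≤ _ := by
              rw [setLAverage_const_mul _ _ h2, setLAverage_add_left measurable_const]
              gcongr
              exact setLAverage_const_le _ _
    _ = 2 ^ (p - 1) * (∫⁻ y, Φ y ^ p ∂ν + ∫⁻ y, ⨍⁻ z in Metric.ball y t, Φ z ^ p ∂ν ∂ν) := by
        rw [lintegral_const_mul' _ _ h2, lintegral_add_left (hΦ.pow_const p)]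
    _ ≤ 2 ^ (p - 1) * (∫⁻ y, Φ y ^ p ∂ν + N * ∫⁻ y, Φ y ^ p ∂ν) := by
        gcongr; exact hN _ (hΦ.pow_const p)
    _ = _ := by ring

/-- Raising the Besov norm to the power `p` turns bounds for its two parts into a bound that is
linear in `U`. -/
theorem besovNorm_rpow_le {Z : Type*} [MetricSpace Z] [MeasurableSpace Z] {ν : Measure Z} {α p : ℝ}
    (hp : 1 ≤ p) {f : Z → ℝ} {C U : ℝ≥0∞} (h1 : ∫⁻ y, ‖f y‖ₑ ^ p ∂ν ≤ C * U)
    (h2 : ∀ t : ℝ, 0 < t → ∫⁻ y, ⨍⁻ z in Metric.ball y t,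
      ‖f y - f z‖ₑ ^ p / ENNReal.ofReal (t ^ (α * p)) ∂ν ∂ν ≤ C * U) (R : ℝ≥0∞) :
    besovNorm R α p ν f ^ p ≤ 2 ^ p * C * U := by
  have hp0 : 0 < p := by linarith
  have hi : 0 ≤ 1 / p := by positivity
  have h3 : besovNorm R α p ν f ≤ 2 * (C * U) ^ (1 / p) := by
    rw [besovNorm, two_mul]
    exact add_le_add (ENNReal.rpow_le_rpow h1 hi)
      (iSup_le fun t => iSup₂_le fun ht _ => ENNReal.rpow_le_rpow (h2 t ht) hi)
  refine (ENNReal.rpow_le_rpow h3 hp0.le).trans (le_of_eq ?_)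
  rw [ENNReal.mul_rpow_of_nonneg _ _ hp0.le, ← ENNReal.rpow_mul, one_div_mul_cancel hp0.ne',
    ENNReal.rpow_one, mul_assoc]

/-- The bound for the Besov norm of the trace. For small `t`, the difference of the values at two
points with distance less than `t` is bounded by the potentials with radius `2 t`; for large `t`,
the bound of the `L^p`-norm is enough. -/
theorem KernelBound.exists_besovNorm_le [IsFiniteMeasure ν] (hD : IsDoublingWith m c)
    (hF : F ⊆ closure Ω) {M : ℝ≥0} {θ ρ : ℝ} (hk : KernelBound m ν M θ ρ) (hρ : 0 < ρ) {p : ℝ}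
    (hp : 1 ≤ p) (hθp : θ < p) (K : ℝ≥0) {L : ℝ} (hL : 1 ≤ L) :
    ∃ C : ℝ≥0∞, C ≠ 0 ∧ C ≠ ∞ ∧ ∀ (u : Ω → ℝ) (h : Ω → ℝ≥0∞) (f : F → ℝ), Measurable u →
      Measurable h → Measurable f → SatisfiesPoincare m F K L p u h →
      (∀ᵐ z ∂ν, Tendsto (meanDev m u (f z) (z : X)) (𝓝[>] 0) (𝓝 0)) → ∀ R : ℝ≥0∞,
      besovNorm R (1 - θ / p) p ν f ^ p ≤ C * (∫⁻ x, ‖u x‖ₑ ^ p ∂m + ∫⁻ x, h x ^ p ∂m) := by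
  have := hD.secondCountableTopology_of_subset subset_closure
  have := hD.sigmaFinite
  have hp0 : 0 < p := by linarith
  have hL0 : 0 < L := by linarith
  have hq : 0 < 1 - θ / p := by rw [sub_pos, div_lt_one hp0]; exact hθp
  have hpθ : 0 < p - θ := by linarith
  obtain ⟨N, hN⟩ := hD.exists_lintegral_setLAverage_ball_le hF ν
  set P : ℝ≥0∞ := M * ENNReal.ofReal L ^ (-θ) * ((1 - 2⁻¹ ^ (1 - θ / p))⁻¹ : ℝ≥0∞) ^ p with hP
  have hLt : ENNReal.ofReal L ^ (-θ) ≠ ∞ :=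
    ENNReal.rpow_ne_top_of_ne_zero (by simpa using hL0) (by finiteness)
  have hPt : P ≠ ∞ := by
    have h1 : ((1 - 2⁻¹ ^ (1 - θ / p))⁻¹ : ℝ≥0∞) ≠ ∞ :=
      ENNReal.inv_ne_top.2 (one_sub_two_inv_rpow_ne_zero hq)
    finiteness
  set r := ρ / L with hr
  have hr0 : 0 < r := by positivity
  have hLr : L * r = ρ := mul_div_cancel₀ _ hL0.ne'
  have hrρ : r ≤ ρ := div_le_self hρ.le hL
  have hrt : ENNReal.ofReal r ^ (-θ) ≠ ∞ :=
    ENNReal.rpow_ne_top_of_ne_zero (by simpa using hr0) (by finiteness)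
  have h2t : (2 : ℝ≥0∞) ^ (p - 1) ≠ ∞ := by
    have : 0 ≤ p - 1 := by linarith
    finiteness
  -- `C₁` bounds the `L^p`-norm, `C₂` the mean differences for small `t`, and `C₃` those for large `t`.
  set C₁ : ℝ≥0∞ := 2 ^ (p - 1) * ((c * K) ^ p * (P * ENNReal.ofReal r ^ (p - θ)) +
    M * ENNReal.ofReal r ^ (-θ)) with hC₁
  set C₂ : ℝ≥0∞ := 2 ^ (p - 1) * (1 + N) * ((c ^ 2 * (c * K)) ^ p * (P * 2 ^ (p - θ))) with hC₂
  set C₃ : ℝ≥0∞ := (ENNReal.ofReal (r / 2) ^ (p - θ))⁻¹ * (2 ^ (p - 1) * (1 + N) * C₁) with hC₃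
  have hC₁t : C₁ ≠ ∞ := by finiteness
  have hC₂t : C₂ ≠ ∞ := by finiteness
  have hC₃t : C₃ ≠ ∞ := by
    refine ENNReal.mul_ne_top (ENNReal.inv_ne_top.2 ?_) (by finiteness)
    exact (ENNReal.rpow_pos (by simpa using hr0) (by finiteness)).ne'
  refine ⟨2 ^ p * (1 + C₁ + C₂ + C₃), ?_, by finiteness, ?_⟩
  · refine mul_ne_zero (ENNReal.rpow_pos (by norm_num) (by norm_num)).ne' ?_
    simp [add_assoc]
  intro u h f hu hh hf hPo htr R
  set U := ∫⁻ x, ‖u x‖ₑ ^ p ∂m + ∫⁻ x, h x ^ p ∂m with hU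
  have hpot : ∀ᵐ z : F ∂ν, ∀ s : ℝ, 0 < s →
      meanDev m u (f z) (z : X) s ≤ c * K * potential m L p h (z : X) s := by
    filter_upwards [htr] with z hz s hs
    exact hD.meanDev_le_potential hu hF hPo z.2 hz hs
  have hA : ∫⁻ z, ‖f z‖ₑ ^ p ∂ν ≤ C₁ * U := by
    calc ∫⁻ z, ‖f z‖ₑ ^ p ∂ν ≤ ∫⁻ z : F, 2 ^ (p - 1) * ((c * K) ^ p *
          potential m L p h (z : X) r ^ p + ⨍⁻ x in relBall Ω (z : X) r, ‖u x‖ₑ ^ p ∂m) ∂ν := by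
          refine lintegral_mono_ae ?_
          filter_upwards [hpot] with z hz
          have h1 : ‖f z‖ₑ ≤ meanDev m u (f z) (z : X) r +
              ⨍⁻ x in relBall Ω (z : X) r, ‖u x‖ₑ ∂m := by
            rw [meanDev, ← setLAverage_add_left (hu.sub_const _).enorm,
              ← setLAverage_const (hD.ne_zero z (hF z.2) r hr0) (hD.ne_top z (hF z.2) r hr0) ‖f z‖ₑ]
            refine setLAverage_mono fun x => ?_
            calc ‖f z‖ₑ = ‖-(u x - f z) + u x‖ₑ := by congr 1; ring
              _ ≤ ‖-(u x - f z)‖ₑ + ‖u x‖ₑ := enorm_add_le _ _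
              _ = _ := by rw [enorm_neg]
          calc ‖f z‖ₑ ^ p ≤ (c * K * potential m L p h (z : X) r +
                ⨍⁻ x in relBall Ω (z : X) r, ‖u x‖ₑ ∂m) ^ p :=
                ENNReal.rpow_le_rpow (h1.trans (add_le_add (hz r hr0) le_rfl)) hp0.le
            _ ≤ _ := (ENNReal.rpow_add_le_mul_rpow_add_rpow _ _ hp)
            _ ≤ _ := by
                rw [ENNReal.mul_rpow_of_nonneg _ _ hp0.le]
                gcongr
                exact rpow_setLAverage_le hp hu.enorm.aemeasurable
      _ = 2 ^ (p - 1) * ((c * K) ^ p * ∫⁻ z : F, potential m L p h (z : X) r ^ p ∂ν +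
            ∫⁻ z : F, ⨍⁻ x in relBall Ω (z : X) r, ‖u x‖ₑ ^ p ∂m ∂ν) := by
          rw [lintegral_const_mul' _ _ h2t, lintegral_add_left
            (((measurable_potential L p r hh).pow_const p).const_mul _),
            lintegral_const_mul _ ((measurable_potential L p r hh).pow_const p)]
      _ ≤ 2 ^ (p - 1) * ((c * K) ^ p * (P * ENNReal.ofReal r ^ (p - θ) * U) +
            M * ENNReal.ofReal r ^ (-θ) * U) := by
          gcongr
          · exact (hk.lintegral_potential_le hp hL0 hr0 hLr.le hh).trans
              (mul_le_mul' le_rfl le_add_self)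
          · exact (hk.lintegral_setLAverage_le hr0 hrρ (hu.enorm.pow_const p)).trans
              (mul_le_mul' le_rfl le_self_add)
      _ = _ := by rw [hC₁]; ring
  refine (besovNorm_rpow_le hp (C := 1 + C₁ + C₂ + C₃) (U := U) ?_ ?_ R)
  · refine hA.trans (mul_le_mul' ?_ le_rfl)
    rw [add_assoc, add_assoc, add_left_comm]; exact le_self_add
  intro t ht
  have ht0 : ENNReal.ofReal t ≠ 0 := by simpa using ht
  have htp : ENNReal.ofReal (t ^ ((1 - θ / p) * p)) = ENNReal.ofReal t ^ (p - θ) := by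
    rw [ENNReal.ofReal_rpow_of_pos ht, sub_mul, one_mul, div_mul_cancel₀ _ hp0.ne']
  have ht1 : ENNReal.ofReal t ^ (p - θ) ≠ 0 :=
    (ENNReal.rpow_pos (by simpa using ht) (by finiteness)).ne'
  have ht2 : ENNReal.ofReal t ^ (p - θ) ≠ ∞ := by finiteness
  have hdiv : ∫⁻ y, ⨍⁻ z in Metric.ball y t,
      ‖f y - f z‖ₑ ^ p / ENNReal.ofReal (t ^ ((1 - θ / p) * p)) ∂ν ∂ν =
      (ENNReal.ofReal t ^ (p - θ))⁻¹ * ∫⁻ y, ⨍⁻ z in Metric.ball y t, ‖f y - f z‖ₑ ^ p ∂ν ∂ν := by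
    rw [htp]
    simp_rw [ENNReal.div_eq_inv_mul]
    rw [← lintegral_const_mul' _ _ (ENNReal.inv_ne_top.2 ht1)]
    refine lintegral_congr fun y => setLAverage_const_mul _ _ (ENNReal.inv_ne_top.2 ht1)
  rw [hdiv]
  rcases le_total (2 * t) r with htr' | htr'
  · have h2t0 : 0 < 2 * t := by positivity
    have hcK : (c : ℝ≥0∞) ^ 2 * (c * K) ≠ ∞ := by finiteness
    have hB := lintegral_setLAverage_enorm_sub_le (ν := ν) hp (hN t ht) (f := f)
      (Φ := fun z : F => c ^ 2 * (c * K) * potential m L p h (z : X) (2 * t))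
      ((measurable_potential L p (2 * t) hh).const_mul _) (by
        filter_upwards [hpot] with y hy
        filter_upwards [hpot] with z hz hzy
        rw [dist_comm, Subtype.dist_eq] at hzy
        refine (hD.enorm_sub_le_meanDev hu (hF y.2) (hF z.2) ht hzy.le).trans ?_
        exact (mul_le_mul' le_rfl (add_le_add (hy _ h2t0) (hz _ h2t0))).trans (le_of_eq (by ring)))
    calc _ ≤ (ENNReal.ofReal t ^ (p - θ))⁻¹ * (2 ^ (p - 1) * (1 + N) *
            ((c ^ 2 * (c * K)) ^ p * (P * (2 ^ (p - θ) * ENNReal.ofReal t ^ (p - θ)) * U))) := by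
          refine mul_le_mul' le_rfl (hB.trans ?_)
          simp_rw [ENNReal.mul_rpow_of_nonneg _ _ hp0.le]
          rw [lintegral_const_mul _ ((measurable_potential L p (2 * t) hh).pow_const p)]
          refine mul_le_mul' le_rfl (mul_le_mul' le_rfl ?_)
          refine (hk.lintegral_potential_le hp hL0 h2t0 ?_ hh).trans
            (mul_le_mul' (mul_le_mul' le_rfl ?_) le_add_self)
          · rw [← hLr]; gcongr
          · rw [ENNReal.ofReal_mul (by norm_num), ENNReal.mul_rpow_of_nonneg _ _ hpθ.le]
            simp
      _ = (ENNReal.ofReal t ^ (p - θ))⁻¹ * ENNReal.ofReal t ^ (p - θ) * (C₂ * U) := by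
          rw [hC₂]; ring
      _ = C₂ * U := by rw [ENNReal.inv_mul_cancel ht1 ht2, one_mul]
      _ ≤ _ := by
          refine mul_le_mul' ?_ le_rfl
          rw [add_assoc, add_left_comm]; exact le_self_add
  · have hB := lintegral_setLAverage_enorm_sub_le (ν := ν) hp (hN t ht) (f := f)
      (Φ := fun z : F => ‖f z‖ₑ) hf.enorm (Eventually.of_forall fun y => Eventually.of_forall
        fun z _ => enorm_sub_le)
    calc _ ≤ (ENNReal.ofReal (r / 2) ^ (p - θ))⁻¹ * (2 ^ (p - 1) * (1 + N) * (C₁ * U)) := by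
          refine mul_le_mul' (ENNReal.inv_le_inv.2 (ENNReal.rpow_le_rpow
            (ENNReal.ofReal_le_ofReal (by linarith)) hpθ.le)) (hB.trans ?_)
          exact mul_le_mul' le_rfl hA
      _ = C₃ * U := by rw [hC₃]; ring
      _ ≤ _ := mul_le_mul' le_add_self le_rfl

end Besov

/-! ### The trace operators on the Hajłasz and Newtonian spaces -/

section Poincare

variable {X : Type*} [MetricSpace X] [MeasurableSpace X] {Ω F : Set X}
  {m : Measure Ω} {c : ℝ≥0}

/-- A Hajłasz gradient satisfies the Poincaré inequality, on balls with arbitrary centres. -/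
theorem SatisfiesPoincare.of_hajlasz [OpensMeasurableSpace X] {u : Ω → ℝ} {g : Ω → ℝ≥0∞}
    (hg : Measurable g)
    (h : ∀ᵐ y ∂m, ∀ᵐ x ∂m, ‖u x - u y‖ₑ ≤ edist x y * (g x + g y)) {p : ℝ} (hp : 1 ≤ p)
    (F : Set X) : SatisfiesPoincare m F 4 1 p u g := by
  intro z _ r hr
  have hB : MeasurableSet (relBall Ω z r) :=
    Metric.isOpen_ball.measurableSet.preimage measurable_subtype_coe
  set D := ENNReal.ofReal (2 * r) with hD
  have hDt : D ≠ ∞ := ENNReal.ofReal_ne_top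
  set G := ⨍⁻ x in relBall Ω z r, g x ∂m with hG
  have hdist : ∀ x ∈ relBall Ω z r, ∀ y ∈ relBall Ω z r, edist x y ≤ D := by
    intro x hx y hy
    rw [edist_dist]
    refine ENNReal.ofReal_le_ofReal ?_
    have h1 : dist (x : X) z < r := hx
    have h2 : dist (y : X) z < r := hy
    have h3 := dist_triangle_right (x : X) y z
    rw [Subtype.dist_eq]; linarith
  calc meanOsc m u z r ≤ ⨍⁻ y in relBall Ω z r, D * (g y + G) ∂m := by
        refine laverage_mono_ae ?_
        filter_upwards [ae_restrict_of_ae h, ae_restrict_mem hB] with y hy hyB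
        calc ⨍⁻ x in relBall Ω z r, ‖u x - u y‖ₑ ∂m
            ≤ ⨍⁻ x in relBall Ω z r, D * (g x + g y) ∂m := by
              refine laverage_mono_ae ?_
              filter_upwards [ae_restrict_of_ae hy, ae_restrict_mem hB] with x hx hxB
              exact hx.trans (mul_le_mul' (hdist x hxB y hyB) le_rfl)
          _ ≤ D * (G + g y) := by
              rw [setLAverage_const_mul _ _ hDt, setLAverage_add_left hg]
              exact mul_le_mul' le_rfl (add_le_add le_rfl (setLAverage_const_le _ _))
          _ = _ := by rw [add_comm]
    _ ≤ D * (G + G) := by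
        rw [setLAverage_const_mul _ _ hDt, setLAverage_add_left hg]
        exact mul_le_mul' le_rfl (add_le_add le_rfl (setLAverage_const_le _ _))
    _ = 4 * (ENNReal.ofReal r * G) := by
        rw [hD, ENNReal.ofReal_mul (by norm_num), ← two_mul]
        simp only [ENNReal.ofReal_ofNat]; ring
    _ ≤ _ := by
        rw [one_mul]
        exact mul_le_mul' le_rfl (mul_le_mul' le_rfl (setLAverage_le_rpow hp hg.aemeasurable))

theorem meanOsc_le_two_mul {u : Ω → ℝ} (hu : Measurable u) (a : ℝ) (z : X) (r : ℝ) :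
    meanOsc m u z r ≤ 2 * meanDev m u a z r := by
  have hm : Measurable fun x => ‖u x - a‖ₑ := (hu.sub_const a).enorm
  calc meanOsc m u z r ≤ ⨍⁻ y in relBall Ω z r, (‖u y - a‖ₑ + meanDev m u a z r) ∂m := by
        refine setLAverage_mono fun y => ?_
        calc ⨍⁻ x in relBall Ω z r, ‖u x - u y‖ₑ ∂m
            ≤ ⨍⁻ x in relBall Ω z r, (‖u x - a‖ₑ + ‖u y - a‖ₑ) ∂m := by
              refine setLAverage_mono fun x => ?_
              rw [show u x - u y = (u x - a) + -(u y - a) by ring, ← enorm_neg (u y - a)]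
              exact enorm_add_le _ _
          _ ≤ meanDev m u a z r + ‖u y - a‖ₑ := by
              rw [setLAverage_add_left hm]
              exact add_le_add le_rfl (setLAverage_const_le _ _)
          _ = _ := add_comm _ _
    _ ≤ meanDev m u a z r + meanDev m u a z r := by
        rw [setLAverage_add_left hm]
        exact add_le_add le_rfl (setLAverage_const_le _ _)
    _ = _ := (two_mul _).symm

/-- A Poincaré inequality on the balls of `Ω` implies one on the balls centred in `F ⊆ closure Ω`,
with constants that do not depend on the function. -/
theorem HasPoincareInequality.exists_satisfiesPoincare (hD : IsDoublingWith m c)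
    (hF : F ⊆ closure Ω) {p : ℝ} (hp : 1 ≤ p) (h : HasPoincareInequality p m) :
    ∃ (K : ℝ≥0) (L : ℝ), 1 ≤ L ∧ ∀ (u v : Ω → ℝ) (g : Ω → ℝ≥0∞), Measurable u → v =ᵐ[m] u →
      ∫⁻ x, ‖u x‖ₑ ^ p ∂m < ∞ → IsUpperGradient v g → SatisfiesPoincare m F K L p u g := by
  obtain ⟨C, L, hC, hL, hPI⟩ := h
  have hp0 : 0 < p := by linarith
  have hi : 0 ≤ 1 / p := by positivity
  refine ⟨2 * c ^ 2 * 2 * C.toNNReal * c ^ (1 / p), 2 * L + 1, by linarith, ?_⟩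
  intro u v g hu hvu hup hg z hz r hr
  obtain ⟨x₀, hx₀, hzx⟩ := Metric.mem_closure_iff.1 (hF hz) r hr
  have hx₀' : x₀ ∈ closure Ω := subset_closure hx₀
  have hv : ∀ (x : Ω) (r : ℝ), IntegrableOn v (Metric.ball x r) m := by
    intro x r
    rcases le_or_gt r 0 with hr | hr
    · rw [Metric.ball_eq_empty.2 hr]; exact integrableOn_empty
    · exact (hD.integrableOn_relBall hu.aestronglyMeasurable hp hup (subset_closure x.2)
        hr).congr_fun_ae (ae_restrict_of_ae hvu.symm)
  have h2r : 0 < 2 * r := by positivity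
  have h1 := hPI v g hv hg ⟨x₀, hx₀⟩ (2 * r) h2r
  set a := ⨍ y in Metric.ball (⟨x₀, hx₀⟩ : Ω) (2 * r), v y ∂m with ha
  have h2 : meanDev m u a z r ≤ (c : ℝ≥0∞) ^ 2 * meanDev m v a x₀ (2 * r) := by
    rw [meanDev_congr hvu.symm]
    exact hD.setLAverage_le 2 (hF hz) hx₀' hr h2r (by linarith) (by rw [dist_comm]; linarith) _
  have hC0 : ENNReal.ofReal C ≠ ∞ := ENNReal.ofReal_ne_top
  have h3 : meanDev m v a x₀ (2 * r) ≤ ENNReal.ofReal (2 * r) * (ENNReal.ofReal C *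
      (⨍⁻ y in relBall Ω x₀ (L * (2 * r)), g y ^ p ∂m) ^ (1 / p)) := by
    refine h1.trans (le_of_eq ?_)
    simp_rw [ENNReal.mul_rpow_of_nonneg _ _ hp0.le]
    rw [setLAverage_const_mul _ _ (by finiteness), ENNReal.mul_rpow_of_nonneg _ _ hi,
      ← ENNReal.rpow_mul, mul_one_div_cancel hp0.ne', ENNReal.rpow_one]
    rfl
  have hLr : 0 < L * (2 * r) := by positivity
  have h4 : ⨍⁻ y in relBall Ω x₀ (L * (2 * r)), g y ^ p ∂m ≤
      c * ⨍⁻ y in relBall Ω z ((2 * L + 1) * r), g y ^ p ∂m := by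
    have := hD.setLAverage_le 1 hx₀' (hF hz) hLr (r' := (2 * L + 1) * r) (by positivity)
      (by rw [dist_comm]; linarith) (by rw [pow_one]; nlinarith) (fun y => g y ^ p)
    rwa [pow_one] at this
  calc meanOsc m u z r ≤ 2 * meanDev m u a z r := meanOsc_le_two_mul hu a z r
    _ ≤ 2 * ((c : ℝ≥0∞) ^ 2 * (ENNReal.ofReal (2 * r) * (ENNReal.ofReal C *
          (c * ⨍⁻ y in relBall Ω z ((2 * L + 1) * r), g y ^ p ∂m) ^ (1 / p)))) := by
        gcongr
        refine h2.trans (mul_le_mul' le_rfl (h3.trans ?_))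
        gcongr
    _ = _ := by
        rw [ENNReal.mul_rpow_of_nonneg _ _ hi, ENNReal.ofReal_mul (by norm_num)]
        push_cast
        rw [← ENNReal.coe_rpow_of_nonneg _ hi, ENNReal.ofReal_ofNat,
          show ((C.toNNReal : ℝ≥0) : ℝ≥0∞) = ENNReal.ofReal C from rfl]
        ring

end Poincare

section Operator

variable {X : Type*} [MetricSpace X] [MeasurableSpace X] [BorelSpace X] {μ : Measure X}
  {Ω F : Set X} {ν : Measure F} {θ : ℝ}

theorem HasUpperCodimBound.isFiniteMeasure (hΩ : IsOpen Ω) {c : ℝ≥0}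
    (hD : IsDoublingWith (measureOn μ Ω) c) (hF : F ⊆ closure Ω) (hb : Bornology.IsBounded F)
    (h : HasUpperCodimBound μ Ω F ν θ) : IsFiniteMeasure ν := by
  obtain ⟨C, ρ, hρ, hdiam, h⟩ := h
  rcases isEmpty_or_nonempty F with h0 | ⟨⟨z⟩⟩
  · rw [ν.eq_zero_of_isEmpty]; infer_instance
  have huniv : (univ : Set F) ⊆ Metric.ball z ρ := by
    intro y _
    have h1 : dist (y : X) z ≤ Metric.diam F := Metric.dist_le_diam_of_mem hb y.2 z.2
    have h2 : 0 ≤ Metric.diam F := Metric.diam_nonneg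
    rw [Metric.mem_ball, Subtype.dist_eq]
    linarith
  refine ⟨(measure_mono huniv).trans_lt ((h z ρ hρ le_rfl).trans_lt ?_)⟩
  rw [← measureOn_relBall hΩ]
  refine ENNReal.div_lt_top (ENNReal.mul_ne_top ENNReal.coe_ne_top
    (hD.ne_top z (hF z.2) ρ hρ)) ?_
  simpa using Real.rpow_pos_of_pos hρ θ

theorem HasUpperCodimBound.exists_kernelBound (hΩ : IsOpen Ω) {c : ℝ≥0}
    (hD : IsDoublingWith (measureOn μ Ω) c) (hF : F ⊆ closure Ω) (hθ : 0 ≤ θ)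
    (h : HasUpperCodimBound μ Ω F ν θ) :
    ∃ (M : ℝ≥0) (ρ : ℝ), 0 < ρ ∧ KernelBound (measureOn μ Ω) ν M θ ρ := by
  obtain ⟨C, ρ, hρ, -, h⟩ := h
  refine ⟨c ^ 2 * C, ρ / 2, by positivity, fun r hr hrρ x => ?_⟩
  set S : Set F := {z : F | dist (z : X) x < r} with hS
  rcases S.eq_empty_or_nonempty with h0 | ⟨z₀, hz₀⟩
  · rw [h0]; simp
  have h2r : 0 < 2 * r := by positivity
  set b := measureOn μ Ω (relBall Ω (z₀ : X) (2 * r)) with hb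
  have hb0 : b ≠ 0 := hD.ne_zero z₀ (hF z₀.2) _ h2r
  have hbt : b ≠ ∞ := hD.ne_top z₀ (hF z₀.2) _ h2r
  have hzz : ∀ z ∈ S, dist (z : X) z₀ < 2 * r := by
    intro z hz
    have h1 : dist (z : X) x < r := hz
    have h2 : dist (z₀ : X) x < r := hz₀
    have := dist_triangle_right (z : X) z₀ x
    linarith
  have hSm : MeasurableSet S := (isOpen_lt (by fun_prop) continuous_const).measurableSet
  have h1 : ∀ z ∈ S, (measureOn μ Ω (relBall Ω (z : X) r))⁻¹ ≤ (c : ℝ≥0∞) ^ 2 * b⁻¹ := by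
    intro z hz
    have h2 : b ≤ (c : ℝ≥0∞) ^ 2 * measureOn μ Ω (relBall Ω (z : X) r) :=
      hD.le_pow_mul_of_subset 2 (hF z.2) hr (by rw [dist_comm]; have := hzz z hz; linarith)
    rw [← div_eq_mul_inv, ENNReal.le_div_iff_mul_le (Or.inl hb0) (Or.inl hbt), mul_comm,
      ← div_eq_mul_inv]
    exact ENNReal.div_le_of_le_mul h2
  have h3 : ν S ≤ C * b / ENNReal.ofReal (r ^ θ) := by
    calc ν S ≤ ν (Metric.ball z₀ (2 * r)) := measure_mono fun z hz => hzz z hz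
      _ ≤ C * b / ENNReal.ofReal ((2 * r) ^ θ) := by
          rw [hb, measureOn_relBall hΩ]; exact h z₀ (2 * r) h2r (by linarith)
      _ ≤ _ := ENNReal.div_le_div_left (ENNReal.ofReal_le_ofReal
          (Real.rpow_le_rpow hr.le (by linarith) hθ)) _
  calc ∫⁻ z in S, (measureOn μ Ω (relBall Ω (z : X) r))⁻¹ ∂ν
      ≤ ∫⁻ _z in S, (c : ℝ≥0∞) ^ 2 * b⁻¹ ∂ν := setLIntegral_mono' hSm h1
    _ = (c : ℝ≥0∞) ^ 2 * b⁻¹ * ν S := setLIntegral_const _ _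
    _ ≤ (c : ℝ≥0∞) ^ 2 * b⁻¹ * (C * b / ENNReal.ofReal (r ^ θ)) := by gcongr
    _ = (c : ℝ≥0∞) ^ 2 * C * (b⁻¹ * b) * (ENNReal.ofReal (r ^ θ))⁻¹ := by
        rw [div_eq_mul_inv]; ring
    _ = _ := by
        rw [ENNReal.inv_mul_cancel hb0 hbt, ← ENNReal.ofReal_rpow_of_pos hr, ENNReal.rpow_neg]
        push_cast; ring

theorem le_const_mul_rpow_of_rpow_le {p : ℝ} (hp : 0 < p) {A C U : ℝ≥0∞} (hC : C ≠ ∞)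
    (h : A ^ p ≤ C * U) : A ≤ ((C ^ (1 / p)).toNNReal : ℝ≥0∞) * U ^ (1 / p) := by
  have hi : 0 ≤ 1 / p := by positivity
  rw [ENNReal.coe_toNNReal (by finiteness), ← ENNReal.mul_rpow_of_nonneg _ _ hi, one_div,
    ENNReal.le_rpow_inv_iff hp]
  exact h

/-- A trace operator exists on each space of functions with a gradient that satisfies a Poincaré
inequality; the norm is given by an infimum over the gradients. -/
theorem exists_isBoundedTraceOperator {p : ℝ} (hp : 1 ≤ p) (hΩ : IsOpen Ω)
    (hD : IsDoublingOn μ Ω) (hF : F ⊆ closure Ω) (hb : Bornology.IsBounded F) (hθ : 0 < θ)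
    (hν : HasUpperCodimBound μ Ω F ν θ) (hθp : θ < p)
    (V : Submodule ℝ (Ω →ₘ[measureOn μ Ω] ℝ)) (N : (Ω →ₘ[measureOn μ Ω] ℝ) → ℝ≥0∞)
    {ι : Type*} (S : (Ω →ₘ[measureOn μ Ω] ℝ) → ι → Prop) (g : ι → Ω → ℝ≥0∞) (K : ℝ≥0) {L : ℝ}
    (hL : 1 ≤ L)
    (hN : ∀ u : V, N u = (∫⁻ x, ‖(u : Ω →ₘ[measureOn μ Ω] ℝ) x‖ₑ ^ p ∂(measureOn μ Ω) +
      ⨅ (i) (_ : S u i), ∫⁻ x, g i x ^ p ∂(measureOn μ Ω)) ^ (1 / p))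
    (hfin : ∀ u : V, N u < ∞)
    (hS : ∀ (u : V) (i : ι), S u i →
      ∫⁻ x, ‖(u : Ω →ₘ[measureOn μ Ω] ℝ) x‖ₑ ^ p ∂(measureOn μ Ω) < ∞ →
      ∃ h, Measurable h ∧ g i =ᵐ[measureOn μ Ω] h ∧
        SatisfiesPoincare (measureOn μ Ω) F K L p (u : Ω →ₘ[measureOn μ Ω] ℝ) h) :
    ∃ T : V →ₗ[ℝ] (F →ₘ[ν] ℝ), IsBoundedTraceOperator μ Ω F ν V N (1 - θ / p) p T := by
  have hp0 : 0 < p := by linarith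
  obtain ⟨c, hD⟩ := hD.exists_isDoublingWith hΩ
  have := hν.isFiniteMeasure hΩ hD hF hb
  obtain ⟨M, ρ, hρ, hk⟩ := hν.exists_kernelBound hΩ hD hF hθ.le
  have hfin' : ∀ u : V, ∫⁻ x, ‖(u : Ω →ₘ[measureOn μ Ω] ℝ) x‖ₑ ^ p ∂(measureOn μ Ω) < ∞ ∧
      ∃ i, S u i ∧ ∫⁻ x, g i x ^ p ∂(measureOn μ Ω) < ∞ := by
    intro u
    have h1 := hfin u
    rw [hN, ENNReal.rpow_lt_top_iff_of_pos (by positivity), ENNReal.add_lt_top] at h1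
    simpa only [iInf_lt_iff, exists_prop] using h1
  have hcongr : ∀ {i : ι} {h : Ω → ℝ≥0∞}, g i =ᵐ[measureOn μ Ω] h →
      ∫⁻ x, g i x ^ p ∂(measureOn μ Ω) = ∫⁻ x, h x ^ p ∂(measureOn μ Ω) := fun hi =>
    lintegral_congr_ae (hi.mono fun x hx => by simp only [hx])
  obtain ⟨T, hT⟩ := hD.exists_linearMap (ν := ν) hF V (by
    intro u
    obtain ⟨hu, i, hi, hgi⟩ := hfin' u
    obtain ⟨h, hh, hgh, hP⟩ := hS u i hi hu
    exact hk.exists_trace hD hF hρ hp hθp (by linarith) (AEEqFun.measurable _) hu hh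
      (by rwa [← hcongr hgh]) hP)
  obtain ⟨C, hC0, hCt, hC⟩ := hk.exists_besovNorm_le hD hF hρ hp hθp K hL
  refine ⟨T, hT, fun R _ => ⟨(C ^ (1 / p)).toNNReal, fun u => ?_⟩⟩
  rw [hN]
  refine le_const_mul_rpow_of_rpow_le hp0 hCt (le_mul_add_iInf hC0 hCt fun i hi => ?_)
  obtain ⟨h, hh, hgh, hP⟩ := hS u i hi (hfin' u).1
  rw [hcongr hgh]
  exact hC _ h (T u) (AEEqFun.measurable _) hh (AEEqFun.measurable _) hP (hT u) R

theorem IsHajlaszGradient.exists_satisfiesPoincare {m : Measure Ω} {u : Ω → ℝ} {g : Ω → ℝ≥0∞}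
    (h : IsHajlaszGradient m u g) {p : ℝ} (hp : 1 ≤ p) (F : Set X) :
    ∃ k, Measurable k ∧ g =ᵐ[m] k ∧ SatisfiesPoincare m F 4 1 p u k := by
  obtain ⟨hg, E, hE, h⟩ := h
  refine ⟨hg.mk g, hg.measurable_mk, hg.ae_eq_mk,
    SatisfiesPoincare.of_hajlasz hg.measurable_mk ?_ hp F⟩
  have hE' : ∀ᵐ x ∂m, x ∉ E := measure_eq_zero_iff_ae_notMem.1 hE
  filter_upwards [hE', hg.ae_eq_mk] with y hy hgy
  filter_upwards [hE', hg.ae_eq_mk] with x hx hgx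
  rw [← hgx, ← hgy]
  exact h x hx y hy

theorem exists_isBoundedTraceOperator_hajlasz {p : ℝ} (hp : 1 ≤ p) (hΩ : IsOpen Ω)
    (hD : IsDoublingOn μ Ω) (hF : F ⊆ closure Ω) (hb : Bornology.IsBounded F) (hθ : 0 < θ)
    (hν : HasUpperCodimBound μ Ω F ν θ) (hθp : θ < p) :
    ∃ T : HajlaszSpace p hp (measureOn μ Ω) →ₗ[ℝ] (F →ₘ[ν] ℝ),
      IsBoundedTraceOperator μ Ω F ν (HajlaszSpace p hp (measureOn μ Ω))
        (hajlaszNorm p (measureOn μ Ω)) (1 - θ / p) p T :=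
  exists_isBoundedTraceOperator hp hΩ hD hF hb hθ hν hθp _ _
    (fun u g => IsHajlaszGradient (measureOn μ Ω) u g) id 4 le_rfl (fun _ => rfl) (fun u => u.2)
    fun _ _ hg _ => hg.exists_satisfiesPoincare hp F

theorem exists_isBoundedTraceOperator_newton {p : ℝ} (hp : 1 ≤ p) (hΩ : IsOpen Ω)
    (hD : IsDoublingOn μ Ω) (hF : F ⊆ closure Ω) (hb : Bornology.IsBounded F) (hθ : 0 < θ)
    (hν : HasUpperCodimBound μ Ω F ν θ) (hθp : θ < p)
    (hP : HasPoincareInequality p (measureOn μ Ω)) :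
    ∃ T : NewtonSpace p hp (measureOn μ Ω) →ₗ[ℝ] (F →ₘ[ν] ℝ),
      IsBoundedTraceOperator μ Ω F ν (NewtonSpace p hp (measureOn μ Ω))
        (newtonNorm p (measureOn μ Ω)) (1 - θ / p) p T := by
  obtain ⟨c, hD'⟩ := hD.exists_isDoublingWith hΩ
  obtain ⟨K, L, hL, hK⟩ := hP.exists_satisfiesPoincare hD' hF hp
  refine exists_isBoundedTraceOperator hp hΩ hD hF hb hθ hν hθp _ _
    (ι := (Ω → ℝ) × (Ω → ℝ≥0∞)) (fun u i => i.1 =ᵐ[measureOn μ Ω] u ∧ IsUpperGradient i.1 i.2)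
    (fun i => i.2) K hL (fun u => ?_) (fun u => u.2) ?_
  · rw [newtonNorm]
    simp only [iInf_prod, iInf_and]
    congr 2
    refine iInf_congr fun v => ?_
    rw [iInf_comm]
  · rintro u ⟨v, g⟩ ⟨hvu, hg⟩ hup
    exact ⟨g, hg.1, Eventually.of_forall fun _ => rfl, hK u v g (AEEqFun.measurable _) hvu hup hg⟩

end Operator

/-! ### The geometry of the cusp -/

section Plane

theorem dist_le_abs_add_abs (x y : EuclideanSpace ℝ (Fin 2)) :
    dist x y ≤ |x 0 - y 0| + |x 1 - y 1| := by
  rw [EuclideanSpace.dist_eq, Fin.sum_univ_two, Real.dist_eq, Real.dist_eq]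
  refine Real.sqrt_le_iff.2 ⟨by positivity, ?_⟩
  nlinarith [mul_nonneg (abs_nonneg (x 0 - y 0)) (abs_nonneg (x 1 - y 1))]

theorem abs_sub_le_dist (x y : EuclideanSpace ℝ (Fin 2)) (i : Fin 2) : |x i - y i| ≤ dist x y := by
  rw [dist_eq_norm, ← Real.norm_eq_abs]
  exact PiLp.norm_apply_le (x - y) i

theorem volume_rectangle (a b c d : ℝ) :
    volume {x : EuclideanSpace ℝ (Fin 2) | (a < x 0 ∧ x 0 < b) ∧ (c < x 1 ∧ x 1 < d)} =
      ENNReal.ofReal (b - a) * ENNReal.ofReal (d - c) := by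
  have h := (EuclideanSpace.volume_preserving_symm_measurableEquiv_toLp (Fin 2)).measure_preimage
    (s := univ.pi ![Ioo a b, Ioo c d])
    (MeasurableSet.univ_pi fun i => by fin_cases i <;> exact measurableSet_Ioo).nullMeasurableSet
  rw [volume_pi_pi, Fin.prod_univ_two] at h
  simp only [Matrix.cons_val_zero, Matrix.cons_val_one, Real.volume_Ioo] at h
  rw [← h]
  congr 1
  ext x
  simp [Fin.forall_fin_two]

end Plane

section Cusp

theorem isOpen_cuspDomain : IsOpen cuspDomain := by
  have h0 : Continuous fun x : EuclideanSpace ℝ (Fin 2) => x 0 := by fun_prop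
  have h1 : Continuous fun x : EuclideanSpace ℝ (Fin 2) => x 1 := by fun_prop
  exact (isOpen_lt continuous_const h1).and
    ((isOpen_lt h1 (h0.pow 2)).and (isOpen_lt (h0.pow 2) h0))

theorem mem_cuspDomain_iff {x : EuclideanSpace ℝ (Fin 2)} :
    x ∈ cuspDomain ↔ (0 < x 0 ∧ x 0 < 1) ∧ 0 < x 1 ∧ x 1 < x 0 ^ 2 := by
  constructor
  · rintro ⟨h1, h2, h3⟩
    have h4 : 0 < x 0 := lt_of_le_of_lt (sq_nonneg _) h3
    exact ⟨⟨h4, by nlinarith⟩, h1, h2⟩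
  · rintro ⟨⟨h1, h2⟩, h3, h4⟩
    exact ⟨h3, h4, by nlinarith⟩

theorem isConnected_cuspDomain : IsConnected cuspDomain := by
  have h : cuspDomain = (fun q : ℝ × ℝ => (!₂[q.1, q.2 * q.1 ^ 2] : EuclideanSpace ℝ (Fin 2))) ''
      (Ioo 0 1 ×ˢ Ioo 0 1) := by
    ext x
    rw [mem_cuspDomain_iff]
    constructor
    · rintro ⟨⟨h1, h2⟩, h3, h4⟩
      refine ⟨(x 0, x 1 / x 0 ^ 2), ⟨⟨h1, h2⟩, by positivity, ?_⟩, ?_⟩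
      · rw [div_lt_one (by positivity)]; exact h4
      · ext i
        fin_cases i
        · simp
        · simp [h1.ne']
    · rintro ⟨⟨s, τ⟩, ⟨⟨h1, h2⟩, h3, h4⟩, rfl⟩
      simp only at h1 h2 h3 h4
      have : 0 < s ^ 2 := by positivity
      simp only [Matrix.cons_val_zero, Matrix.cons_val_one]
      exact ⟨⟨h1, h2⟩, by positivity, by nlinarith⟩
  rw [h]
  refine IsConnected.image ?_ _ (Continuous.continuousOn ?_)
  · exact (isConnected_Ioo one_pos).prod (isConnected_Ioo one_pos)
  · refine (PiLp.continuous_toLp 2 _).comp (continuous_pi fun i => ?_)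
    fin_cases i
    · exact continuous_fst
    · exact continuous_snd.mul (continuous_fst.pow 2)

theorem closure_cuspDomain_subset {z : EuclideanSpace ℝ (Fin 2)} (hz : z ∈ closure cuspDomain) :
    (0 ≤ z 0 ∧ z 0 ≤ 1) ∧ 0 ≤ z 1 ∧ z 1 ≤ z 0 ^ 2 := by
  have c0 : Continuous fun x : EuclideanSpace ℝ (Fin 2) => x 0 := by fun_prop
  have c1 : Continuous fun x : EuclideanSpace ℝ (Fin 2) => x 1 := by fun_prop
  have hc : IsClosed {z : EuclideanSpace ℝ (Fin 2) |
      (0 ≤ z 0 ∧ z 0 ≤ 1) ∧ 0 ≤ z 1 ∧ z 1 ≤ z 0 ^ 2} :=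
    ((isClosed_le continuous_const c0).inter (isClosed_le c0 continuous_const)).inter
      ((isClosed_le continuous_const c1).inter (isClosed_le c1 (c0.pow 2)))
  refine closure_minimal (fun x hx => ?_) hc hz
  obtain ⟨⟨h1, h2⟩, h3, h4⟩ := mem_cuspDomain_iff.1 hx
  exact ⟨⟨h1.le, h2.le⟩, h3.le, h4.le⟩

theorem dist_le_two_of_mem_closure_cuspDomain {y z : EuclideanSpace ℝ (Fin 2)}
    (hy : y ∈ closure cuspDomain) (hz : z ∈ closure cuspDomain) : dist y z ≤ 2 := by
  obtain ⟨⟨h1, h2⟩, h3, h4⟩ := closure_cuspDomain_subset hy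
  obtain ⟨⟨k1, k2⟩, k3, k4⟩ := closure_cuspDomain_subset hz
  have h5 : y 1 ≤ 1 := by nlinarith
  have k5 : z 1 ≤ 1 := by nlinarith
  refine (dist_le_abs_add_abs y z).trans ?_
  have e1 : |y 0 - z 0| ≤ 1 := abs_le.2 ⟨by linarith, by linarith⟩
  have e2 : |y 1 - z 1| ≤ 1 := abs_le.2 ⟨by linarith, by linarith⟩
  linarith

theorem isBounded_closure_cuspDomain : Bornology.IsBounded (closure cuspDomain) :=
  Metric.isBounded_iff.2 ⟨2, fun _ hy _ hz => dist_le_two_of_mem_closure_cuspDomain hy hz⟩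

theorem frontier_cuspDomain_cases {z : EuclideanSpace ℝ (Fin 2)} (hz : z ∈ frontier cuspDomain) :
    z 1 = 0 ∨ z 1 = z 0 ^ 2 ∨ z 0 = 1 := by
  rw [isOpen_cuspDomain.frontier_eq] at hz
  obtain ⟨⟨h1, h2⟩, h3, h4⟩ := closure_cuspDomain_subset hz.1
  by_contra! h
  refine hz.2 (mem_cuspDomain_iff.2 ⟨⟨?_, h2.lt_of_ne h.2.2⟩, h3.lt_of_ne' h.1, h4.lt_of_ne h.2.1⟩)
  have : 0 < z 0 ^ 2 := (h3.lt_of_ne' h.1).trans_le h4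
  exact h1.lt_of_ne fun h0 => by rw [← h0] at this; norm_num at this

theorem mem_frontier_cuspDomain {s y : ℝ} (hs : 0 < s) (hs1 : s < 1) (hy : y = 0 ∨ y = s ^ 2) :
    (!₂[s, y] : EuclideanSpace ℝ (Fin 2)) ∈ frontier cuspDomain := by
  have hs2 : 0 < s ^ 2 := by positivity
  rw [isOpen_cuspDomain.frontier_eq]
  refine ⟨Metric.mem_closure_iff.2 fun ε hε => ?_, fun h => ?_⟩
  · -- Move the point vertically into the cusp.
    set δ := min (ε / 2) (s ^ 2 / 2) with hδ
    have h0 : 0 < δ := by positivity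
    have h1 : δ ≤ ε / 2 := min_le_left _ _
    have h2 : δ ≤ s ^ 2 / 2 := min_le_right _ _
    obtain ⟨w, hw0, hw1, hwy⟩ : ∃ w : ℝ, 0 < w ∧ w < s ^ 2 ∧ |y - w| < ε := by
      rcases hy with rfl | rfl
      · exact ⟨δ, h0, by linarith, by rw [abs_lt]; constructor <;> linarith⟩
      · exact ⟨s ^ 2 - δ, by linarith, by linarith, by rw [abs_lt]; constructor <;> linarith⟩
    refine ⟨!₂[s, w], mem_cuspDomain_iff.2 (by simpa using ⟨⟨hs, hs1⟩, hw0, hw1⟩), ?_⟩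
    refine (dist_le_abs_add_abs _ _).trans_lt ?_
    simpa using hwy
  · obtain ⟨-, h3, h4⟩ := mem_cuspDomain_iff.1 h
    simp only [Matrix.cons_val_zero, Matrix.cons_val_one] at h3 h4
    rcases hy with rfl | rfl
    · exact lt_irrefl _ h3
    · exact lt_irrefl _ h4

/-- The part in the cusp of a ball with radius `r ≤ 1` and centre `z` contains a rectangle with
width about `r` and height about `min r (z₁ + r)²`. -/
theorem le_volume_ball_inter_cuspDomain {z : EuclideanSpace ℝ (Fin 2)}
    (hz : z ∈ closure cuspDomain) {r : ℝ} (hr : 0 < r) (hr1 : r ≤ 1) :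
    ENNReal.ofReal (r * min r ((z 0 + r) ^ 2) / 128) ≤
      volume (Metric.ball z r ∩ cuspDomain) := by
  obtain ⟨⟨h1, h2⟩, h3, h4⟩ := closure_cuspDomain_subset hz
  set a := z 0 with ha
  set b := z 1 with hb
  -- The base `[s, s + e]` of the rectangle lies to the right of `z` if `z` is in the left half of the
  -- cusp, and to the left of `z` otherwise, so that it does not cross the vertical edge.
  obtain ⟨s, e, w, hs0, hsr, he, her, he1, hw, hwh⟩ : ∃ s e w : ℝ, 0 ≤ s ∧ a - r / 2 ≤ s ∧
      r / 8 ≤ e ∧ s + e ≤ a + r / 2 ∧ s + e ≤ 1 ∧ w = min r ((a + r) ^ 2) / 16 ∧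
      w ≤ min (s ^ 2) (b + r / 2) - max 0 (b - r / 2) := by
    have m1 : min r ((a + r) ^ 2) ≤ r := min_le_left _ _
    have m2 : min r ((a + r) ^ 2) ≤ (a + r) ^ 2 := min_le_right _ _
    rcases le_or_gt a (1 / 2) with h | h
    · refine ⟨a + r / 4, r / 4, _, by positivity, by linarith, by linarith, by linarith,
        by linarith, rfl, ?_⟩
      rw [le_sub_iff_add_le', ← le_sub_iff_add_le, max_le_iff]
      simp only [le_sub_iff_add_le, le_min_iff]
      refine ⟨⟨?_, ?_⟩, ?_, ?_⟩ <;> nlinarith [sq_nonneg a, sq_nonneg r, mul_nonneg h1 hr.le]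
    · refine ⟨a - r / 8, r / 8, _, by linarith, by linarith, by linarith, by linarith,
        by linarith, rfl, ?_⟩
      rw [le_sub_iff_add_le', ← le_sub_iff_add_le, max_le_iff]
      simp only [le_sub_iff_add_le, le_min_iff]
      refine ⟨⟨?_, ?_⟩, ?_, ?_⟩ <;> nlinarith [sq_nonneg a, sq_nonneg r, mul_nonneg h1 hr.le]
  have hw0 : 0 ≤ w := by rw [hw]; positivity
  calc ENNReal.ofReal (r * min r ((a + r) ^ 2) / 128) = ENNReal.ofReal (r / 8 * w) := by
        rw [hw]; congr 1; ring
    _ ≤ ENNReal.ofReal ((s + e) - s) *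
          ENNReal.ofReal (min (s ^ 2) (b + r / 2) - max 0 (b - r / 2)) := by
        rw [ENNReal.ofReal_mul (by positivity)]
        exact mul_le_mul' (ENNReal.ofReal_le_ofReal (by linarith)) (ENNReal.ofReal_le_ofReal hwh)
    _ = _ := (volume_rectangle _ _ _ _).symm
    _ ≤ _ := by
        refine measure_mono ?_
        rintro x ⟨⟨x1, x2⟩, x3, x4⟩
        rw [max_lt_iff] at x3
        rw [lt_min_iff] at x4
        refine ⟨?_, mem_cuspDomain_iff.2 ⟨⟨by linarith, by linarith⟩, x3.1, ?_⟩⟩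
        · rw [Metric.mem_ball]
          have e1 : |x 0 - z 0| < r / 2 := abs_lt.2 ⟨by linarith, by linarith⟩
          have e2 : |x 1 - z 1| < r / 2 := abs_lt.2 ⟨by linarith, by linarith⟩
          linarith [dist_le_abs_add_abs x z]
        · nlinarith

theorem volume_ball_inter_cuspDomain_le {z : EuclideanSpace ℝ (Fin 2)}
    (hz : z ∈ closure cuspDomain) {r : ℝ} (hr : 0 < r) :
    volume (Metric.ball z r ∩ cuspDomain) ≤
      ENNReal.ofReal (4 * (r * min r ((z 0 + r) ^ 2))) := by
  obtain ⟨⟨h1, h2⟩, h3, h4⟩ := closure_cuspDomain_subset hz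
  have hsub : Metric.ball z r ∩ cuspDomain ⊆ {x : EuclideanSpace ℝ (Fin 2) |
      (z 0 - r < x 0 ∧ x 0 < z 0 + r) ∧ (max 0 (z 1 - r) < x 1 ∧
        x 1 < min ((z 0 + r) ^ 2) (z 1 + r))} := by
    rintro x ⟨hx, hxΩ⟩
    obtain ⟨⟨k1, k2⟩, k3, k4⟩ := mem_cuspDomain_iff.1 hxΩ
    have e0 := abs_lt.1 ((abs_sub_le_dist x z 0).trans_lt hx)
    have e1 := abs_lt.1 ((abs_sub_le_dist x z 1).trans_lt hx)
    refine ⟨⟨by linarith, by linarith⟩, max_lt k3 (by linarith), lt_min ?_ (by linarith)⟩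
    nlinarith
  refine (measure_mono hsub).trans ?_
  rw [volume_rectangle, ← ENNReal.ofReal_mul (by linarith)]
  refine ENNReal.ofReal_le_ofReal ?_
  have e1 : min ((z 0 + r) ^ 2) (z 1 + r) - max 0 (z 1 - r) ≤ 2 * min r ((z 0 + r) ^ 2) := by
    rw [mul_min_of_nonneg _ _ (by norm_num : (0 : ℝ) ≤ 2), le_min_iff]
    have m1 := min_le_left ((z 0 + r) ^ 2) (z 1 + r)
    have m2 := min_le_right ((z 0 + r) ^ 2) (z 1 + r)
    have m3 := le_max_left 0 (z 1 - r)
    have m4 := le_max_right 0 (z 1 - r)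
    constructor
    · linarith
    · linarith [sq_nonneg (z 0 + r)]
  calc (z 0 + r - (z 0 - r)) * (min ((z 0 + r) ^ 2) (z 1 + r) - max 0 (z 1 - r))
      ≤ (z 0 + r - (z 0 - r)) * (2 * min r ((z 0 + r) ^ 2)) :=
        mul_le_mul_of_nonneg_left e1 (by linarith)
    _ = _ := by ring

theorem volume_cuspDomain_strip_le (s : ℝ) (hs : 0 ≤ s) :
    volume {x | x ∈ cuspDomain ∧ x 0 < s} ≤ ENNReal.ofReal (s ^ 3) := by
  have hsub : {x | x ∈ cuspDomain ∧ x 0 < s} ⊆ {x : EuclideanSpace ℝ (Fin 2) |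
      (0 < x 0 ∧ x 0 < s) ∧ (0 < x 1 ∧ x 1 < s ^ 2)} := by
    rintro x ⟨hxΩ, hx⟩
    obtain ⟨⟨k1, k2⟩, k3, k4⟩ := mem_cuspDomain_iff.1 hxΩ
    exact ⟨⟨k1, hx⟩, k3, by nlinarith⟩
  refine (measure_mono hsub).trans ?_
  rw [volume_rectangle, ← ENNReal.ofReal_mul (by linarith)]
  refine ENNReal.ofReal_le_ofReal (le_of_eq (by ring))

theorem volume_cuspDomain_le : volume cuspDomain ≤ 1 := by
  have h := volume_cuspDomain_strip_le 1 zero_le_one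
  rw [one_pow, ENNReal.ofReal_one] at h
  refine (measure_mono fun x hx => ?_).trans h
  exact ⟨hx, (mem_cuspDomain_iff.1 hx).1.2⟩

/-- The cubic lower bound for the measure of balls, which is attained at the tip of the cusp. -/
theorem cube_le_volume_ball_inter_cuspDomain {z : EuclideanSpace ℝ (Fin 2)}
    (hz : z ∈ closure cuspDomain) {r : ℝ} (hr : 0 < r) (hr1 : r ≤ 1) :
    ENNReal.ofReal (r ^ 3 / 128) ≤ volume (Metric.ball z r ∩ cuspDomain) := by
  refine (ENNReal.ofReal_le_ofReal ?_).trans (le_volume_ball_inter_cuspDomain hz hr hr1)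
  obtain ⟨⟨h1, h2⟩, h3, h4⟩ := closure_cuspDomain_subset hz
  have : r ^ 2 ≤ min r ((z 0 + r) ^ 2) := le_min (by nlinarith) (by nlinarith)
  nlinarith

theorem isDoublingOn_cuspDomain : IsDoublingOn volume cuspDomain := by
  refine ⟨4096, fun z hz r hr => ?_⟩
  have hfin : ∀ s : ℝ, volume (Metric.ball z s ∩ cuspDomain) ≤ 1 := fun s =>
    (measure_mono inter_subset_right).trans volume_cuspDomain_le
  have hpos : ∀ s : ℝ, 0 < s → 0 < volume (Metric.ball z s ∩ cuspDomain) := by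
    intro s hs
    have hm : 0 < min s 1 := by positivity
    refine lt_of_lt_of_le ?_ (measure_mono (inter_subset_inter_left _
      (Metric.ball_subset_ball (min_le_left s 1))))
    refine lt_of_lt_of_le ?_ (cube_le_volume_ball_inter_cuspDomain hz hm (min_le_right _ _))
    rw [ENNReal.ofReal_pos]; positivity
  refine ⟨hpos _ (by positivity), ?_, (hfin r).trans_lt ENNReal.one_lt_top⟩
  rcases le_or_gt r 1 with hr1 | hr1
  · refine (volume_ball_inter_cuspDomain_le hz (by positivity : 0 < 2 * r)).trans ?_
    refine le_trans ?_ (mul_le_mul' le_rfl (le_volume_ball_inter_cuspDomain hz hr hr1))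
    rw [show ((4096 : ℝ≥0) : ℝ≥0∞) = ENNReal.ofReal 4096 by simp,
      ← ENNReal.ofReal_mul (by norm_num)]
    refine ENNReal.ofReal_le_ofReal ?_
    obtain ⟨⟨h1, h2⟩, h3, h4⟩ := closure_cuspDomain_subset hz
    have h5 : min (2 * r) ((z 0 + 2 * r) ^ 2) ≤ 2 * min r (2 * (z 0 + r) ^ 2) := by
      rw [mul_min_of_nonneg _ _ (by norm_num : (0 : ℝ) ≤ 2)]
      exact min_le_min le_rfl (by nlinarith [mul_nonneg h1 hr.le])
    have h6 : min r (2 * (z 0 + r) ^ 2) ≤ 2 * min r ((z 0 + r) ^ 2) := by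
      rw [mul_min_of_nonneg _ _ (by norm_num : (0 : ℝ) ≤ 2)]
      exact min_le_min (by linarith) le_rfl
    have h7 : 0 ≤ min r ((z 0 + r) ^ 2) := by positivity
    calc 4 * (2 * r * min (2 * r) ((z 0 + 2 * r) ^ 2))
        ≤ 4 * (2 * r * (2 * (2 * min r ((z 0 + r) ^ 2)))) := by
          have := h5.trans (mul_le_mul_of_nonneg_left h6 (by norm_num))
          gcongr
      _ ≤ _ := by nlinarith [mul_nonneg hr.le h7]
  · have h1 : ENNReal.ofReal (1 / 128) ≤ volume (Metric.ball z r ∩ cuspDomain) := by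
      have := cube_le_volume_ball_inter_cuspDomain hz one_pos le_rfl
      rw [one_pow] at this
      exact this.trans (measure_mono (inter_subset_inter_left _ (Metric.ball_subset_ball hr1.le)))
    refine (hfin _).trans (le_trans ?_ (mul_le_mul' le_rfl h1))
    rw [show ((4096 : ℝ≥0) : ℝ≥0∞) = ENNReal.ofReal 4096 by simp,
      ← ENNReal.ofReal_mul (by norm_num)]
    exact ENNReal.one_le_ofReal.2 (by norm_num)

/-! ### The measure on the boundary of the cusp -/

/-- The projection of the boundary of the cusp to the first axis does not increase measures. -/
theorem volume_image_le_cuspBoundaryMeasure (S : Set (frontier cuspDomain)) :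
    volume ((fun z : frontier cuspDomain => (z : EuclideanSpace ℝ (Fin 2)) 0) '' S) ≤
      cuspBoundaryMeasure S := by
  have hL : LipschitzWith 1 (fun z : frontier cuspDomain => (z : EuclideanSpace ℝ (Fin 2)) 0) :=
    LipschitzWith.of_dist_le_mul fun y z => by
      rw [NNReal.coe_one, one_mul, Real.dist_eq, Subtype.dist_eq]
      exact abs_sub_le_dist _ _ 0
  have h := hL.hausdorffMeasure_image_le zero_le_one S
  rw [ENNReal.coe_one, ENNReal.one_rpow, one_mul, hausdorffMeasure_real] at h
  exact h

theorem cuspBoundaryMeasure_ball_le (z : frontier cuspDomain) {r : ℝ} (hr : 0 < r) :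
    cuspBoundaryMeasure (Metric.ball z r) ≤ ENNReal.ofReal (10 * r) := by
  set a := (z : EuclideanSpace ℝ (Fin 2)) 0
  set b := (z : EuclideanSpace ℝ (Fin 2)) 1
  have h0 : cuspBoundaryMeasure (Metric.ball z r) =
      Measure.hausdorffMeasure 1 (Subtype.val '' (Metric.ball z r)) :=
    (isometry_subtype_coe.hausdorffMeasure_image (Or.inl zero_le_one) _).symm
  -- The boundary consists of a graph over the first axis, a parabola and a vertical segment.
  set f₁ : ℝ → EuclideanSpace ℝ (Fin 2) := fun s => !₂[s, 0]
  set f₂ : ℝ → EuclideanSpace ℝ (Fin 2) := fun s => !₂[s, s ^ 2]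
  set f₃ : ℝ → EuclideanSpace ℝ (Fin 2) := fun y => !₂[1, y]
  have hsub : Subtype.val '' (Metric.ball z r) ⊆ f₁ '' Icc (a - r) (a + r) ∪
      f₂ '' (Icc (a - r) (a + r) ∩ Icc 0 1) ∪ f₃ '' Icc (b - r) (b + r) := by
    rintro _ ⟨y, hy, rfl⟩
    have e0 := abs_lt.1 ((abs_sub_le_dist (y : EuclideanSpace ℝ (Fin 2)) z 0).trans_lt hy)
    have e1 := abs_lt.1 ((abs_sub_le_dist (y : EuclideanSpace ℝ (Fin 2)) z 1).trans_lt hy)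
    have hy01 := (closure_cuspDomain_subset (frontier_subset_closure y.2)).1
    rcases frontier_cuspDomain_cases y.2 with h | h | h
    · refine Or.inl (Or.inl ⟨(y : EuclideanSpace ℝ (Fin 2)) 0, ⟨?_, ?_⟩, ?_⟩)
      · linarith
      · linarith
      · ext i; fin_cases i <;> simp [f₁, h]
    · refine Or.inl (Or.inr ⟨(y : EuclideanSpace ℝ (Fin 2)) 0, ⟨⟨?_, ?_⟩, hy01⟩, ?_⟩)
      · linarith
      · linarith
      · ext i; fin_cases i <;> simp [f₂, h]
    · refine Or.inr ⟨(y : EuclideanSpace ℝ (Fin 2)) 1, ⟨?_, ?_⟩, ?_⟩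
      · linarith
      · linarith
      · ext i; fin_cases i <;> simp [f₃, h]
  have hf₁ : LipschitzOnWith 1 f₁ (Icc (a - r) (a + r)) :=
    LipschitzOnWith.of_dist_le_mul fun s _ t _ => by
      refine (dist_le_abs_add_abs _ _).trans ?_
      simp [f₁, Real.dist_eq]
  have hf₂ : LipschitzOnWith 3 f₂ (Icc (a - r) (a + r) ∩ Icc 0 1) :=
    LipschitzOnWith.of_dist_le_mul fun s hs t ht => by
      refine (dist_le_abs_add_abs _ _).trans ?_
      have h1 : |s + t| ≤ 2 := abs_le.2 ⟨by linarith [hs.2.1, ht.2.1], by linarith [hs.2.2, ht.2.2]⟩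
      simp only [f₂, Matrix.cons_val_zero, Matrix.cons_val_one, Real.dist_eq]
      rw [show s ^ 2 - t ^ 2 = (s + t) * (s - t) by ring, abs_mul]
      push_cast
      nlinarith [abs_nonneg (s - t)]
  have hf₃ : LipschitzOnWith 1 f₃ (Icc (b - r) (b + r)) :=
    LipschitzOnWith.of_dist_le_mul fun s _ t _ => by
      refine (dist_le_abs_add_abs _ _).trans ?_
      simp [f₃, Real.dist_eq]
  have k₁ := hf₁.hausdorffMeasure_image_le zero_le_one
  have k₂ := hf₂.hausdorffMeasure_image_le zero_le_one
  have k₃ := hf₃.hausdorffMeasure_image_le zero_le_one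
  rw [hausdorffMeasure_real, ENNReal.rpow_one] at k₁ k₂ k₃
  have k₂' := k₂.trans (mul_le_mul' le_rfl (measure_mono inter_subset_left))
  rw [Real.volume_Icc] at k₁ k₂' k₃
  rw [h0]
  calc _ ≤ _ := measure_mono hsub
    _ ≤ _ := measure_union_le _ _
    _ ≤ _ := add_le_add (measure_union_le _ _) le_rfl
    _ ≤ _ := add_le_add (add_le_add k₁ k₂') k₃
    _ = ENNReal.ofReal (10 * r) := by
        rw [show ((3 : ℝ≥0) : ℝ≥0∞) = ENNReal.ofReal 3 by simp, ENNReal.coe_one, one_mul, one_mul,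
          ← ENNReal.ofReal_mul (by norm_num), ← ENNReal.ofReal_add (by linarith) (by linarith),
          ← ENNReal.ofReal_add (by linarith) (by linarith)]
        congr 1; ring

theorem hasUpperCodimBound_cuspDomain :
    HasUpperCodimBound volume cuspDomain (frontier cuspDomain) cuspBoundaryMeasure 2 := by
  refine ⟨81920, 4, by norm_num, ?_, fun z r hr hr4 => ?_⟩
  · have : Metric.diam (frontier cuspDomain) ≤ 2 := Metric.diam_le_of_forall_dist_le (by norm_num)
      fun y hy z hz => dist_le_two_of_mem_closure_cuspDomain (frontier_subset_closure hy)
        (frontier_subset_closure hz)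
    linarith
  have hz := frontier_subset_closure z.2
  -- The cubic bound requires a radius of at most `1`, but `r` ranges up to `4`.
  have h1 : ENNReal.ofReal ((r / 4) ^ 3 / 128) ≤
      volume (Metric.ball (z : EuclideanSpace ℝ (Fin 2)) r ∩ cuspDomain) :=
    (cube_le_volume_ball_inter_cuspDomain hz (by positivity) (by linarith)).trans
      (measure_mono (inter_subset_inter_left _ (Metric.ball_subset_ball (by linarith))))
  refine (cuspBoundaryMeasure_ball_le z hr).trans ?_
  have hr2 : 0 < r ^ (2 : ℝ) := by positivity
  calc ENNReal.ofReal (10 * r)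
      = ENNReal.ofReal 81920 * ENNReal.ofReal ((r / 4) ^ 3 / 128) / ENNReal.ofReal (r ^ (2 : ℝ)) := by
        rw [← ENNReal.ofReal_mul (by norm_num), ← ENNReal.ofReal_div_of_pos hr2]
        congr 1
        rw [Real.rpow_two]
        field_simp
        ring
    _ ≤ _ := by
        rw [show ((81920 : ℝ≥0) : ℝ≥0∞) = ENNReal.ofReal 81920 by simp]
        gcongr

end Cusp

/-! ### A Besov function on the boundary of the cusp that is not a trace -/

section NotSurjective

theorem isFiniteMeasure_cuspBoundaryMeasure : IsFiniteMeasure cuspBoundaryMeasure := by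
  obtain ⟨c, hD⟩ := isDoublingOn_cuspDomain.exists_isDoublingWith isOpen_cuspDomain
  exact hasUpperCodimBound_cuspDomain.isFiniteMeasure isOpen_cuspDomain hD
    frontier_subset_closure (isBounded_closure_cuspDomain.subset frontier_subset_closure)

/-- Away from the tip, and at small scales, the boundary of the cusp has codimension `1`; the
constant does not depend on the distance `s` to the tip. -/
theorem kernelBound_cuspBoundaryMeasure_restrict {s : ℝ} (hs : 0 < s) (hs1 : 8 * s ^ 2 ≤ 1) :
    KernelBound (measureOn volume cuspDomain) (cuspBoundaryMeasure.restrict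
      {z | s ≤ (z : EuclideanSpace ℝ (Fin 2)) 0}) 20480 1 (8 * s ^ 2) := by
  intro r hr hrs x
  set E : Set (frontier cuspDomain) := {z | s ≤ (z : EuclideanSpace ℝ (Fin 2)) 0} with hE
  set S : Set (frontier cuspDomain) := {z | dist (z : EuclideanSpace ℝ (Fin 2)) x < r} with hS
  have hSm : MeasurableSet S := (isOpen_lt (by fun_prop) continuous_const).measurableSet
  have hEm : MeasurableSet E := by
    have c0 : Continuous fun z : frontier cuspDomain => (z : EuclideanSpace ℝ (Fin 2)) 0 := by
      fun_prop
    exact (isClosed_le continuous_const c0).measurableSet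
  have h1 : ∀ z ∈ S ∩ E, (measureOn volume cuspDomain (relBall cuspDomain (z :
      EuclideanSpace ℝ (Fin 2)) r))⁻¹ ≤ ENNReal.ofReal (1024 / r ^ 2) := by
    rintro z ⟨-, hzE⟩
    have hz0 : s ≤ (z : EuclideanSpace ℝ (Fin 2)) 0 := hzE
    have hmin : r / 8 ≤ min r (((z : EuclideanSpace ℝ (Fin 2)) 0 + r) ^ 2) :=
      le_min (by linarith) (by nlinarith)
    rw [measureOn_relBall isOpen_cuspDomain, show 1024 / r ^ 2 = (r * (r / 8) / 128)⁻¹ by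
      field_simp; norm_num, ENNReal.ofReal_inv_of_pos (by positivity)]
    refine ENNReal.inv_le_inv.2 (le_trans (ENNReal.ofReal_le_ofReal ?_)
      (le_volume_ball_inter_cuspDomain (frontier_subset_closure z.2) hr (by linarith)))
    gcongr
  have h2 : cuspBoundaryMeasure S ≤ ENNReal.ofReal (20 * r) := by
    rcases S.eq_empty_or_nonempty with h0 | ⟨z₀, hz₀⟩
    · rw [h0]; simp
    have hsub : S ⊆ Metric.ball z₀ (2 * r) := by
      intro z hz
      have k1 : dist (z : EuclideanSpace ℝ (Fin 2)) x < r := hz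
      have k2 : dist (z₀ : EuclideanSpace ℝ (Fin 2)) x < r := hz₀
      have := dist_triangle_right (z : EuclideanSpace ℝ (Fin 2)) z₀ x
      rw [Metric.mem_ball, Subtype.dist_eq]
      linarith
    refine (measure_mono hsub).trans ((cuspBoundaryMeasure_ball_le z₀ (by positivity)).trans
      (ENNReal.ofReal_le_ofReal (by linarith)))
  rw [Measure.restrict_restrict hSm]
  calc _ ≤ ∫⁻ _z in S ∩ E, ENNReal.ofReal (1024 / r ^ 2) ∂cuspBoundaryMeasure :=
        setLIntegral_mono' (hSm.inter hEm) h1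
    _ = ENNReal.ofReal (1024 / r ^ 2) * cuspBoundaryMeasure (S ∩ E) := setLIntegral_const _ _
    _ ≤ ENNReal.ofReal (1024 / r ^ 2) * ENNReal.ofReal (20 * r) := by
        gcongr; exact (measure_mono inter_subset_left).trans h2
    _ = _ := by
        rw [← ENNReal.ofReal_mul (by positivity), ENNReal.ofReal_rpow_of_pos hr, Real.rpow_neg_one,
          show ((20480 : ℝ≥0) : ℝ≥0∞) = ENNReal.ofReal 20480 by simp,
          ← ENNReal.ofReal_mul (by norm_num)]
        congr 1
        field_simp
        norm_num

/-- The points `(s, 0)` and `(s, s ^ 2)` of the boundary are so close that the trace of a function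
in `M^{1,p}` cannot take the values `0` and `s ^ (2 (1 - 2 / p))` there: on the part of the boundary
with distance about `s` to the tip, the set of the points where the trace deviates that much from
the averages of the function has a measure of the order `s ^ 2`, but its projection to the axis
contains an interval with length `s`. -/
theorem not_hasTrace_cusp {p : ℝ} (hp : 2 < p) {u : cuspDomain → ℝ} (hu : Measurable u)
    {h : cuspDomain → ℝ≥0∞} (hh : Measurable h)
    (hhp : ∫⁻ x, h x ^ p ∂(measureOn volume cuspDomain) < ∞)
    (hP : SatisfiesPoincare (measureOn volume cuspDomain) (frontier cuspDomain) 4 1 p u h)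
    {f : frontier cuspDomain → ℝ}
    (hf : ∀ᵐ z ∂cuspBoundaryMeasure, f z = (z : EuclideanSpace ℝ (Fin 2)) 1 ^ (1 - 2 / p)) :
    ¬ HasTrace volume cuspDomain (frontier cuspDomain) cuspBoundaryMeasure u f := by
  intro htr
  have := isFiniteMeasure_cuspBoundaryMeasure
  have hp0 : 0 < p := by linarith
  obtain ⟨c, hD⟩ := isDoublingOn_cuspDomain.exists_isDoublingWith isOpen_cuspDomain
  have hσ := hD.sigmaFinite
  set m := measureOn volume cuspDomain
  set ν := cuspBoundaryMeasure
  set α := 1 - 2 / p with hα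
  have hα0 : 0 < α := by rw [hα, sub_pos, div_lt_one hp0]; exact hp
  have hαp : 2 * α * p = 2 * p - 4 := by rw [hα]; field_simp; ring
  have htr' : ∀ᵐ z ∂ν, Tendsto (meanDev m u (f z) (z : EuclideanSpace ℝ (Fin 2))) (𝓝[>] 0) (𝓝 0) :=
    htr
  set N : Set (frontier cuspDomain) := {z | ¬ (f z = (z : EuclideanSpace ℝ (Fin 2)) 1 ^ α ∧
    Tendsto (meanDev m u (f z) (z : EuclideanSpace ℝ (Fin 2))) (𝓝[>] 0) (𝓝 0))} with hN
  have hN0 : ν N = 0 := ae_iff.1 (hf.and htr')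
  set H := ∫⁻ x, h x ^ p ∂m
  set Q : ℝ≥0∞ := (8 * c ^ 3) ^ p * ((20480 : ℝ≥0) * ENNReal.ofReal 1 ^ (-1 : ℝ) *
    ((1 - 2⁻¹ ^ (1 - 1 / p))⁻¹ : ℝ≥0∞) ^ p * (8 ^ (p - 1) * H)) with hQ
  have hQt : Q ≠ ∞ := by
    have h1 : ((1 - 2⁻¹ ^ (1 - 1 / p))⁻¹ : ℝ≥0∞) ≠ ∞ :=
      ENNReal.inv_ne_top.2 (one_sub_two_inv_rpow_ne_zero
        (by rw [sub_pos, div_lt_one hp0]; linarith))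
    have h2 : 0 ≤ p - 1 := by linarith
    rw [hQ, ENNReal.ofReal_one, ENNReal.one_rpow]
    finiteness
  have key : ∀ s : ℝ, 0 < s → s ≤ 1 / 4 → 1 ≤ Q * ENNReal.ofReal s := by
    intro s hs hs4
    have hs1 : 8 * s ^ 2 ≤ 1 := by nlinarith
    set σ := ENNReal.ofReal s with hσs
    have hσ0 : σ ≠ 0 := by simpa [hσs] using hs
    have hσt : σ ≠ ∞ := ENNReal.ofReal_ne_top
    set r := 8 * s ^ 2 with hr
    have hr0 : 0 < r := by positivity
    have hk := kernelBound_cuspBoundaryMeasure_restrict hs hs1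
    set E : Set (frontier cuspDomain) := {z | s ≤ (z : EuclideanSpace ℝ (Fin 2)) 0} with hE
    have hEm : MeasurableSet E := by
      have c0 : Continuous fun z : frontier cuspDomain => (z : EuclideanSpace ℝ (Fin 2)) 0 := by
        fun_prop
      exact (isClosed_le continuous_const c0).measurableSet
    set Φ : frontier cuspDomain → ℝ≥0∞ := fun z =>
      8 * c ^ 3 * potential m 1 p h (z : EuclideanSpace ℝ (Fin 2)) r with hΦ
    have hΦm : Measurable Φ := (measurable_potential 1 p r hh).const_mul _
    set A : Set (frontier cuspDomain) := {z | (σ ^ (2 * α)) ^ p ≤ Φ z ^ p} with hA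
    have hint : ∫⁻ z, Φ z ^ p ∂(ν.restrict E) ≤ Q * σ ^ (2 * p - 2) := by
      have h1 := hk.lintegral_potential_le (by linarith : 1 ≤ p) one_pos hr0 (by rw [one_mul]) hh
      have h2 : ENNReal.ofReal r ^ (p - 1) = 8 ^ (p - 1) * σ ^ (2 * p - 2) := by
        rw [hr, ENNReal.ofReal_mul (by norm_num), ENNReal.ofReal_pow hs.le,
          ENNReal.mul_rpow_of_nonneg _ _ (by linarith), ← ENNReal.rpow_natCast, ← ENNReal.rpow_mul,
          ENNReal.ofReal_ofNat]
        congr 2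
        push_cast; ring
      simp_rw [hΦ, ENNReal.mul_rpow_of_nonneg _ _ hp0.le] at h1 ⊢
      rw [lintegral_const_mul _ ((measurable_potential 1 p r hh).pow_const p)]
      refine (mul_le_mul' le_rfl h1).trans (le_of_eq ?_)
      rw [h2, hQ, ENNReal.mul_rpow_of_nonneg _ _ hp0.le]
      ring
    -- Chebyshev's inequality for the potential with radius `r`, where the codimension is `1`.
    have hcheb : σ ^ (2 * p - 4) * ν (A ∩ E) ≤ Q * σ ^ (2 * p - 2) := by
      have h1 := mul_meas_ge_le_lintegral (μ := ν.restrict E) (hΦm.pow_const p) ((σ ^ (2 * α)) ^ p)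
      rw [Measure.restrict_apply' hEm, ← ENNReal.rpow_mul, hαp] at h1
      rw [← ENNReal.rpow_mul, hαp] at hA
      rw [hA]
      exact h1.trans hint
    -- For each `q`, the potential is large at `(q, 0)` or at `(q, q ^ 2)`, or one of these points is
    -- in the exceptional set `N`.
    have hproj : Ioo s (2 * s) ⊆
        (fun z : frontier cuspDomain => (z : EuclideanSpace ℝ (Fin 2)) 0) '' (N ∪ A ∩ E) := by
      rintro q ⟨hq1, hq2⟩
      have hq0 : 0 < q := hs.trans hq1
      set y : frontier cuspDomain :=
        ⟨!₂[q, 0], mem_frontier_cuspDomain hq0 (by linarith) (Or.inl rfl)⟩ with hy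
      set z : frontier cuspDomain :=
        ⟨!₂[q, q ^ 2], mem_frontier_cuspDomain hq0 (by linarith) (Or.inr rfl)⟩ with hz
      have hyq : (y : EuclideanSpace ℝ (Fin 2)) 0 = q := by simp [hy]
      have hzq : (z : EuclideanSpace ℝ (Fin 2)) 0 = q := by simp [hz]
      by_cases hyN : y ∈ N
      · exact ⟨y, Or.inl hyN, hyq⟩
      by_cases hzN : z ∈ N
      · exact ⟨z, Or.inl hzN, hzq⟩
      rw [hN, mem_ofPred_eq, not_not] at hyN hzN
      have hfy : f y = 0 := by
        rw [hyN.1]; simp [hy, Real.zero_rpow hα0.ne']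
      have hfz : f z = q ^ (2 * α) := by
        rw [hzN.1, Real.rpow_mul hq0.le, Real.rpow_two]; simp [hz]
      have hdist : dist (z : EuclideanSpace ℝ (Fin 2)) y ≤ 4 * s ^ 2 := by
        refine (dist_le_abs_add_abs _ _).trans ?_
        simp only [hy, hz, Matrix.cons_val_zero, Matrix.cons_val_one, sub_self, abs_zero, sub_zero,
          zero_add]
        rw [abs_of_nonneg (by positivity)]
        nlinarith
      have h1 := hD.enorm_sub_le_meanDev hu (a := f z) (b := f y) (frontier_subset_closure z.2)
        (frontier_subset_closure y.2) (by positivity : 0 < 4 * s ^ 2) hdist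
      rw [show 2 * (4 * s ^ 2) = r by rw [hr]; ring] at h1
      have h2 := hD.meanDev_le_potential hu frontier_subset_closure hP y.2 hyN.2 hr0
      have h3 := hD.meanDev_le_potential hu frontier_subset_closure hP z.2 hzN.2 hr0
      have h4 : σ ^ (2 * α) ≤ (Φ z + Φ y) / 2 := by
        calc σ ^ (2 * α) ≤ ‖f z - f y‖ₑ := by
              rw [hfy, hfz, sub_zero, Real.enorm_of_nonneg (by positivity), hσs,
                ENNReal.ofReal_rpow_of_pos hs]
              exact ENNReal.ofReal_le_ofReal (Real.rpow_le_rpow hs.le hq1.le (by positivity))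
          _ ≤ _ := h1.trans (mul_le_mul' le_rfl (add_le_add h3 h2))
          _ = _ := by
              rw [ENNReal.eq_div_iff two_ne_zero ENNReal.ofNat_ne_top, hΦ]
              push_cast
              ring
      rcases le_total (Φ z) (Φ y) with hle | hle
      · refine ⟨y, Or.inr ⟨ENNReal.rpow_le_rpow (h4.trans ?_) hp0.le, ?_⟩, hyq⟩
        · refine ENNReal.div_le_of_le_mul ?_
          rw [mul_two]; gcongr
        · rw [hE, mem_ofPred_eq, hyq]; exact hq1.le
      · refine ⟨z, Or.inr ⟨ENNReal.rpow_le_rpow (h4.trans ?_) hp0.le, ?_⟩, hzq⟩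
        · refine ENNReal.div_le_of_le_mul ?_
          rw [mul_two]; gcongr
        · rw [hE, mem_ofPred_eq, hzq]; exact hq1.le
    have hσν : σ ≤ ν (A ∩ E) := by
      calc σ = volume (Ioo s (2 * s)) := by rw [Real.volume_Ioo, hσs]; congr 1; ring
        _ ≤ _ := measure_mono hproj
        _ ≤ ν (N ∪ A ∩ E) := volume_image_le_cuspBoundaryMeasure _
        _ ≤ ν N + ν (A ∩ E) := measure_union_le _ _
        _ = ν (A ∩ E) := by rw [hN0, zero_add]
    have h5 : σ ^ (2 * p - 3) * 1 ≤ σ ^ (2 * p - 3) * (Q * σ) := by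
      calc σ ^ (2 * p - 3) * 1 = σ ^ (2 * p - 4) * σ := by
            rw [mul_one, show 2 * p - 3 = 2 * p - 4 + 1 by ring, ENNReal.rpow_add _ _ hσ0 hσt,
              ENNReal.rpow_one]
        _ ≤ σ ^ (2 * p - 4) * ν (A ∩ E) := by gcongr
        _ ≤ _ := hcheb
        _ = _ := by
            rw [show 2 * p - 2 = 2 * p - 3 + 1 by ring, ENNReal.rpow_add _ _ hσ0 hσt,
              ENNReal.rpow_one]
            ring
    exact (ENNReal.mul_le_mul_iff_right (ENNReal.rpow_pos (pos_iff_ne_zero.2 hσ0) hσt).ne'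
      (ENNReal.rpow_ne_top_of_ne_zero hσ0 hσt)).1 h5
  have hQ1 : 0 < Q.toReal + 1 := by positivity
  have h1 := key (min (1 / 4) (1 / (2 * (Q.toReal + 1)))) (by positivity) (min_le_left _ _)
  have h2 : Q * ENNReal.ofReal (min (1 / 4) (1 / (2 * (Q.toReal + 1)))) < 1 := by
    calc _ ≤ ENNReal.ofReal Q.toReal * ENNReal.ofReal (1 / (2 * (Q.toReal + 1))) := by
          rw [ENNReal.ofReal_toReal hQt]
          exact mul_le_mul' le_rfl (ENNReal.ofReal_le_ofReal (min_le_right _ _))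
      _ = ENNReal.ofReal (Q.toReal * (1 / (2 * (Q.toReal + 1)))) :=
          (ENNReal.ofReal_mul (by positivity)).symm
      _ < 1 := by
          rw [ENNReal.ofReal_lt_one, mul_one_div, div_lt_one (by positivity)]
          linarith [ENNReal.toReal_nonneg (a := Q)]
  exact absurd h1 (not_le.2 h2)

theorem abs_rpow_sub_rpow_le {α a b : ℝ} (hα0 : 0 ≤ α) (hα1 : α ≤ 1) (ha : 0 ≤ a) (hb : 0 ≤ b) :
    |a ^ α - b ^ α| ≤ |a - b| ^ α := by
  wlog hab : b ≤ a generalizing a b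
  · rw [abs_sub_comm, abs_sub_comm a]
    exact this hb ha (le_of_not_ge hab)
  rw [abs_of_nonneg (sub_nonneg.2 (Real.rpow_le_rpow hb hab hα0)),
    abs_of_nonneg (sub_nonneg.2 hab), sub_le_iff_le_add]
  have := Real.rpow_add_le_add_rpow (sub_nonneg.2 hab) hb hα0 hα1
  rwa [sub_add_cancel] at this

/-- The function `z ↦ z₂ ^ α` is `α`-Hölder continuous, so that it belongs to `B^α_{p,∞}`. -/
theorem besovNorm_lt_top_cusp {p α : ℝ} (hp : 1 ≤ p) (hα0 : 0 ≤ α) (hα1 : α ≤ 1)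
    {f : frontier cuspDomain → ℝ}
    (hf : ∀ᵐ z ∂cuspBoundaryMeasure, f z = (z : EuclideanSpace ℝ (Fin 2)) 1 ^ α) (R : ℝ≥0∞) :
    besovNorm R α p cuspBoundaryMeasure f < ∞ := by
  have := isFiniteMeasure_cuspBoundaryMeasure
  have hp0 : 0 < p := by linarith
  have hz : ∀ z : frontier cuspDomain, 0 ≤ (z : EuclideanSpace ℝ (Fin 2)) 1 ∧
      (z : EuclideanSpace ℝ (Fin 2)) 1 ≤ 1 := by
    intro z
    obtain ⟨⟨h1, h2⟩, h3, h4⟩ := closure_cuspDomain_subset (frontier_subset_closure z.2)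
    exact ⟨h3, by nlinarith⟩
  have h := besovNorm_rpow_le (ν := cuspBoundaryMeasure) hp (f := f) (C := 1)
    (U := cuspBoundaryMeasure univ) (α := α) ?_ ?_ R
  · have h1 : besovNorm R α p cuspBoundaryMeasure f ^ p < ∞ := h.trans_lt (by finiteness)
    exact (ENNReal.rpow_lt_top_iff_of_pos hp0).1 h1
  · rw [one_mul, ← lintegral_one]
    refine lintegral_mono_ae ?_
    filter_upwards [hf] with z hfz
    rw [hfz, Real.enorm_of_nonneg (Real.rpow_nonneg (hz z).1 _)]
    refine ENNReal.rpow_le_one (ENNReal.ofReal_le_one.2 ?_) hp0.le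
    exact Real.rpow_le_one (hz z).1 (hz z).2 hα0
  · intro t ht
    rw [one_mul, ← lintegral_one]
    refine lintegral_mono_ae ?_
    filter_upwards [hf] with y hfy
    refine le_trans (laverage_mono_ae ?_) (setLAverage_const_le (Metric.ball y t) 1)
    filter_upwards [ae_restrict_of_ae hf, ae_restrict_mem measurableSet_ball] with z hfz hzt
    have hyz : |(y : EuclideanSpace ℝ (Fin 2)) 1 - (z : EuclideanSpace ℝ (Fin 2)) 1| ≤ t := by
      refine (abs_sub_le_dist _ _ 1).trans ?_
      rw [← Subtype.dist_eq, dist_comm]; exact (Metric.mem_ball.1 hzt).le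
    refine ENNReal.div_le_of_le_mul ?_
    rw [one_mul, hfy, hfz, ← ofReal_norm, Real.norm_eq_abs, ENNReal.ofReal_rpow_of_nonneg
      (abs_nonneg _) hp0.le, Real.rpow_mul ht.le]
    refine ENNReal.ofReal_le_ofReal (Real.rpow_le_rpow (abs_nonneg _) ?_ hp0.le)
    exact (abs_rpow_sub_rpow_le hα0 hα1 (hz y).1 (hz z).1).trans
      (Real.rpow_le_rpow (abs_nonneg _) hyz hα0)

theorem exists_besov_not_trace_cusp {p : ℝ} (hp1 : 1 ≤ p) (hp : 2 < p)
    {T : HajlaszSpace p hp1 (measureOn volume cuspDomain) →ₗ[ℝ]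
      (frontier cuspDomain →ₘ[cuspBoundaryMeasure] ℝ)}
    (hT : ∀ u : HajlaszSpace p hp1 (measureOn volume cuspDomain),
      HasTrace volume cuspDomain (frontier cuspDomain) cuspBoundaryMeasure
      (u : cuspDomain →ₘ[measureOn volume cuspDomain] ℝ) (T u)) :
    ∃ f : frontier cuspDomain →ₘ[cuspBoundaryMeasure] ℝ,
      (∀ R : ℝ≥0∞, 0 < R → besovNorm R (1 - 2 / p) p cuspBoundaryMeasure f < ∞) ∧
      ∀ u, T u ≠ f := by
  have hα0 : 0 ≤ 1 - 2 / p := by rw [sub_nonneg, div_le_one (by linarith)]; exact hp.le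
  have hα1 : 1 - 2 / p ≤ 1 := by
    have : 0 < 2 / p := by positivity
    linarith
  have hm : Continuous fun z : frontier cuspDomain =>
      (z : EuclideanSpace ℝ (Fin 2)) 1 ^ (1 - 2 / p) := by
    have c1 : Continuous fun z : frontier cuspDomain => (z : EuclideanSpace ℝ (Fin 2)) 1 := by
      fun_prop
    exact c1.rpow_const fun _ => Or.inr hα0
  have hf := AEEqFun.coeFn_mk (μ := cuspBoundaryMeasure) _ hm.aestronglyMeasurable
  refine ⟨AEEqFun.mk _ hm.aestronglyMeasurable, fun R _ =>
    besovNorm_lt_top_cusp hp1 hα0 hα1 hf R, fun u hu => ?_⟩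
  obtain ⟨-, g, hg, hgp⟩ := (hajlaszNorm_lt_top_iff hp1).1 u.2
  obtain ⟨k, hk, hgk, hP⟩ := hg.exists_satisfiesPoincare hp1 (frontier cuspDomain)
  refine not_hasTrace_cusp hp (AEEqFun.measurable _) hk ?_ hP hf ?_
  · have e : ∫⁻ x, g x ^ p ∂(measureOn volume cuspDomain) =
        ∫⁻ x, k x ^ p ∂(measureOn volume cuspDomain) :=
      lintegral_congr_ae (hgk.mono fun x hx => by simp only [hx])
    rwa [← e]
  · rw [← hu]; exact hT u

end NotSurjective

/-! ### A trace without higher smoothness -/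

section Spike

/-- The coefficients of `spike`: up to the summable factor `(k + 1) ^ (-2)`, the largest ones for
which the `k`-th summand of `spike` has a gradient that is bounded in `L^p` of the cusp. -/
def spikeCoeff (p : ℝ) (k : ℕ) : ℝ := 2 ^ ((3 / p - 1) * k) / (k + 1) ^ 2

/-- A sum of spikes with width `2 ^ (-k)` at `0`. As a function of the first coordinate, it belongs
to `M^{1,p}` of the cusp. The sum is finite if `s > 0`; the value at `0` does not matter, as the tip
is a null set. -/
def spike (p s : ℝ) : ℝ := ∑' k : ℕ, spikeCoeff p k * max 0 (1 - 2 ^ k * s)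

/-- The sum of the slopes of the summands of `spike`, which is a Hajłasz gradient of `spike`
on the positive half-line. -/
def spikeSlope (p s : ℝ) : ℝ≥0∞ :=
  ∑' k : ℕ, ENNReal.ofReal (spikeCoeff p k * 2 ^ k) * (Iio ((1 / 2 : ℝ) ^ k)).indicator 1 s

theorem spikeCoeff_pos (p : ℝ) (k : ℕ) : 0 < spikeCoeff p k := by
  rw [spikeCoeff]; positivity

theorem one_le_two_pow_mul_of_notMem {k : ℕ} {s : ℝ} (h : s ∉ Iio ((1 / 2 : ℝ) ^ k)) :
    1 ≤ 2 ^ k * s := by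
  rw [mem_Iio, not_lt, one_div, inv_pow] at h
  calc (1 : ℝ) = 2 ^ k * (2 ^ k)⁻¹ := (mul_inv_cancel₀ (by positivity)).symm
    _ ≤ _ := by gcongr

theorem exists_forall_notMem_Iio {s : ℝ} (hs : 0 < s) :
    ∃ n : ℕ, ∀ k, k ∉ Finset.range n → s ∉ Iio ((1 / 2 : ℝ) ^ k) := by
  obtain ⟨n, hn⟩ := exists_pow_lt_of_lt_one hs (by norm_num : (1 / 2 : ℝ) < 1)
  refine ⟨n, fun k hk => ?_⟩
  rw [Finset.mem_range, not_lt] at hk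
  rw [mem_Iio, not_lt]
  exact (pow_le_pow_of_le_one (by norm_num) (by norm_num) hk).trans hn.le

theorem spike_term_eq_zero (p : ℝ) {k : ℕ} {s : ℝ} (h : s ∉ Iio ((1 / 2 : ℝ) ^ k)) :
    spikeCoeff p k * max 0 (1 - 2 ^ k * s) = 0 := by
  rw [max_eq_left (by linarith [one_le_two_pow_mul_of_notMem h]), mul_zero]

theorem summable_spike (p : ℝ) {s : ℝ} (hs : 0 < s) :
    Summable fun k : ℕ => spikeCoeff p k * max 0 (1 - 2 ^ k * s) := by
  obtain ⟨n, hn⟩ := exists_forall_notMem_Iio hs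
  exact summable_of_ne_finset_zero fun k hk => spike_term_eq_zero p (hn k hk)

theorem spikeSlope_ne_top (p : ℝ) {s : ℝ} (hs : 0 < s) : spikeSlope p s ≠ ∞ := by
  obtain ⟨n, hn⟩ := exists_forall_notMem_Iio hs
  rw [spikeSlope, tsum_eq_sum fun k hk => by rw [indicator_of_notMem (hn k hk), mul_zero]]
  refine (ENNReal.sum_lt_top.2 fun k _ => ENNReal.mul_lt_top ENNReal.ofReal_lt_top ?_).ne
  exact (indicator_le_self' (fun _ _ => zero_le) s).trans_lt ENNReal.one_lt_top

theorem spikeSlope_antitone (p : ℝ) : Antitone (spikeSlope p) := by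
  intro s t hst
  refine ENNReal.tsum_le_tsum fun k => mul_le_mul' le_rfl ?_
  by_cases h : t ∈ Iio ((1 / 2 : ℝ) ^ k)
  · rw [indicator_of_mem h, indicator_of_mem (show s ∈ Iio _ from lt_of_le_of_lt hst h)]; rfl
  · rw [indicator_of_notMem h]; exact zero_le

theorem measurable_spikeSlope (p : ℝ) : Measurable (spikeSlope p) :=
  (spikeSlope_antitone p).measurable

theorem enorm_spike_le (p : ℝ) (s : ℝ) (hs : 0 < s) : ‖spike p s‖ₑ ≤ spikeSlope p s := by
  rw [spike]
  refine (enorm_tsum_le_tsum_enorm).trans (ENNReal.tsum_le_tsum fun k => ?_)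
  by_cases h : s ∈ Iio ((1 / 2 : ℝ) ^ k)
  · rw [indicator_of_mem h, Pi.one_apply, mul_one,
      Real.enorm_of_nonneg (mul_nonneg (spikeCoeff_pos p k).le (le_max_left _ _))]
    refine ENNReal.ofReal_le_ofReal (mul_le_mul_of_nonneg_left ?_ (spikeCoeff_pos p k).le)
    have h1 : (1 : ℝ) ≤ 2 ^ k := one_le_pow₀ (by norm_num)
    have h2 : 0 ≤ 2 ^ k * s := by positivity
    exact max_le (by positivity) (by linarith)
  · rw [spike_term_eq_zero p h, enorm_zero]; exact zero_le

theorem enorm_spike_sub_le (p : ℝ) {s t : ℝ} (hs : 0 < s) (ht : 0 < t) :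
    ‖spike p s - spike p t‖ₑ ≤ edist s t * (spikeSlope p s + spikeSlope p t) := by
  rw [spike, spike, ← (summable_spike p hs).tsum_sub (summable_spike p ht), spikeSlope, spikeSlope,
    ← ENNReal.tsum_add, ← ENNReal.tsum_mul_left]
  refine (enorm_tsum_le_tsum_enorm).trans (ENNReal.tsum_le_tsum fun k => ?_)
  by_cases h : s ∈ Iio ((1 / 2 : ℝ) ^ k) ∨ t ∈ Iio ((1 / 2 : ℝ) ^ k)
  · have h1 : (1 : ℝ≥0∞) ≤ (Iio ((1 / 2 : ℝ) ^ k)).indicator 1 s +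
        (Iio ((1 / 2 : ℝ) ^ k)).indicator 1 t := by
      rcases h with h | h
      · rw [indicator_of_mem h]; exact le_self_add
      · rw [indicator_of_mem h]; exact le_add_self
    have h2 : |max 0 (1 - 2 ^ k * s) - max 0 (1 - 2 ^ k * t)| ≤ 2 ^ k * |s - t| := by
      rw [max_comm 0, max_comm 0]
      refine (abs_max_sub_max_le_abs _ _ _).trans (le_of_eq ?_)
      rw [show 1 - 2 ^ k * s - (1 - 2 ^ k * t) = -(2 ^ k * (s - t)) by ring, abs_neg, abs_mul,
        abs_of_nonneg (by positivity)]
    calc _ = ENNReal.ofReal (spikeCoeff p k *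
          |max 0 (1 - 2 ^ k * s) - max 0 (1 - 2 ^ k * t)|) := by
          rw [← mul_sub, ← ofReal_norm, Real.norm_eq_abs, abs_mul,
            abs_of_pos (spikeCoeff_pos p k)]
      _ ≤ ENNReal.ofReal (|s - t| * (spikeCoeff p k * 2 ^ k)) := by
          refine ENNReal.ofReal_le_ofReal ?_
          nlinarith [spikeCoeff_pos p k]
      _ = edist s t * (ENNReal.ofReal (spikeCoeff p k * 2 ^ k) * 1) := by
          rw [ENNReal.ofReal_mul (abs_nonneg _), mul_one, edist_dist, Real.dist_eq]
      _ ≤ _ := by rw [← mul_add]; gcongr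
  · rw [not_or] at h
    rw [spike_term_eq_zero p h.1, spike_term_eq_zero p h.2, sub_zero, enorm_zero]
    exact zero_le

theorem continuousOn_spike (p : ℝ) : ContinuousOn (spike p) (Ioi 0) := by
  intro s hs
  have hs0 : 0 < s := hs
  refine ContinuousAt.continuousWithinAt ?_
  rw [ContinuousAt, tendsto_iff_edist_tendsto_0]
  have h1 : Tendsto (fun t => edist t s * (spikeSlope p (s / 2) + spikeSlope p (s / 2)))
      (𝓝 s) (𝓝 0) := by
    have h2 : Tendsto (fun t => edist t s) (𝓝 s) (𝓝 0) := tendsto_iff_edist_tendsto_0.1 tendsto_id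
    have h3 := ENNReal.Tendsto.mul_const (b := spikeSlope p (s / 2) + spikeSlope p (s / 2)) h2
      (Or.inr (ENNReal.add_ne_top.2 ⟨spikeSlope_ne_top p (by positivity),
        spikeSlope_ne_top p (by positivity)⟩))
    rwa [zero_mul] at h3
  refine tendsto_of_tendsto_of_tendsto_of_le_of_le' tendsto_const_nhds h1
    (Eventually.of_forall fun _ => zero_le) ?_
  filter_upwards [lt_mem_nhds (half_lt_self hs0)] with t ht
  rw [edist_eq_enorm_sub]
  refine (enorm_spike_sub_le p (by linarith) hs0).trans (mul_le_mul' le_rfl (add_le_add ?_ ?_))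
  · exact spikeSlope_antitone p ht.le
  · exact spikeSlope_antitone p (by linarith)

theorem le_spike_sub (p : ℝ) (k : ℕ) {s t : ℝ} (hs : 0 < s) (hst : s ≤ t) (ht : 2 ^ k * t ≤ 1) :
    spikeCoeff p k * (2 ^ k * (t - s)) ≤ spike p s - spike p t := by
  have ht0 : 0 < t := hs.trans_le hst
  rw [spike, spike, ← (summable_spike p hs).tsum_sub (summable_spike p ht0)]
  have hmono : ∀ j : ℕ, (2 : ℝ) ^ j * s ≤ 2 ^ j * t := fun j => by gcongr
  refine le_trans (le_of_eq ?_) (((summable_spike p hs).sub (summable_spike p ht0)).le_tsum k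
    fun j _ => ?_)
  · have := hmono k
    rw [max_eq_right (by linarith), max_eq_right (by linarith)]
    ring
  · rw [sub_nonneg]
    refine mul_le_mul_of_nonneg_left (max_le_max le_rfl ?_) (spikeCoeff_pos p j).le
    linarith [hmono j]

/-- The power of `2` in `spikeCoeff` is such that the `L^p`-norms of the slopes are
`(k + 1) ^ (-2)`. -/
theorem lintegral_spikeSlope_lt_top {p : ℝ} (hp : 1 ≤ p) :
    ∫⁻ x : cuspDomain, spikeSlope p ((x : EuclideanSpace ℝ (Fin 2)) 0) ^ p
      ∂(measureOn volume cuspDomain) < ∞ := by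
  have hp0 : 0 < p := by linarith
  have hc : Measurable fun x : cuspDomain => (x : EuclideanSpace ℝ (Fin 2)) 0 :=
    (by fun_prop : Continuous fun x : cuspDomain => (x : EuclideanSpace ℝ (Fin 2)) 0).measurable
  have hI : ∀ k : ℕ, Measurable fun x : cuspDomain =>
      (Iio ((1 / 2 : ℝ) ^ k)).indicator (1 : ℝ → ℝ≥0∞) ((x : EuclideanSpace ℝ (Fin 2)) 0) := fun k =>
    ((measurable_one).indicator measurableSet_Iio).comp hc
  rw [← ENNReal.rpow_lt_top_iff_of_pos (one_div_pos.2 hp0)]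
  refine (lintegral_Lp_tsum_le hp fun k => (hI k).const_mul _).trans_lt ?_
  have hterm : ∀ k : ℕ, (∫⁻ x : cuspDomain, (ENNReal.ofReal (spikeCoeff p k * 2 ^ k) *
      (Iio ((1 / 2 : ℝ) ^ k)).indicator 1 ((x : EuclideanSpace ℝ (Fin 2)) 0)) ^ p
      ∂(measureOn volume cuspDomain)) ^ (1 / p) ≤ ENNReal.ofReal (1 / ((k : ℝ) + 1) ^ 2) := by
    intro k
    have hck : 0 ≤ spikeCoeff p k * 2 ^ k := mul_nonneg (spikeCoeff_pos p k).le (by positivity)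
    have h1 : ∫⁻ x : cuspDomain, (ENNReal.ofReal (spikeCoeff p k * 2 ^ k) *
        (Iio ((1 / 2 : ℝ) ^ k)).indicator 1 ((x : EuclideanSpace ℝ (Fin 2)) 0)) ^ p
        ∂(measureOn volume cuspDomain) ≤
        ENNReal.ofReal (spikeCoeff p k * 2 ^ k) ^ p * ENNReal.ofReal (((1 / 2 : ℝ) ^ k) ^ 3) := by
      simp_rw [ENNReal.mul_rpow_of_nonneg _ _ hp0.le]
      rw [lintegral_const_mul _ ((hI k).pow_const p)]
      refine mul_le_mul' le_rfl ?_
      have h2 : ∀ x : cuspDomain, (Iio ((1 / 2 : ℝ) ^ k)).indicator (1 : ℝ → ℝ≥0∞)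
          ((x : EuclideanSpace ℝ (Fin 2)) 0) ^ p =
          {x : cuspDomain | (x : EuclideanSpace ℝ (Fin 2)) 0 < (1 / 2 : ℝ) ^ k}.indicator 1 x := by
        intro x
        by_cases h : (x : EuclideanSpace ℝ (Fin 2)) 0 < (1 / 2 : ℝ) ^ k
        · rw [indicator_of_mem (show _ ∈ Iio _ from h), indicator_of_mem (show x ∈ {x : cuspDomain |
            (x : EuclideanSpace ℝ (Fin 2)) 0 < (1 / 2 : ℝ) ^ k} from h)]
          simp
        · rw [indicator_of_notMem (show _ ∉ Iio _ from h), indicator_of_notMem (show x ∉ {x :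
            cuspDomain | (x : EuclideanSpace ℝ (Fin 2)) 0 < (1 / 2 : ℝ) ^ k} from h)]
          simp [hp0]
      simp_rw [h2]
      rw [lintegral_indicator_one (measurableSet_lt hc measurable_const), measureOn,
        comap_subtype_coe_apply isOpen_cuspDomain.measurableSet]
      refine (measure_mono ?_).trans (volume_cuspDomain_strip_le _ (by positivity))
      rintro _ ⟨x, hx, rfl⟩
      exact ⟨x.2, hx⟩
    refine (ENNReal.rpow_le_rpow h1 (by positivity)).trans (le_of_eq ?_)
    rw [ENNReal.ofReal_rpow_of_nonneg hck hp0.le, ← ENNReal.ofReal_mul (by positivity),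
      ENNReal.ofReal_rpow_of_nonneg (by positivity) (by positivity)]
    congr 1
    rw [Real.mul_rpow (by positivity) (by positivity), ← Real.rpow_mul hck, mul_one_div_cancel hp0.ne',
      Real.rpow_one, spikeCoeff]
    have h3 : (((1 / 2 : ℝ) ^ k) ^ 3) ^ (1 / p) = 2 ^ (-(3 / p * k)) := by
      rw [one_div 2, inv_pow, ← Real.rpow_natCast 2 k, ← Real.rpow_neg (by norm_num),
        ← Real.rpow_natCast _ 3, ← Real.rpow_mul (by norm_num), ← Real.rpow_mul (by norm_num)]
      congr 1
      push_cast
      ring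
    rw [h3, ← Real.rpow_natCast 2 k, div_mul_eq_mul_div, div_mul_eq_mul_div,
      ← Real.rpow_add (by norm_num), ← Real.rpow_add (by norm_num),
      show (3 / p - 1) * (k : ℝ) + k + -(3 / p * k) = 0 by ring, Real.rpow_zero]
  refine (ENNReal.tsum_le_tsum hterm).trans_lt ?_
  have hs : Summable fun k : ℕ => 1 / ((k : ℝ) + 1) ^ 2 := by
    have := (summable_nat_add_iff 1).2 (Real.summable_one_div_nat_pow.2 one_lt_two)
    simpa using this
  rw [← ENNReal.ofReal_tsum_of_nonneg (fun k => by positivity) hs]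
  exact ENNReal.ofReal_lt_top

theorem ofReal_le_cuspBoundaryMeasure {a b : ℝ} (ha : 0 ≤ a) (hb : b ≤ 1) :
    ENNReal.ofReal (b - a) ≤ cuspBoundaryMeasure {z | (z : EuclideanSpace ℝ (Fin 2)) 1 = 0 ∧
      a < (z : EuclideanSpace ℝ (Fin 2)) 0 ∧ (z : EuclideanSpace ℝ (Fin 2)) 0 < b} := by
  rw [← Real.volume_Ioo]
  refine (measure_mono ?_).trans (volume_image_le_cuspBoundaryMeasure _)
  rintro s ⟨hs1, hs2⟩
  refine ⟨⟨!₂[s, 0], mem_frontier_cuspDomain (ha.trans_lt hs1) (hs2.trans_le hb) (Or.inl rfl)⟩,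
    ⟨?_, ?_, ?_⟩, ?_⟩ <;> simp [hs1, hs2]

/-- The lower bound for the Besov norm of `spike` that is obtained at the scale `t = 2 ^ (-k)`, from
pairs of points on the lower edge of the cusp with distance less than `t` to the tip. -/
theorem le_besovNorm_spike {p : ℝ} (hp : 1 ≤ p) {α : ℝ} {R : ℝ≥0∞} {f : frontier cuspDomain → ℝ}
    (hf : ∀ᵐ z ∂cuspBoundaryMeasure, f z = spike p ((z : EuclideanSpace ℝ (Fin 2)) 0)) (k : ℕ)
    (hk : ENNReal.ofReal ((1 / 2) ^ k) < R) :
    ENNReal.ofReal ((1 / 320) ^ (1 / p) / 8 *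
      (((2 : ℝ) ^ ((2 - p + α * p) / p)) ^ k / (k + 1) ^ 2)) ≤
      besovNorm R α p cuspBoundaryMeasure f := by
  have hp0 : 0 < p := by linarith
  set t : ℝ := (1 / 2) ^ k with ht
  have ht0 : 0 < t := by positivity
  have ht1 : t ≤ 1 := pow_le_one₀ (by norm_num) (by norm_num)
  have h2t : 2 ^ k * t = 1 := by rw [ht, ← mul_pow]; norm_num
  set ν := cuspBoundaryMeasure with hν
  set Y : Set (frontier cuspDomain) := {z | (z : EuclideanSpace ℝ (Fin 2)) 1 = 0 ∧
    0 < (z : EuclideanSpace ℝ (Fin 2)) 0 ∧ (z : EuclideanSpace ℝ (Fin 2)) 0 < t / 8} with hY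
  set W : Set (frontier cuspDomain) := {z | (z : EuclideanSpace ℝ (Fin 2)) 1 = 0 ∧
    t / 4 < (z : EuclideanSpace ℝ (Fin 2)) 0 ∧ (z : EuclideanSpace ℝ (Fin 2)) 0 < t / 2} with hW
  have c0 : Measurable fun z : frontier cuspDomain => (z : EuclideanSpace ℝ (Fin 2)) 0 :=
    (by fun_prop : Continuous fun z : frontier cuspDomain =>
      (z : EuclideanSpace ℝ (Fin 2)) 0).measurable
  have c1 : Measurable fun z : frontier cuspDomain => (z : EuclideanSpace ℝ (Fin 2)) 1 :=
    (by fun_prop : Continuous fun z : frontier cuspDomain =>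
      (z : EuclideanSpace ℝ (Fin 2)) 1).measurable
  have hYm : MeasurableSet Y := (measurableSet_eq_fun c1 measurable_const).inter
    ((measurableSet_lt measurable_const c0).inter (measurableSet_lt c0 measurable_const))
  have hWm : MeasurableSet W := (measurableSet_eq_fun c1 measurable_const).inter
    ((measurableSet_lt measurable_const c0).inter (measurableSet_lt c0 measurable_const))
  have hYν : ENNReal.ofReal (t / 8) ≤ ν Y := by
    have := ofReal_le_cuspBoundaryMeasure le_rfl (by linarith : t / 8 ≤ 1)
    rwa [sub_zero] at this
  have hWν : ENNReal.ofReal (t / 4) ≤ ν W := by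
    have := ofReal_le_cuspBoundaryMeasure (by positivity : 0 ≤ t / 4) (by linarith : t / 2 ≤ 1)
    rwa [show t / 2 - t / 4 = t / 4 by ring] at this
  set A : ℝ := (spikeCoeff p k / 8) ^ p / t ^ (α * p) with hA
  have hc0 := spikeCoeff_pos p k
  have hA0 : 0 ≤ A := by positivity
  -- For `y` in `Y`, the set `W`, of measure at least `t / 4`, is contained in the ball with centre `y`
  -- and radius `t`, which has measure at most `10 t`, and the integrand is at least `A` on `W`.
  have hint : ENNReal.ofReal (A * t / 320) ≤
      ∫⁻ y, ⨍⁻ z in Metric.ball y t, ‖f y - f z‖ₑ ^ p / ENNReal.ofReal (t ^ (α * p)) ∂ν ∂ν := by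
    calc ENNReal.ofReal (A * t / 320)
        = ENNReal.ofReal A * ENNReal.ofReal (t / 4) / ENNReal.ofReal (10 * t) *
            ENNReal.ofReal (t / 8) := by
          rw [← ENNReal.ofReal_mul hA0, ← ENNReal.ofReal_div_of_pos (by positivity),
            ← ENNReal.ofReal_mul (by positivity)]
          congr 1
          field_simp
          ring
      _ ≤ ENNReal.ofReal A * ENNReal.ofReal (t / 4) / ENNReal.ofReal (10 * t) * ν Y := by gcongr
      _ = ∫⁻ _y in Y, ENNReal.ofReal A * ENNReal.ofReal (t / 4) / ENNReal.ofReal (10 * t) ∂ν :=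
          (setLIntegral_const _ _).symm
      _ ≤ ∫⁻ y in Y, ⨍⁻ z in Metric.ball y t,
            ‖f y - f z‖ₑ ^ p / ENNReal.ofReal (t ^ (α * p)) ∂ν ∂ν := by
          refine lintegral_mono_ae ?_
          filter_upwards [ae_restrict_of_ae hf, ae_restrict_mem hYm] with y hfy hyY
          obtain ⟨y1, y2, y3⟩ := hyY
          rw [setLAverage_eq]
          refine ENNReal.div_le_div ?_ (cuspBoundaryMeasure_ball_le y ht0)
          have hsub : W ⊆ Metric.ball y t := by
            rintro z ⟨z1, z2, z3⟩
            rw [Metric.mem_ball, Subtype.dist_eq]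
            refine (dist_le_abs_add_abs _ _).trans_lt ?_
            rw [z1, y1, sub_zero, abs_zero, add_zero, abs_lt]
            constructor <;> linarith
          refine le_trans ?_ (lintegral_mono_set hsub)
          calc ENNReal.ofReal A * ENNReal.ofReal (t / 4) ≤ ENNReal.ofReal A * ν W := by gcongr
            _ = ∫⁻ _z in W, ENNReal.ofReal A ∂ν := (setLIntegral_const _ _).symm
            _ ≤ _ := by
                refine lintegral_mono_ae ?_
                filter_upwards [ae_restrict_of_ae hf, ae_restrict_mem hWm] with z hfz hzW
                obtain ⟨z1, z2, z3⟩ := hzW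
                have h2tz : 2 ^ k * (z : EuclideanSpace ℝ (Fin 2)) 0 ≤ 1 := by
                  rw [← h2t]; gcongr; linarith
                have h1 := le_spike_sub p k y2 (by linarith) h2tz
                have h2 : spikeCoeff p k / 8 ≤ f y - f z := by
                  rw [hfy, hfz]
                  refine le_trans ?_ h1
                  rw [div_eq_mul_one_div]
                  refine mul_le_mul_of_nonneg_left ?_ hc0.le
                  calc (1 : ℝ) / 8 = 2 ^ k * (t / 8) := by rw [← mul_div_assoc, h2t]
                    _ ≤ _ := by gcongr; linarith
                rw [hA, ENNReal.ofReal_div_of_pos (by positivity)]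
                gcongr
                rw [← ENNReal.ofReal_rpow_of_nonneg (by positivity) hp0.le,
                  Real.enorm_of_nonneg (by linarith [div_pos hc0 (by norm_num : (0 : ℝ) < 8)])]
                gcongr
      _ ≤ _ := setLIntegral_le_lintegral _ _
  have hsup : ENNReal.ofReal (A * t / 320) ^ (1 / p) ≤ besovNorm R α p ν f := by
    refine (ENNReal.rpow_le_rpow hint (by positivity)).trans (le_trans ?_ le_add_self)
    exact le_iSup_of_le t (le_iSup₂_of_le ht0 hk le_rfl)
  refine le_trans (le_of_eq ?_) hsup
  rw [ENNReal.ofReal_rpow_of_nonneg (by positivity) (by positivity)]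
  congr 1
  have e1 : A * t / 320 = ((spikeCoeff p k / 8) * 2 ^ ((α * p - 1) / p * k)) ^ p * (1 / 320) := by
    have h3 : t = 2 ^ (-(k : ℝ)) := by
      rw [Real.rpow_neg (by norm_num), Real.rpow_natCast, ht, one_div, inv_pow]
    have h4 : (2 : ℝ) ^ ((α * p - 1) / p * k * p) = t / t ^ (α * p) := by
      rw [h3, ← Real.rpow_mul (by norm_num), ← Real.rpow_sub (by norm_num)]
      congr 1
      field_simp
      ring
    rw [Real.mul_rpow (by positivity) (by positivity), ← Real.rpow_mul (by norm_num), h4, hA]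
    ring
  rw [e1, Real.mul_rpow (by positivity) (by norm_num), ← Real.rpow_mul (by positivity),
    mul_one_div_cancel hp0.ne', Real.rpow_one, spikeCoeff, ← Real.rpow_natCast (2 ^ _) k,
    ← Real.rpow_mul (by norm_num),
    show (2 - p + α * p) / p * (k : ℝ) = (3 / p - 1) * k + (α * p - 1) / p * k by field_simp; ring,
    Real.rpow_add (by norm_num)]
  ring

theorem besovNorm_spike_eq_top {p : ℝ} (hp : 1 ≤ p) {α : ℝ} (hα : 1 - 2 / p < α) {R : ℝ≥0∞}
    (hR : 0 < R) {f : frontier cuspDomain → ℝ}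
    (hf : ∀ᵐ z ∂cuspBoundaryMeasure, f z = spike p ((z : EuclideanSpace ℝ (Fin 2)) 0)) :
    besovNorm R α p cuspBoundaryMeasure f = ∞ := by
  have hp0 : 0 < p := by linarith
  set b : ℝ := 2 ^ ((2 - p + α * p) / p) with hb
  have hb1 : 1 < b := by
    refine Real.one_lt_rpow (by norm_num) (div_pos ?_ hp0)
    have h1 : (1 - 2 / p) * p < α * p := by gcongr
    rw [sub_mul, div_mul_cancel₀ _ hp0.ne', one_mul] at h1
    linarith
  have h1 : Tendsto (fun k : ℕ => ((k : ℝ) + 1) ^ 2 / b ^ k) atTop (𝓝[>] 0) := by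
    refine tendsto_nhdsWithin_iff.2 ⟨?_, Eventually.of_forall fun k => by
      simp only [mem_Ioi]; positivity⟩
    have h2 := ((tendsto_add_atTop_iff_nat 1).2
      (tendsto_pow_const_div_const_pow_of_one_lt 2 hb1)).mul_const b
    rw [zero_mul] at h2
    refine h2.congr fun k => ?_
    push_cast
    rw [pow_succ b]
    field_simp
  have h3 : Tendsto (fun k : ℕ => b ^ k / ((k : ℝ) + 1) ^ 2) atTop atTop := by
    refine (tendsto_inv_nhdsGT_zero.comp h1).congr fun k => ?_
    simp
  have hκ : (0 : ℝ) < (1 / 320) ^ (1 / p) / 8 := by positivity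
  have h4 := ENNReal.tendsto_ofReal_atTop.comp (h3.const_mul_atTop hκ)
  have h5 : Tendsto (fun k : ℕ => ENNReal.ofReal ((1 / 2 : ℝ) ^ k)) atTop (𝓝 0) := by
    have := ENNReal.tendsto_ofReal (tendsto_pow_atTop_nhds_zero_of_lt_one
      (by norm_num : (0 : ℝ) ≤ 1 / 2) (by norm_num))
    rwa [ENNReal.ofReal_zero] at this
  refine top_le_iff.1 (le_of_tendsto h4 ?_)
  filter_upwards [h5.eventually (gt_mem_nhds hR)] with k hk
  exact le_besovNorm_spike hp hf k hk

theorem exists_trace_not_smooth_cusp {p : ℝ} (hp : 1 ≤ p)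
    {T : HajlaszSpace p hp (measureOn volume cuspDomain) →ₗ[ℝ]
      (frontier cuspDomain →ₘ[cuspBoundaryMeasure] ℝ)}
    (hT : IsBoundedTraceOperator volume cuspDomain (frontier cuspDomain) cuspBoundaryMeasure
      (HajlaszSpace p hp (measureOn volume cuspDomain))
      (hajlaszNorm p (measureOn volume cuspDomain)) (1 - 2 / p) p T) :
    ∃ u, (∀ R : ℝ≥0∞, 0 < R → besovNorm R (1 - 2 / p) p cuspBoundaryMeasure (T u) < ∞) ∧
      ∀ α : ℝ, 1 - 2 / p < α → ∀ R : ℝ≥0∞, 0 < R →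
        besovNorm R α p cuspBoundaryMeasure (T u) = ∞ := by
  have hp0 : 0 < p := by linarith
  obtain ⟨c, hD⟩ := isDoublingOn_cuspDomain.exists_isDoublingWith isOpen_cuspDomain
  have c0 : Continuous fun x : cuspDomain => (x : EuclideanSpace ℝ (Fin 2)) 0 := by fun_prop
  have hpos : ∀ x : cuspDomain, 0 < (x : EuclideanSpace ℝ (Fin 2)) 0 := fun x =>
    (mem_cuspDomain_iff.1 x.2).1.1
  have hcont : Continuous fun x : cuspDomain => spike p ((x : EuclideanSpace ℝ (Fin 2)) 0) :=
    (continuousOn_spike p).comp_continuous c0 hpos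
  set v : cuspDomain →ₘ[measureOn volume cuspDomain] ℝ :=
    AEEqFun.mk _ hcont.aestronglyMeasurable with hv
  have hvs : ∀ᵐ x ∂measureOn volume cuspDomain, v x = spike p ((x : EuclideanSpace ℝ (Fin 2)) 0) :=
    AEEqFun.coeFn_mk _ hcont.aestronglyMeasurable
  have hvN : hajlaszNorm p (measureOn volume cuspDomain) v < ∞ := by
    refine (hajlaszNorm_lt_top_iff hp).2 ⟨?_, fun x =>
      spikeSlope p ((x : EuclideanSpace ℝ (Fin 2)) 0), ⟨?_, _, ae_iff.1 hvs, ?_⟩,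
      lintegral_spikeSlope_lt_top hp⟩
    · refine (lintegral_mono_ae ?_).trans_lt (lintegral_spikeSlope_lt_top hp)
      filter_upwards [hvs] with x hx
      rw [hx]
      exact ENNReal.rpow_le_rpow (enorm_spike_le p _ (hpos x)) hp0.le
    · exact ((measurable_spikeSlope p).comp c0.measurable).aemeasurable
    · intro x hx y hy
      rw [mem_ofPred_eq, not_not] at hx hy
      rw [hx, hy]
      refine (enorm_spike_sub_le p (hpos x) (hpos y)).trans (mul_le_mul' ?_ le_rfl)
      rw [edist_dist, edist_dist, Real.dist_eq, Subtype.dist_eq]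
      exact ENNReal.ofReal_le_ofReal (abs_sub_le_dist _ _ 0)
  -- At each boundary point except the tip, the trace exists by continuity.
  have htrace : ∀ z : frontier cuspDomain, (z : EuclideanSpace ℝ (Fin 2)) 0 ≠ 0 →
      Tendsto (meanDev (measureOn volume cuspDomain) v
        (spike p ((z : EuclideanSpace ℝ (Fin 2)) 0)) (z : EuclideanSpace ℝ (Fin 2)))
        (𝓝[>] 0) (𝓝 0) := by
    intro z hz
    have hz0 : 0 < (z : EuclideanSpace ℝ (Fin 2)) 0 :=
      (closure_cuspDomain_subset (frontier_subset_closure z.2)).1.1.lt_of_ne' hz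
    have hca : ContinuousAt (fun x : EuclideanSpace ℝ (Fin 2) => spike p (x 0))
        (z : EuclideanSpace ℝ (Fin 2)) := by
      refine ContinuousAt.comp (f := fun x : EuclideanSpace ℝ (Fin 2) => x 0)
        ((continuousOn_spike p).continuousAt (Ioi_mem_nhds hz0)) ?_
      exact (by fun_prop : Continuous fun x : EuclideanSpace ℝ (Fin 2) => x 0).continuousAt
    rw [meanDev_congr hvs, ENNReal.tendsto_nhds_zero]
    intro ε hε
    obtain ⟨δ, hδ, hball⟩ := Metric.eventually_nhds_iff_ball.1
      ((tendsto_iff_edist_tendsto_0.1 hca).eventually (ge_mem_nhds hε))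
    filter_upwards [Ioo_mem_nhdsGT hδ] with r hr
    refine le_trans (laverage_mono_ae ?_) (setLAverage_const_le (relBall cuspDomain
      (z : EuclideanSpace ℝ (Fin 2)) r) ε)
    filter_upwards [ae_restrict_mem (Metric.isOpen_ball.measurableSet.preimage
      measurable_subtype_coe)] with x hx
    rw [← edist_eq_enorm_sub]
    exact hball x (Metric.ball_subset_ball hr.2.le hx)
  have htip : ∀ᵐ z : frontier cuspDomain ∂cuspBoundaryMeasure,
      (z : EuclideanSpace ℝ (Fin 2)) 0 ≠ 0 := by
    have hsub : {z : frontier cuspDomain | ¬ (z : EuclideanSpace ℝ (Fin 2)) 0 ≠ 0}.Subsingleton := by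
      intro y hy z hz
      rw [mem_ofPred_eq, not_not] at hy hz
      obtain ⟨-, y3, y4⟩ := closure_cuspDomain_subset (frontier_subset_closure y.2)
      obtain ⟨-, z3, z4⟩ := closure_cuspDomain_subset (frontier_subset_closure z.2)
      rw [hy] at y4
      rw [hz] at z4
      ext i
      fin_cases i
      · exact hy.trans hz.symm
      · show (y : EuclideanSpace ℝ (Fin 2)) 1 = (z : EuclideanSpace ℝ (Fin 2)) 1
        norm_num at y4 z4
        linarith
    have : NullSingletonClass cuspBoundaryMeasure :=
      Measure.nullSingletonClass_hausdorff (frontier cuspDomain) one_pos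
    exact ae_iff.2 (hsub.measure_zero _)
  set u : HajlaszSpace p hp (measureOn volume cuspDomain) := ⟨v, hvN⟩ with hu
  have hTu : ∀ᵐ z ∂cuspBoundaryMeasure, T u z = spike p ((z : EuclideanSpace ℝ (Fin 2)) 0) := by
    have h1 : ∀ᵐ z ∂cuspBoundaryMeasure,
        Tendsto (meanDev (measureOn volume cuspDomain) v (T u z) (z : EuclideanSpace ℝ (Fin 2)))
          (𝓝[>] 0) (𝓝 0) := hT.1 u
    filter_upwards [h1, htip] with z hz1 hz2
    exact hD.eq_of_tendsto_meanDev (AEEqFun.measurable v) (frontier_subset_closure z.2) hz1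
      (htrace z hz2)
  refine ⟨u, fun R hR => ?_, fun α hα R hR => besovNorm_spike_eq_top hp hα hR hTu⟩
  obtain ⟨C, hC⟩ := hT.2 R hR
  exact (hC u).trans_lt (ENNReal.mul_lt_top ENNReal.coe_lt_top hvN)

end Spike

end

theorem theorem1p2 :
    -- boundedness of the trace operator on `M^{1,p}(Ω)` and on `N^{1,p}(Ω)`
    (∀ (X : Type*) [MetricSpace X] [MeasurableSpace X] [BorelSpace X]
        (μ : Measure X) (Ω F : Set X) (ν : Measure F) (θ p : ℝ) (hp : 1 ≤ p),
      IsOpen Ω → IsConnected Ω → IsDoublingOn μ Ω →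
      F ⊆ closure Ω → Bornology.IsBounded F →
      0 < θ → HasUpperCodimBound μ Ω F ν θ → θ < p →
      (∃ T : HajlaszSpace p hp (measureOn μ Ω) →ₗ[ℝ] (F →ₘ[ν] ℝ),
        IsBoundedTraceOperator μ Ω F ν (HajlaszSpace p hp (measureOn μ Ω))
          (hajlaszNorm p (measureOn μ Ω)) (1 - θ / p) p T) ∧
      (HasPoincareInequality p (measureOn μ Ω) →
        ∃ T : NewtonSpace p hp (measureOn μ Ω) →ₗ[ℝ] (F →ₘ[ν] ℝ),
          IsBoundedTraceOperator μ Ω F ν (NewtonSpace p hp (measureOn μ Ω))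
            (newtonNorm p (measureOn μ Ω)) (1 - θ / p) p T)) ∧
    -- the cusp satisfies the hypotheses with `θ = 2`
    (IsOpen cuspDomain ∧ IsConnected cuspDomain ∧ Bornology.IsBounded cuspDomain ∧
      IsDoublingOn volume cuspDomain ∧
      HasUpperCodimBound volume cuspDomain (frontier cuspDomain) cuspBoundaryMeasure 2) ∧
    -- failure of surjectivity and of higher smoothness in the cusp, for every `p ∈ (2, 3)`
    (∀ (p : ℝ) (hp : 1 ≤ p), 2 < p → p < 3 →
      ∃ T : HajlaszSpace p hp (measureOn volume cuspDomain) →ₗ[ℝ]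
          (frontier cuspDomain →ₘ[cuspBoundaryMeasure] ℝ),
        IsBoundedTraceOperator volume cuspDomain (frontier cuspDomain) cuspBoundaryMeasure
          (HajlaszSpace p hp (measureOn volume cuspDomain))
          (hajlaszNorm p (measureOn volume cuspDomain)) (1 - 2 / p) p T ∧
        (∃ f : frontier cuspDomain →ₘ[cuspBoundaryMeasure] ℝ,
          (∀ R : ℝ≥0∞, 0 < R → besovNorm R (1 - 2 / p) p cuspBoundaryMeasure f < ∞) ∧
          ∀ u, T u ≠ f) ∧
        (∃ u,
          (∀ R : ℝ≥0∞, 0 < R → besovNorm R (1 - 2 / p) p cuspBoundaryMeasure (T u) < ∞) ∧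
          ∀ α : ℝ, 1 - 2 / p < α → ∀ R : ℝ≥0∞, 0 < R →
            besovNorm R α p cuspBoundaryMeasure (T u) = ∞)) := by
  refine ⟨?_, ?_, ?_⟩
  · intro X _ _ _ μ Ω F ν θ p hp hΩ _ hD hF hb hθ hν hθp
    exact ⟨exists_isBoundedTraceOperator_hajlasz hp hΩ hD hF hb hθ hν hθp,
      exists_isBoundedTraceOperator_newton hp hΩ hD hF hb hθ hν hθp⟩
  · exact ⟨isOpen_cuspDomain, isConnected_cuspDomain,
      isBounded_closure_cuspDomain.subset subset_closure, isDoublingOn_cuspDomain,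
      hasUpperCodimBound_cuspDomain⟩
  · intro p hp hp2 hp3
    obtain ⟨T, hT⟩ := exists_isBoundedTraceOperator_hajlasz hp isOpen_cuspDomain
      isDoublingOn_cuspDomain frontier_subset_closure
      (isBounded_closure_cuspDomain.subset frontier_subset_closure) two_pos
      hasUpperCodimBound_cuspDomain hp2
    exact ⟨T, hT, exists_besov_not_trace_cusp hp hp2 hT.1, exists_trace_not_smooth_cusp hp hT⟩
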